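/- **Setting.** Let $d\ge 2$, $\mathcal U_d=\{\pm e_i\}_{i=1}^d$, and let $\Omega=\{0,1\}^{\mathbb B_d}$ (bond percolation, $\mathbb B_d$ the nearest-neighbour edges of $\mathbb Z^d$) or $\Omega=\{0,1\}^{\mathbb Z^d}$ (site percolation), with the product topology and $\sigma$-algebra and the shifts $(\tau_x\omega)_b=\omega_{x+b}$. Each $\omega$ determines a graph on $\mathbb Z^d$ of open edges (in the site model an edge is open if both endpoints are open); $\mathrm d_{\rm ch}$ is its graph distance, and $\mathcal C_\infty(\omega)$ is its infinite cluster (the set of all vertices lying in an infinite connected component). For $e\in\mathcal U_d$, "$\omega_e=1$" means that the edge from $0$ to $e$ is open. Put $\Omega_0=\{0\in\mathcal C_\infty\}$ and, for $\omega\in\Omega_0$, $k(\omega,e)=\inf\{k\ge1:\tau_{ke}\omega\in\Omega_0\}$, $v_e=k(\omega,e)e$, and $\pi_\omega(0,e)=\mathbf 1_{\{\omega_e=1\}}/\sum_{e'\in\mathcal U_d}\mathbf 1_{\{\omega_{e'}=1\}}$. Let $\mathbb P$ be a probability measure on $\Omega$, put $\mathbb P_0=\mathbb P(\cdot\mid\Omega_0)$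 with expectation $\mathbb E_0$, and assume: 1. $\mathbb P$-a.s. there is a unique infinite cluster. 2. $\mathbb P$ is invariant and ergodic under $\tau_x$ for every $x\ne0$. 3. There are $c_1,\dots,c_4>0$ with $\mathbb P[\mathrm d_{\rm ch}(0,x)\ge c_1|x|_1,\ 0,x\in\mathcal C_\infty]\le c_2\exp(-c_3(\log|x|_1)^{1+c_4})$ for all $x\neq 0$. 4. There are $c_5,c_6>0$ with $\mathbb P_0[\mathrm d_{\rm ch}(0,v_e)>n]\le c_5e^{-c_6n}$ for all $e\in\mathcal U_d$ and $n\in\mathbb N$. 5. $\mathbb P(A\cap B)\ge\mathbb P(A)\mathbb P(B)$ for all increasing events $A,B$. **Lower variational formula.** For a probability measure $\mu$ on $\Omega_0\times\mathcal U_d$ let $(\mu)_1$ and $(\mu)_2$ be its images under $(\omega,e)\mapsto\omega$ and $(\omega,e)\mapsto\tau_e\omega$. Let $\mathcal M_1^\star$ be the set of those $\mu$ with $(\mu)_1=(\mu)_2\ll\mathbb P_0$ such that, $\mathbb P_0$-a.s., for every $e$, $\frac{d\mu(\omega,e)}{d(\mu)_1(\omega)}>0$ if and only if $\omega_e=1$.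 For $\mu\in\mathcal M_1^\star$ set $$\mathfrak I(\mu)=\int\sum_{e\in\mathcal U_d}d\mu(\omega,e)\,\log\frac{d\mu(\omega,e)}{d(\mu)_1(\omega)\,\pi_\omega(0,e)},\qquad\text{and set}\qquad \overline H(f)=\sup_{\mu\in\mathcal M_1^\star}\{\langle f,\mu\rangle-\mathfrak I(\mu)\}.$$ Let also $$\overline H_{\rm s}(f)=\sup_{\phi}\ \sup_{\tilde\pi\in\widetilde\Pi}\ \inf_{g}\int d\mathbb P_0\,\phi(\omega)\sum_{e\in\mathcal U_d}\tilde\pi(\omega,e)\Big(f(\omega,e)-\log\frac{\tilde\pi(\omega,e)}{\pi_\omega(0,e)}+g(\omega)-g(\tau_e\omega)\Big),$$ where $\phi\ge0$ ranges over the measurable functions with $\mathbb E_0\phi=1$, $g$ over the bounded measurable functions, and $\widetilde\Pi$ is the set of $\tilde\pi:\Omega_0\times\mathcal U_d\to[0,1]$, measurable in $\omega$, with $\sum_e\tilde\pi(\omega,e)=1$ for $\mathbb P_0$-a.e. $\omega$ and $\tilde\pi(\omega,e)=0\iff\pi_\omega(0,e)=0$ for all $\omega\in\Omega_0$, $e\in\mathcal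 U_d$ (terms with $\tilde\pi(\omega,e)=0$ are read as $0$). **Gradients.** $\mathcal G_\infty$ is the class of $G:\Omega_0\times\mathcal U_d\to\mathbb R$, measurable in $\omega$, such that * for every $e\in\mathcal U_d$, $G(\cdot,e)$ is $\mathbb P_0$-essentially bounded; * $\mathbb P_0$-a.s., $\sum_{j=0}^{n-1}G(\tau_{x_j}\omega,x_{j+1}-x_j)=0$ for every closed open nearest-neighbour path $x_0,\dots,x_n=x_0$ in $\mathcal C_\infty$; * for every $e\in\mathcal U_d$, the sum $V_G(\omega,v_e)=\sum_{i=0}^{k-1}G(\tau_{x_i}\omega,x_{i+1}-x_i)$ along an open path $0=x_0,\dots,x_k=v_e$ (a.s. independent of the path) is $\mathbb P_0$-integrable with $\mathbb E_0[V_G(\cdot,v_e)]=0$. **Theorem 5.1 (Equivalence of bounds).** For every bounded continuous $f:\Omega_0\times\mathcal U_d\to\mathbb R$, $$\overline H(f)=\overline H_{\rm s}(f)=\inf_{G\in\mathcal G_\infty}\ \operatorname*{ess\,sup}_{\mathbb P_0}\ \log\sum_{e\in\mathcal U_d}\mathbf 1_{\{\omega_e=1\}}\,\pi_\omega(0,e)\,\exp\{f(\omega,e)+G(\omega,e)\}.$$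 -/

import Mathlib

open MeasureTheory ProbabilityTheory Set
open scoped ENNReal

noncomputable section

namespace Perc

/-! ### The lattice, percolation configurations and clusters -/

abbrev Lat (d : ℕ) : Type := Fin d → ℤ

/-- The norm `|x|_1`. -/
def l1 {d : ℕ} (x : Lat d) : ℤ := ∑ i, |x i|

/-- The nearest neighbour graph of `ℤ^d`. -/
def lattice (d : ℕ) : SimpleGraph (Lat d) where
  Adj x y := l1 (y - x) = 1
  symm := ⟨fun x y h => by
    have : l1 (x - y) = l1 (y - x) := by
      unfold l1
      exact Finset.sum_congr rfl fun i _ => abs_sub_comm _ _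
    exact this.trans h⟩
  loopless := ⟨fun x h => by simp [l1] at h⟩

/-- The set `𝒰_d = {± e_i}` of nearest neighbours of the origin. -/
abbrev Dir (d : ℕ) : Type := {e : Lat d // l1 e = 1}

theorem finite_dir (d : ℕ) : Finite (Dir d) := by
  have hfin : (Set.Icc (fun _ => -1 : Lat d) (fun _ => 1)).Finite := Set.finite_Icc _ _
  refine (hfin.subset ?_ : ({e : Lat d | l1 e = 1}).Finite).to_subtype
  intro e he
  have key : ∀ i, |e i| ≤ 1 := fun i =>
    (Finset.single_le_sum (f := fun i => |e i|) (fun j _ => abs_nonneg _)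
      (Finset.mem_univ i)).trans (le_of_eq he)
  exact ⟨fun i => (abs_le.mp (key i)).1, fun i => (abs_le.mp (key i)).2⟩

instance instFintypeDir (d : ℕ) : Fintype (Dir d) :=
  haveI := finite_dir d
  Fintype.ofFinite _

/-- The two types of percolation models. -/
inductive Model : Type
  | bond
  | site

/-- The index set of a configuration: the nearest neighbour edges for bond percolation,
the vertices for site percolation. -/
def Index (d : ℕ) : Model → Type
  | .bond => (lattice d).edgeSet
  | .site => Lat d

/-- The configuration space `Ω = {0,1}^{index set}`, with the product topology and
the product `σ`-algebra (`true` means open). -/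
abbrev Config (d : ℕ) (m : Model) : Type := Index d m → Bool

theorem map_mem_edgeSet {d : ℕ} (x : Lat d) (b : Sym2 (Lat d)) (hb : b ∈ (lattice d).edgeSet) :
    Sym2.map (x + ·) b ∈ (lattice d).edgeSet := by
  induction b using Sym2.ind with
  | _ u v =>
    have h : l1 (v - u) = 1 := hb
    have h2 : l1 ((x + v) - (x + u)) = 1 := by rw [add_sub_add_left_eq_sub]; exact h
    exact h2

/-- Translation `b ↦ x + b` of edges, resp. vertices. -/
def translate {d : ℕ} (x : Lat d) : {m : Model} → Index d m → Index d m
  | .bond, b => ⟨Sym2.map (x + ·) b.1, map_mem_edgeSet x b.1 b.2⟩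
  | .site, v => x + (show Lat d from v)

/-- The shift `(τ_x ω)_b = ω_{x + b}`. -/
def shift {d : ℕ} {m : Model} (x : Lat d) (ω : Config d m) : Config d m :=
  fun b => ω (translate x b)

/-- The random subgraph of `ℤ^d` of open edges. For site percolation an edge is open when both of
its endpoints are open; closed vertices are isolated. -/
def openGraph {d : ℕ} : {m : Model} → Config d m → SimpleGraph (Lat d)
  | .bond, ω => SimpleGraph.fromEdgeSet {b | ∃ h : b ∈ (lattice d).edgeSet, ω ⟨b, h⟩ = true}
  | .site, ω =>
    { Adj := fun x y => (lattice d).Adj x y ∧ ω x = true ∧ ω y = true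
      symm := ⟨fun _ _ h => ⟨h.1.symm, h.2.2, h.2.1⟩⟩
      loopless := ⟨fun x h => (lattice d).loopless.irrefl x h.1⟩ }

theorem openGraph_le {d : ℕ} {m : Model} (ω : Config d m) : openGraph ω ≤ lattice d := by
  intro x y h
  cases m with
  | bond =>
    obtain ⟨⟨h1, _⟩, _⟩ := (SimpleGraph.fromEdgeSet_adj _).mp h
    exact h1
  | site => exact h.1

/-- The infinite cluster `𝒞_∞(ω)`: all vertices that lie in an infinite cluster (which is
almost surely unique under the standing assumptions). -/
def infCluster {d : ℕ} {m : Model} (ω : Config d m) : Set (Lat d) :=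
  {x | ((openGraph ω).connectedComponentMk x).supp.Infinite}

/-- `Ω_0 = {0 ∈ 𝒞_∞}`. -/
def Omega0 (d : ℕ) (m : Model) : Set (Config d m) := {ω | 0 ∈ infCluster ω}

/-- The conditional law `ℙ_0 = ℙ( · | Ω_0)`. -/
def P0 {d : ℕ} {m : Model} (P : Measure (Config d m)) : Measure (Config d m) :=
  ProbabilityTheory.cond P (Omega0 d m)

/-- `k(ω,e) = inf {k ≥ 1 : τ_{ke} ω ∈ Ω_0}`. -/
def arrival {d : ℕ} {m : Model} (ω : Config d m) (e : Dir d) : ℕ :=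
  sInf {k : ℕ | 1 ≤ k ∧ shift (k • e.1) ω ∈ Omega0 d m}

/-- The first arrival point `v_e = k(ω,e) e`. -/
def arrivalPoint {d : ℕ} {m : Model} (ω : Config d m) (e : Dir d) : Lat d :=
  arrival ω e • e.1

/-- The graph (chemical) distance in the open subgraph. -/
def chemDist {d : ℕ} {m : Model} (ω : Config d m) (x y : Lat d) : ℕ := (openGraph ω).dist x y

/-- The standing assumptions on the law `ℙ` of the percolation configuration. -/
structure Admissible {d : ℕ} {m : Model} (P : Measure (Config d m)) : Prop where
  /-- There is almost surely a unique infinite cluster. -/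
  unique_cluster :
    ∀ᵐ ω ∂P, ∃! C : (openGraph ω).ConnectedComponent, C.supp.Infinite
  /-- `ℙ` is invariant and ergodic under each nontrivial shift. -/
  ergodic : ∀ x : Lat d, x ≠ 0 → Ergodic (shift x) P
  /-- The chemical distance on the infinite cluster is comparable to the lattice distance. -/
  chem_dist : ∃ c₁ c₂ c₃ c₄ : ℝ, 0 < c₁ ∧ 0 < c₂ ∧ 0 < c₃ ∧ 0 < c₄ ∧ ∀ x : Lat d, x ≠ 0 →
    P.real {ω | c₁ * (l1 x : ℝ) ≤ (chemDist ω 0 x : ℝ) ∧ 0 ∈ infCluster ω ∧ x ∈ infCluster ω}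
      ≤ c₂ * Real.exp (-c₃ * (Real.log (l1 x : ℝ)) ^ (1 + c₄))
  /-- The chemical distance to the first arrival point has exponential tails. -/
  arrival_tail : ∃ c₅ c₆ : ℝ, 0 < c₅ ∧ 0 < c₆ ∧ ∀ (e : Dir d) (n : ℕ),
    (P0 P).real {ω | n < chemDist ω 0 (arrivalPoint ω e)} ≤ c₅ * Real.exp (-c₆ * n)
  /-- The FKG inequality. -/
  fkg : ∀ A B : Set (Config d m), MeasurableSet A → MeasurableSet B → IsUpperSet A →
    IsUpperSet B → P A * P B ≤ P (A ∩ B)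

/-! ### The random walk kernel and the class of gradients -/

/-- The indicator of `ω_e = 1`: on `Ω_0`, the step from `0` to `e` is possible. -/
def openInd {d : ℕ} {m : Model} (ω : Config d m) (e : Dir d) : ℝ :=
  open Classical in if (openGraph ω).Adj 0 e.1 then 1 else 0

/-- `π_ω(0,e)`, the transition probability of the simple random walk on the cluster. -/
def stepProb {d : ℕ} {m : Model} (ω : Config d m) (e : Dir d) : ℝ :=
  openInd ω e / ∑ e', openInd ω e'

/-- The direction `y - x` of a directed open edge `(x,y)`. -/
def dartDir {d : ℕ} {m : Model} {ω : Config d m} (a : (openGraph ω).Dart) : Dir d :=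
  ⟨a.snd - a.fst, openGraph_le ω a.adj⟩

/-- `∑_j G(τ_{x_j} ω, x_{j+1} - x_j)` along an open path `x_0, …, x_n`. -/
def pathSum {d : ℕ} {m : Model} (G : Config d m → Dir d → ℝ) (ω : Config d m) {x y : Lat d}
    (w : (openGraph ω).Walk x y) : ℝ :=
  (w.darts.map fun a => G (shift a.fst ω) (dartDir a)).sum

/-- The corrector `V_G(ω,x)`: the sum of `G` along some open path from `0` to `x`
(the path does not matter when `G` sums to zero along closed loops). -/
def corrector {d : ℕ} {m : Model} (G : Config d m → Dir d → ℝ) (ω : Config d m) (x : Lat d) : ℝ :=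
  open Classical in
  if h : (openGraph ω).Reachable 0 x then pathSum G ω h.some else 0

/-- The class `𝒢_∞` of gradients. -/
structure GradientClass {d : ℕ} {m : Model} (P : Measure (Config d m))
    (G : Config d m → Dir d → ℝ) : Prop where
  measurable : ∀ e, Measurable fun ω => G ω e
  /-- Uniform boundedness. -/
  bounded : ∀ e, ∃ A : ℝ, ∀ᵐ ω ∂(P0 P), |G ω e| ≤ A
  /-- Closed loop property on the infinite cluster. -/
  closed_loop : ∀ᵐ ω ∂(P0 P), ∀ x ∈ infCluster ω, ∀ w : (openGraph ω).Walk x x,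
    pathSum G ω w = 0
  /-- Zero induced mean. -/
  mean_zero : ∀ e, Integrable (fun ω => corrector G ω (arrivalPoint ω e)) (P0 P) ∧
    ∫ ω, corrector G ω (arrivalPoint ω e) ∂(P0 P) = 0

/-- `Λ(f,G)`, the essential supremum under `ℙ_0` of
`log ∑_e 1{ω_e = 1} π_ω(0,e) exp(f(ω,e) + G(ω,e))`. -/
def Lam {d : ℕ} {m : Model} (P : Measure (Config d m)) (f : Config d m × Dir d → ℝ)
    (G : Config d m → Dir d → ℝ) : EReal :=
  essSup (fun ω => ((Real.log (∑ e, openInd ω e * stepProb ω e *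
    Real.exp (f (ω, e) + G ω e)) : ℝ) : EReal)) (P0 P)

/-- `inf_{G ∈ 𝒢_∞} Λ(f,G)`. -/
def infLam {d : ℕ} {m : Model} (P : Measure (Config d m)) (f : Config d m × Dir d → ℝ) : EReal :=
  ⨅ (G : Config d m → Dir d → ℝ) (_ : GradientClass P G), Lam P f G

/-! ### The lower bound variational formula -/

/-- The measure `μ( · × {e})`. -/
def slice {d : ℕ} {m : Model} (μ : Measure (Config d m × Dir d)) (e : Dir d) :
    Measure (Config d m) :=
  (μ.restrict (univ ×ˢ {e})).map Prod.fst

/-- The first marginal `(μ)_1`. -/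
def marg1 {d : ℕ} {m : Model} (μ : Measure (Config d m × Dir d)) : Measure (Config d m) :=
  μ.map Prod.fst

/-- The second marginal `(μ)_2`, the image of `μ` under `(ω,e) ↦ τ_e ω`. -/
def marg2 {d : ℕ} {m : Model} (μ : Measure (Config d m × Dir d)) : Measure (Config d m) :=
  μ.map fun q => shift q.2.1 q.1

/-- The density `dμ(ω,e) / d(μ)_1(ω)`. -/
def condStep {d : ℕ} {m : Model} (μ : Measure (Config d m × Dir d)) (ω : Config d m)
    (e : Dir d) : ℝ≥0∞ :=
  (slice μ e).rnDeriv (marg1 μ) ω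

/-- The class `ℳ_1^⋆` of probability measures on `Ω_0 × 𝒰_d`. -/
structure MStar {d : ℕ} {m : Model} (P : Measure (Config d m))
    (μ : Measure (Config d m × Dir d)) : Prop where
  prob : IsProbabilityMeasure μ
  supported : μ ((Omega0 d m)ᶜ ×ˢ univ) = 0
  marginals : marg1 μ = marg2 μ
  ac : marg1 μ ≪ P0 P
  pos_iff : ∀ᵐ ω ∂(P0 P), ∀ e : Dir d, 0 < condStep μ ω e ↔ (openGraph ω).Adj 0 e.1

/-- The relative entropy functional `𝔍`, with value `∞` off `ℳ_1^⋆`. -/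
def entropyI {d : ℕ} {m : Model} (P : Measure (Config d m))
    (μ : Measure (Config d m × Dir d)) : EReal :=
  open Classical in
  if MStar P μ then
    ((∫ q, Real.log ((condStep μ q.1 q.2).toReal / stepProb q.1 q.2) ∂μ : ℝ) : EReal)
  else ⊤

/-- `H̄(f) = sup_{μ ∈ ℳ_1^⋆} (⟨f, μ⟩ - 𝔍(μ))`. -/
def HBar {d : ℕ} {m : Model} (P : Measure (Config d m)) (f : Config d m × Dir d → ℝ) : EReal :=
  ⨆ (μ : Measure (Config d m × Dir d)) (_ : MStar P μ),
    (((∫ q, f q ∂μ : ℝ) : EReal) - entropyI P μ)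

/-- A probability density with respect to `ℙ_0`. -/
structure IsDensity {d : ℕ} {m : Model} (P : Measure (Config d m)) (φ : Config d m → ℝ) :
    Prop where
  measurable : Measurable φ
  nonneg : ∀ ω, 0 ≤ φ ω
  integrable : Integrable φ (P0 P)
  integral_eq_one : ∫ ω, φ ω ∂(P0 P) = 1

/-- The class `Π̃` of transition kernels with the same zeros as `π`. -/
structure IsKernel {d : ℕ} {m : Model} (P : Measure (Config d m)) (k : Config d m → Dir d → ℝ) :
    Prop where
  measurable : ∀ e, Measurable fun ω => k ω e
  mem_Icc : ∀ ω e, k ω e ∈ Icc (0 : ℝ) 1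
  sum_eq_one : ∀ᵐ ω ∂(P0 P), ∑ e, k ω e = 1
  zero_iff : ∀ ω ∈ Omega0 d m, ∀ e, k ω e = 0 ↔ stepProb ω e = 0

/-- The same quantity written as a saddle: the supremum over densities `φ` and kernels `π̃ ∈ Π̃` of
the infimum over bounded measurable `g` of
`∫ φ ∑_e π̃(ω,e) (f(ω,e) - log (π̃(ω,e) / π_ω(0,e)) + g(ω) - g(τ_e ω)) dℙ_0`. -/
def HBarSaddle {d : ℕ} {m : Model} (P : Measure (Config d m)) (f : Config d m × Dir d → ℝ) :
    EReal :=
  ⨆ (φ : Config d m → ℝ) (_ : IsDensity P φ) (k : Config d m → Dir d → ℝ) (_ : IsKernel P k),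
    ⨅ (g : Config d m → ℝ) (_ : Measurable g ∧ ∃ C : ℝ, ∀ ω, |g ω| ≤ C),
      ((∫ ω, φ ω * ∑ e, k ω e * (f (ω, e) - Real.log (k ω e / stepProb ω e)
        + (g ω - g (shift e.1 ω))) ∂(P0 P) : ℝ) : EReal)

end Perc

end

/-!
The three expressions are compared in a cycle: lower variational formula ≤ saddle expression ≤
infimum over gradients ≤ lower variational formula. A continuous function on `Ω_0` is first extended
by zero to a bounded measurable function on all configurations, which changes none of the three.

**From pair measures to the saddle expression** (`HBar_le_HBarSaddle`). A pair measure `μ` has a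
density `φ` of its first marginal and a kernel `π̃`, its conditional step distribution. Equality of
the marginals says that the flow `φ π̃` annihilates the gradients of bounded functions, so that the
inner infimum over `g` is constant and equal to `⟨f, μ⟩ - 𝔍(μ)`.

**From the saddle expression to gradients** (`HBarSaddle_le_infLam`). If the flow `φ π̃` is not
stationary, scaling `g` shows that the infimum over `g` is `-∞`. If it is, then every gradient `G`
of the class has integral zero against it (`IsFlow.integral_gradient_eq_zero`). Hence `G` may be
added to `f` at no cost, and the finite Gibbs inequality (`sum_mul_sub_log_le`), applied at each
configuration, bounds the gain by the essential supremum.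

The vanishing of the integral rests on the sublinearity of the corrector (`corrector_box_small`):
along a coordinate axis its increments are Birkhoff sums of a centred integrable function, and the
mean ergodic theorem makes them small in probability; the remaining points of the cluster are
reached at a cost bounded by the chemical distance, which is comparable to the lattice distance.
Convergence in probability is enough. A sublinear corrector is replaced by the bounded function
`approxPotential`, the least value of `∑ G + cost` over open paths from the origin, whose gradient
dominates `G` up to a small error off a set of small probability.

**From gradients to pair measures** (`infLam_le_HBar`). Let `c` be less than the infimum over
gradients, and work in `L²` of the open directed edges at the origin (`dartMeasure`). The edge
functions `a` with `∑_e π_ω(0,e) exp (f + a) ≤ exp c` form a closed convex set, and the gradients of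
bounded functions form a subspace. A common point of the convex set and of the closure of the
subspace would be a bounded limit of gradients, therefore a member of the gradient class
(`gradientClass_of_tendsto`, where the exponential tails of the distance to the first arrival point
give the mean zero condition), with essential supremum at most `c` (`infLam_le_of_mem`). So the two
sets are disjoint. The convex set is bounded above pointwise and gradients are antisymmetric under
reversal of edges, so that gradients near the convex set are bounded; by weak compactness, in the
elementary form of `nonempty_iInter_of_convex`, the sets are at positive distance and are strictly
separated (`exists_separating_vector`). The separating function `ψ` is nonnegative and orthogonal to
gradients. After the addition of a small constant on all open edges, its normalization is a
stationary kernel, and testing the separation with the logarithm of this kernel shows that its mean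
gain is at least `c` (`exists_stationary_kernel`). The joint law of the environment and the step is
then an admissible pair measure (`mStar_stepMeasure`).
-/

namespace Perc

variable {d : ℕ} {m : Model}

/-! ### Shifts and the open graph -/

theorem translate_zero (b : Index d m) : translate 0 b = b := by
  cases m with
  | bond =>
    apply Subtype.ext
    change Sym2.map (0 + ·) b.1 = b.1
    simp
  | site => exact zero_add (show Lat d from b)

theorem translate_add (x y : Lat d) (b : Index d m) :
    translate (x + y) b = translate x (translate y b) := by
  cases m with
  | bond =>
    apply Subtype.ext
    change Sym2.map (x + y + ·) b.1 = Sym2.map (x + ·) (Sym2.map (y + ·) b.1)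
    rw [Sym2.map_map]
    congr 1
    funext z
    exact add_assoc _ _ _
  | site => exact add_assoc x y (show Lat d from b)

@[simp] theorem shift_zero (ω : Config d m) : shift 0 ω = ω := by
  funext b
  simp [shift, translate_zero]

theorem shift_shift (x y : Lat d) (ω : Config d m) : shift x (shift y ω) = shift (y + x) ω := by
  funext b
  simp [shift, translate_add]

theorem measurable_shift (x : Lat d) : Measurable (shift x : Config d m → Config d m) :=
  measurable_pi_lambda _ fun b => measurable_pi_apply (translate x b)

/-- Translation of configurations as a measurable equivalence. -/
def shiftEquiv (x : Lat d) : Config d m ≃ᵐ Config d m where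
  toFun := shift x
  invFun := shift (-x)
  left_inv ω := by rw [shift_shift]; simp
  right_inv ω := by rw [shift_shift]; simp
  measurable_toFun := measurable_shift x
  measurable_invFun := measurable_shift (-x)

theorem openGraph_shift_adj (ω : Config d m) (x y z : Lat d) :
    (openGraph (shift x ω)).Adj y z ↔ (openGraph ω).Adj (x + y) (x + z) := by
  cases m with
  | bond =>
    change (SimpleGraph.fromEdgeSet _).Adj _ _ ↔ (SimpleGraph.fromEdgeSet _).Adj _ _
    rw [SimpleGraph.fromEdgeSet_adj, SimpleGraph.fromEdgeSet_adj]
    refine and_congr ?_ (by simp)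
    constructor
    · rintro ⟨h1, h2⟩
      exact ⟨map_mem_edgeSet x _ h1, h2⟩
    · rintro ⟨h1, h2⟩
      have h3 : s(y, z) ∈ (lattice d).edgeSet := by
        have h : l1 ((x + z) - (x + y)) = 1 := h1
        rw [add_sub_add_left_eq_sub] at h
        exact h
      exact ⟨h3, h2⟩
  | site =>
    change (lattice d).Adj _ _ ∧ ω (x + y) = true ∧ ω (x + z) = true ↔
      (lattice d).Adj _ _ ∧ _
    have : (lattice d).Adj y z ↔ (lattice d).Adj (x + y) (x + z) := by
      change l1 _ = 1 ↔ l1 _ = 1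
      rw [add_sub_add_left_eq_sub]
    rw [this]

theorem openGraph_shift_adj_zero (ω : Config d m) (x : Lat d) (e : Lat d) :
    (openGraph (shift x ω)).Adj 0 e ↔ (openGraph ω).Adj x (x + e) := by
  rw [openGraph_shift_adj, add_zero]

theorem measurableSet_adj (x y : Lat d) :
    MeasurableSet {ω : Config d m | (openGraph ω).Adj x y} := by
  cases m with
  | bond =>
    by_cases h : s(x, y) ∈ (lattice d).edgeSet
    · have : {ω : Config d .bond | (openGraph ω).Adj x y} = {ω | ω ⟨s(x, y), h⟩ = true} := by
        ext ω
        change (SimpleGraph.fromEdgeSet _).Adj _ _ ↔ _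
        rw [SimpleGraph.fromEdgeSet_adj]
        constructor
        · rintro ⟨⟨_, h2⟩, _⟩
          exact h2
        · intro h2
          exact ⟨⟨h, h2⟩, (show (lattice d).Adj x y from h).ne⟩
      rw [this]
      exact measurable_pi_apply (X := fun _ : Index d .bond => Bool) _
        (measurableSet_singleton true)
    · have : {ω : Config d .bond | (openGraph ω).Adj x y} = ∅ := by
        ext ω
        simp only [mem_ofPred_eq, mem_empty_iff_false, iff_false]
        intro h2
        exact h (openGraph_le ω h2)
      rw [this]
      exact MeasurableSet.empty
  | site =>
    have : {ω : Config d .site | (openGraph ω).Adj x y} =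
        {_ω | (lattice d).Adj x y} ∩ ({ω | ω x = true} ∩ {ω | ω y = true}) := rfl
    rw [this]
    exact (MeasurableSet.const _).inter
      ((measurable_pi_apply (X := fun _ : Index d .site => Bool) _
        (measurableSet_singleton true)).inter
        (measurable_pi_apply (X := fun _ : Index d .site => Bool) _
          (measurableSet_singleton true)))

/-! ### The lattice norm -/

@[simp] theorem l1_zero : l1 (0 : Lat d) = 0 := by simp [l1]

theorem l1_neg (x : Lat d) : l1 (-x) = l1 x := by simp [l1]

theorem l1_add_le (x y : Lat d) : l1 (x + y) ≤ l1 x + l1 y := by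
  unfold l1
  rw [← Finset.sum_add_distrib]
  exact Finset.sum_le_sum fun i _ => abs_add_le _ _

theorem abs_apply_le_l1 (x : Lat d) (i : Fin d) : |x i| ≤ l1 x :=
  Finset.single_le_sum (f := fun i => |x i|) (fun _ _ => abs_nonneg _) (Finset.mem_univ i)

/-- The cube of side `2n + 1` centred at the origin. -/
noncomputable def box (d n : ℕ) : Finset (Lat d) :=
  Fintype.piFinset fun _ => Finset.Icc (-(n : ℤ)) n

theorem mem_box {n : ℕ} {x : Lat d} : x ∈ box d n ↔ ∀ i, |x i| ≤ n := by
  simp [box, Fintype.mem_piFinset, abs_le]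

theorem card_box (d n : ℕ) : (box d n).card = (2 * n + 1) ^ d := by
  simp only [box, Fintype.card_piFinset, Int.card_Icc, Finset.prod_const, Finset.card_univ,
    Fintype.card_fin]
  congr 1
  omega

theorem mem_box_of_l1_le {n : ℕ} {x : Lat d} (h : l1 x ≤ n) : x ∈ box d n :=
  mem_box.2 fun i => (abs_apply_le_l1 x i).trans h

/-- The opposite direction. -/
noncomputable def negDir (e : Dir d) : Dir d := ⟨-e.1, by rw [l1_neg]; exact e.2⟩

@[simp] theorem negDir_val (e : Dir d) : (negDir e).1 = -e.1 := rfl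

@[simp] theorem negDir_negDir (e : Dir d) : negDir (negDir e) = e := Subtype.ext (neg_neg _)

/-- The coordinate direction `e_i`. -/
noncomputable def coordDir (i : Fin d) : Dir d := ⟨Pi.single i 1, by
  unfold l1
  rw [Finset.sum_eq_single i]
  · simp
  · intro j _ hj
    simp [Pi.single_eq_of_ne hj]
  · simp⟩

theorem dir_ne_zero (e : Dir d) : e.1 ≠ 0 := by
  intro h
  have := e.2
  rw [h, l1_zero] at this
  exact zero_ne_one this

/-! ### Open paths as lists of directions -/

/-- The path from `0` with the given successive steps uses open edges only. -/
def OpenPath : Config d m → List (Dir d) → Prop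
  | _, [] => True
  | ω, e :: l => (openGraph ω).Adj 0 e.1 ∧ OpenPath (shift e.1 ω) l

/-- The endpoint of the path from `0` with the given steps. -/
noncomputable def endpt (l : List (Dir d)) : Lat d := (l.map Subtype.val).sum

/-- The sum of `G` along the path from `0` with the given steps, as seen from the environment. -/
def total (G : Config d m → Dir d → ℝ) : Config d m → List (Dir d) → ℝ
  | _, [] => 0
  | ω, e :: l => G ω e + total G (shift e.1 ω) l

/-- The path with the given steps, traversed backwards from its endpoint. -/
noncomputable def revPath (l : List (Dir d)) : List (Dir d) := (l.map negDir).reverse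

@[simp] theorem openPath_nil (ω : Config d m) : OpenPath ω [] := trivial

theorem openPath_cons (ω : Config d m) (e : Dir d) (l : List (Dir d)) :
    OpenPath ω (e :: l) ↔ (openGraph ω).Adj 0 e.1 ∧ OpenPath (shift e.1 ω) l := Iff.rfl

@[simp] theorem endpt_nil : endpt ([] : List (Dir d)) = 0 := rfl

@[simp] theorem endpt_cons (e : Dir d) (l : List (Dir d)) : endpt (e :: l) = e.1 + endpt l := by
  simp [endpt]

theorem endpt_append (l l' : List (Dir d)) : endpt (l ++ l') = endpt l + endpt l' := by
  simp [endpt]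

@[simp] theorem total_nil (G : Config d m → Dir d → ℝ) (ω : Config d m) : total G ω [] = 0 := rfl

@[simp] theorem total_cons (G : Config d m → Dir d → ℝ) (ω : Config d m) (e : Dir d)
    (l : List (Dir d)) : total G ω (e :: l) = G ω e + total G (shift e.1 ω) l := rfl

theorem openPath_append (ω : Config d m) (l l' : List (Dir d)) :
    OpenPath ω (l ++ l') ↔ OpenPath ω l ∧ OpenPath (shift (endpt l) ω) l' := by
  induction l generalizing ω with
  | nil => simp
  | cons e l ih =>
    rw [List.cons_append, openPath_cons, openPath_cons, ih, shift_shift, endpt_cons, and_assoc]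

theorem total_append (G : Config d m → Dir d → ℝ) (ω : Config d m) (l l' : List (Dir d)) :
    total G ω (l ++ l') = total G ω l + total G (shift (endpt l) ω) l' := by
  induction l generalizing ω with
  | nil => simp
  | cons e l ih =>
    rw [List.cons_append, total_cons, total_cons, ih, shift_shift, endpt_cons, add_assoc]

theorem revPath_cons (e : Dir d) (l : List (Dir d)) :
    revPath (e :: l) = revPath l ++ [negDir e] := by simp [revPath]

theorem endpt_revPath (l : List (Dir d)) : endpt (revPath l) = -endpt l := by
  induction l with
  | nil => simp [revPath]
  | cons e l ih =>
    rw [revPath_cons, endpt_append, ih]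
    simp [add_comm]

theorem adj_negDir (ω : Config d m) (e : Dir d) :
    (openGraph (shift e.1 ω)).Adj 0 (negDir e).1 ↔ (openGraph ω).Adj 0 e.1 := by
  rw [openGraph_shift_adj_zero, negDir_val, add_neg_cancel, SimpleGraph.adj_comm]

theorem openPath_revPath {ω : Config d m} {l : List (Dir d)} (h : OpenPath ω l) :
    OpenPath (shift (endpt l) ω) (revPath l) := by
  induction l generalizing ω with
  | nil => simp [revPath]
  | cons e l ih =>
    rw [revPath_cons, openPath_append]
    have := ih h.2
    rw [shift_shift] at this
    rw [endpt_cons]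
    refine ⟨this, ?_⟩
    rw [shift_shift, endpt_revPath, openPath_cons]
    refine ⟨?_, trivial⟩
    have h1 := h.1
    rw [add_assoc, add_neg_cancel, add_zero]
    exact (adj_negDir ω e).2 h1

theorem measurableSet_openPath (l : List (Dir d)) :
    MeasurableSet {ω : Config d m | OpenPath ω l} := by
  induction l with
  | nil => exact MeasurableSet.univ
  | cons e l ih => exact (measurableSet_adj 0 e.1).inter (measurable_shift e.1 ih)

theorem measurable_total {G : Config d m → Dir d → ℝ} (hG : ∀ e, Measurable fun ω => G ω e)
    (l : List (Dir d)) : Measurable fun ω => total G ω l := by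
  induction l with
  | nil => exact measurable_const
  | cons e l ih => exact (hG e).add (ih.comp (measurable_shift e.1))

theorem l1_endpt_le (l : List (Dir d)) : l1 (endpt l) ≤ l.length := by
  induction l with
  | nil => simp
  | cons e l ih =>
    rw [endpt_cons, List.length_cons]
    have := l1_add_le e.1 (endpt l)
    rw [e.2] at this
    push_cast
    linarith

/-- Walks in the open graph starting at `x` are the open paths seen from `x`. -/
theorem exists_openPath_of_walk (G : Config d m → Dir d → ℝ) (ω : Config d m) {x y : Lat d}
    (w : (openGraph ω).Walk x y) :
    ∃ l : List (Dir d), OpenPath (shift x ω) l ∧ x + endpt l = y ∧ l.length = w.length ∧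
      pathSum G ω w = total G (shift x ω) l := by
  induction w with
  | nil => exact ⟨[], trivial, by simp, rfl, by simp [pathSum]⟩
  | @cons x y z h w ih =>
    obtain ⟨l, h1, h2, h3, h4⟩ := ih
    have hd : l1 (y - x) = 1 := openGraph_le ω h
    refine ⟨⟨y - x, hd⟩ :: l, ?_, ?_, ?_, ?_⟩
    · refine ⟨?_, ?_⟩
      · rw [openGraph_shift_adj_zero]
        simpa using h
      · rw [shift_shift]
        simpa using h1
    · rw [endpt_cons, ← h2]
      simp [← add_assoc]
    · simp [h3]
    · rw [total_cons, shift_shift]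
      have : pathSum G ω (SimpleGraph.Walk.cons h w) =
          G (shift x ω) ⟨y - x, hd⟩ + pathSum G ω w := by
        simp [pathSum, dartDir]
      rw [this, h4]
      simp

/-- Conversely, the open paths seen from `x` come from walks in the open graph. -/
theorem exists_walk_of_openPath (G : Config d m → Dir d → ℝ) (ω : Config d m) (x : Lat d)
    (l : List (Dir d)) (h : OpenPath (shift x ω) l) :
    ∃ w : (openGraph ω).Walk x (x + endpt l), w.length = l.length ∧
      pathSum G ω w = total G (shift x ω) l := by
  induction l generalizing x with
  | nil =>
    rw [endpt_nil, add_zero]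
    exact ⟨SimpleGraph.Walk.nil, rfl, by simp [pathSum]⟩
  | cons e l ih =>
    rw [openPath_cons, shift_shift, openGraph_shift_adj_zero] at h
    obtain ⟨w, h1, h2⟩ := ih (x + e.1) h.2
    rw [endpt_cons, ← add_assoc]
    refine ⟨SimpleGraph.Walk.cons h.1 w, by simp [h1], ?_⟩
    rw [total_cons, shift_shift, ← h2]
    simp [pathSum, dartDir]

theorem reachable_iff_openPath (ω : Config d m) (x y : Lat d) :
    (openGraph ω).Reachable x y ↔ ∃ l, OpenPath (shift x ω) l ∧ x + endpt l = y := by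
  constructor
  · rintro ⟨w⟩
    obtain ⟨l, h1, h2, -⟩ := exists_openPath_of_walk (fun _ _ => 0) ω w
    exact ⟨l, h1, h2⟩
  · rintro ⟨l, h1, rfl⟩
    obtain ⟨w, -⟩ := exists_walk_of_openPath (fun _ _ => 0) ω x l h1
    exact ⟨w⟩

/-! ### The infinite cluster -/

theorem mem_infCluster_shift (ω : Config d m) (x y : Lat d) :
    y ∈ infCluster (shift x ω) ↔ x + y ∈ infCluster ω := by
  have key : ((openGraph ω).connectedComponentMk (x + y)).supp =
      (x + ·) '' ((openGraph (shift x ω)).connectedComponentMk y).supp := by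
    ext z
    simp only [SimpleGraph.ConnectedComponent.mem_supp_iff, SimpleGraph.ConnectedComponent.eq,
      mem_image]
    constructor
    · intro h
      obtain ⟨l, h1, h2⟩ := (reachable_iff_openPath _ _ _).1 h.symm
      refine ⟨z - x, SimpleGraph.Reachable.symm ?_, by simp⟩
      rw [reachable_iff_openPath]
      exact ⟨l, by rwa [shift_shift], by rw [← h2]; abel⟩
    · rintro ⟨w, h, rfl⟩
      obtain ⟨l, h1, h2⟩ := (reachable_iff_openPath _ _ _).1 h.symm
      refine SimpleGraph.Reachable.symm ?_
      rw [reachable_iff_openPath]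
      exact ⟨l, by rwa [shift_shift] at h1, by rw [← h2]; abel⟩
  change (((openGraph (shift x ω)).connectedComponentMk y).supp).Infinite ↔
    (((openGraph ω).connectedComponentMk (x + y)).supp).Infinite
  rw [key, Set.infinite_image_iff (add_right_injective x).injOn]

theorem shift_mem_Omega0 (ω : Config d m) (x : Lat d) :
    shift x ω ∈ Omega0 d m ↔ x ∈ infCluster ω := by
  change 0 ∈ infCluster _ ↔ _
  rw [mem_infCluster_shift, add_zero]

theorem mem_infCluster_of_reachable {ω : Config d m} {x y : Lat d}
    (h : (openGraph ω).Reachable x y) (hx : x ∈ infCluster ω) : y ∈ infCluster ω := by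
  have : (openGraph ω).connectedComponentMk x = (openGraph ω).connectedComponentMk y :=
    SimpleGraph.ConnectedComponent.eq.2 h
  change (SimpleGraph.ConnectedComponent.supp _).Infinite
  rw [← this]
  exact hx

theorem shift_mem_Omega0_of_openPath {ω : Config d m} (h0 : ω ∈ Omega0 d m) {l : List (Dir d)}
    (h : OpenPath ω l) : shift (endpt l) ω ∈ Omega0 d m := by
  rw [shift_mem_Omega0]
  refine mem_infCluster_of_reachable (x := 0) ?_ h0
  rw [reachable_iff_openPath]
  exact ⟨l, by simpa using h, by simp⟩

theorem shift_mem_Omega0_of_adj {ω : Config d m} (h0 : ω ∈ Omega0 d m) {e : Dir d}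
    (h : (openGraph ω).Adj 0 e.1) : shift e.1 ω ∈ Omega0 d m := by
  simpa using shift_mem_Omega0_of_openPath h0 (l := [e]) ⟨h, trivial⟩

/-- The cluster of the origin is infinite exactly when open paths lead arbitrarily far away. This
describes `Ω_0` by countably many conditions on finitely many edges. -/
theorem mem_Omega0_iff (ω : Config d m) :
    ω ∈ Omega0 d m ↔ ∀ n : ℕ, ∃ l, OpenPath ω l ∧ (n : ℤ) ≤ l1 (endpt l) := by
  have hsupp : ∀ z, z ∈ ((openGraph ω).connectedComponentMk 0).supp ↔
      ∃ l, OpenPath ω l ∧ endpt l = z := by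
    intro z
    simp only [SimpleGraph.ConnectedComponent.mem_supp_iff, SimpleGraph.ConnectedComponent.eq]
    rw [SimpleGraph.reachable_comm, reachable_iff_openPath]
    simp
  constructor
  · intro h n
    by_contra hcon
    push Not at hcon
    refine h ((box d n).finite_toSet.subset fun z hz => ?_)
    obtain ⟨l, h1, rfl⟩ := (hsupp z).1 hz
    exact mem_box_of_l1_le (hcon l h1).le
  · intro h hfin
    obtain ⟨M, hM⟩ := (hfin.image l1).bddAbove
    obtain ⟨l, h1, h2⟩ := h (M.toNat + 1)
    have := hM ⟨_, (hsupp _).2 ⟨l, h1, rfl⟩, rfl⟩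
    push_cast at h2
    have := Int.self_le_toNat M
    linarith

theorem measurableSet_Omega0 : MeasurableSet (Omega0 d m) := by
  have : Omega0 d m = ⋂ n : ℕ, ⋃ l : List (Dir d),
      {ω | OpenPath ω l} ∩ {_ω | (n : ℤ) ≤ l1 (endpt l)} := by
    ext ω
    rw [mem_Omega0_iff]
    simp
  rw [this]
  exact MeasurableSet.iInter fun n => MeasurableSet.iUnion fun l =>
    (measurableSet_openPath l).inter (MeasurableSet.const _)

theorem measurableSet_mem_infCluster (x : Lat d) :
    MeasurableSet {ω : Config d m | x ∈ infCluster ω} := by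
  have : {ω : Config d m | x ∈ infCluster ω} = shift x ⁻¹' Omega0 d m := by
    ext ω
    exact (shift_mem_Omega0 ω x).symm
  rw [this]
  exact measurable_shift x measurableSet_Omega0

theorem exists_adj_of_mem_Omega0 {ω : Config d m} (h : ω ∈ Omega0 d m) :
    ∃ e : Dir d, (openGraph ω).Adj 0 e.1 := by
  obtain ⟨l, h1, h2⟩ := (mem_Omega0_iff ω).1 h 1
  cases l with
  | nil => simp at h2
  | cons e l => exact ⟨e, h1.1⟩

/-! ### Chemical distance and arrival times -/

theorem chemDist_le_of_openPath {ω : Config d m} {x y : Lat d} {l : List (Dir d)}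
    (h : OpenPath (shift x ω) l) (hy : x + endpt l = y) : chemDist ω x y ≤ l.length := by
  obtain ⟨w, h1, -⟩ := exists_walk_of_openPath (fun _ _ => 0) ω x l h
  subst hy
  rw [← h1]
  exact SimpleGraph.dist_le w

theorem exists_openPath_length_eq_chemDist {ω : Config d m} {x y : Lat d}
    (h : (openGraph ω).Reachable x y) :
    ∃ l : List (Dir d), OpenPath (shift x ω) l ∧ x + endpt l = y ∧ l.length = chemDist ω x y := by
  obtain ⟨w, hw⟩ := h.exists_walk_length_eq_dist
  obtain ⟨l, h1, h2, h3, -⟩ := exists_openPath_of_walk (fun _ _ => 0) ω w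
  exact ⟨l, h1, h2, h3.trans hw⟩

theorem chemDist_shift (ω : Config d m) (z x y : Lat d) :
    chemDist (shift z ω) x y = chemDist ω (z + x) (z + y) := by
  have hreach : (openGraph (shift z ω)).Reachable x y ↔
      (openGraph ω).Reachable (z + x) (z + y) := by
    simp only [reachable_iff_openPath, shift_shift, add_assoc, add_right_inj]
  by_cases h : (openGraph (shift z ω)).Reachable x y
  · obtain ⟨l, h1, h2, h3⟩ := exists_openPath_length_eq_chemDist h
    obtain ⟨l', h1', h2', h3'⟩ := exists_openPath_length_eq_chemDist (hreach.1 h)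
    rw [shift_shift] at h1
    apply le_antisymm
    · rw [← h3']
      refine chemDist_le_of_openPath (by rwa [shift_shift]) ?_
      rwa [add_assoc, add_right_inj] at h2'
    · rw [← h3]
      exact chemDist_le_of_openPath h1 (by rw [add_assoc, h2])
  · rw [chemDist, chemDist, SimpleGraph.dist_eq_zero_of_not_reachable h,
      SimpleGraph.dist_eq_zero_of_not_reachable (fun h' => h (hreach.2 h'))]

/-- The value is `0` where no `k` satisfies the condition, which is why the set `{sInf ≤ n}`
contains those points. -/
theorem measurable_nat_sInf {α : Type*} [MeasurableSpace α] {p : α → ℕ → Prop}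
    (hp : ∀ k, MeasurableSet {a | p a k}) : Measurable fun a => sInf {k | p a k} := by
  have hle : ∀ n : ℕ, MeasurableSet {a | sInf {k | p a k} ≤ n} := by
    intro n
    have : {a | sInf {k | p a k} ≤ n} = (⋃ k ∈ Finset.range (n + 1), {a | p a k}) ∪
        ⋂ k : ℕ, {a | p a k}ᶜ := by
      ext a
      simp only [mem_ofPred_eq, mem_union, mem_iUnion, Finset.mem_range, mem_iInter, mem_compl_iff,
        exists_prop]
      constructor
      · intro h
        by_cases hne : {k | p a k}.Nonempty
        · exact Or.inl ⟨_, Nat.lt_succ_of_le h, Nat.sInf_mem hne⟩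
        · right
          intro k hk
          exact hne ⟨k, hk⟩
      · rintro (⟨k, h1, h2⟩ | h)
        · exact (Nat.sInf_le h2).trans (Nat.le_of_lt_succ h1)
        · have : {k | p a k} = ∅ := by
            ext k
            simp [h k]
          rw [this]
          simp
    rw [this]
    exact (Finset.measurableSet_biUnion _ fun k _ => hp k).union
      (MeasurableSet.iInter fun k => (hp k).compl)
  exact measurable_of_Iic fun n => hle n

theorem measurableSet_exists_openPath (x y : Lat d) (p : List (Dir d) → Prop) :
    MeasurableSet {ω : Config d m | ∃ l, OpenPath (shift x ω) l ∧ x + endpt l = y ∧ p l} := by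
  have : {ω : Config d m | ∃ l, OpenPath (shift x ω) l ∧ x + endpt l = y ∧ p l} =
      ⋃ l : List (Dir d), shift x ⁻¹' {ω | OpenPath ω l} ∩ {_ω | x + endpt l = y ∧ p l} := by
    ext ω
    simp
  rw [this]
  exact MeasurableSet.iUnion fun l =>
    (measurable_shift x (measurableSet_openPath l)).inter (MeasurableSet.const _)

theorem measurable_chemDist (x y : Lat d) :
    Measurable fun ω : Config d m => chemDist ω x y := by
  have : (fun ω : Config d m => chemDist ω x y) = fun ω => sInf {k : ℕ |
      ∃ l, OpenPath (shift x ω) l ∧ x + endpt l = y ∧ l.length = k} := by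
    funext ω
    by_cases h : (openGraph ω).Reachable x y
    · apply le_antisymm
      · obtain ⟨l, h1, h2, h3⟩ := Nat.sInf_mem (s := {k : ℕ |
          ∃ l, OpenPath (shift x ω) l ∧ x + endpt l = y ∧ l.length = k}) (by
            obtain ⟨l, h1, h2⟩ := (reachable_iff_openPath _ _ _).1 h
            exact ⟨_, l, h1, h2, rfl⟩)
        rw [← h3]
        exact chemDist_le_of_openPath h1 h2
      · exact Nat.sInf_le (exists_openPath_length_eq_chemDist h)
    · rw [chemDist, SimpleGraph.dist_eq_zero_of_not_reachable h]
      rw [reachable_iff_openPath] at h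
      push Not at h
      have : {k : ℕ | ∃ l, OpenPath (shift x ω) l ∧ x + endpt l = y ∧ l.length = k} = ∅ := by
        ext k
        simp only [mem_ofPred_eq, mem_empty_iff_false, iff_false]
        rintro ⟨l, h1, h2, -⟩
        exact h l h1 h2
      rw [this]
      simp
  rw [this]
  exact measurable_nat_sInf fun k => measurableSet_exists_openPath x y _

theorem measurable_arrival (e : Dir d) : Measurable fun ω : Config d m => arrival ω e :=
  measurable_nat_sInf fun _ => (MeasurableSet.const _).inter
    (measurable_shift _ measurableSet_Omega0)

/-- The first `k ≥ 0` such that `k e` lies in the infinite cluster. -/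
noncomputable def hit (e : Dir d) (ω : Config d m) : ℕ :=
  sInf {k : ℕ | shift (k • e.1) ω ∈ Omega0 d m}

theorem measurable_hit (e : Dir d) : Measurable fun ω : Config d m => hit e ω :=
  measurable_nat_sInf fun _ => measurable_shift _ measurableSet_Omega0

end Perc

namespace Perc

variable {d : ℕ} {m : Model}

open Filter Topology

/-! ### The mean ergodic theorem in `L¹` -/

section MeanErgodic

variable {α : Type*} [MeasurableSpace α] {μ : Measure α} [IsProbabilityMeasure μ] {T : α → α}

theorem integral_abs_sub_le_norm_sub (F G : Lp ℝ 2 μ) : ∫ a, |F a - G a| ∂μ ≤ ‖F - G‖ := by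
  have h1 : ∫ a, |F a - G a| ∂μ = ∫ a, ‖(F - G : Lp ℝ 2 μ) a‖ ∂μ := by
    refine integral_congr_ae ?_
    filter_upwards [Lp.coeFn_sub F G] with a ha
    rw [ha]
    rfl
  rw [h1, integral_norm_eq_lintegral_enorm (Lp.aestronglyMeasurable _), Lp.norm_def,
    ← eLpNorm_one_eq_lintegral_enorm]
  exact ENNReal.toReal_mono (Lp.eLpNorm_ne_top _)
    (eLpNorm_le_eLpNorm_of_exponent_le (by norm_num) (Lp.aestronglyMeasurable _))

/-- Von Neumann's theorem, with convergence measured in `L¹` and the limit identified. -/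
theorem tendsto_integral_abs_average_sub_of_memLp_two (hT : Ergodic T μ) {U : α → ℝ}
    (hU : MemLp U 2 μ) :
    Tendsto (fun n : ℕ => ∫ a, |(n : ℝ)⁻¹ * ∑ j ∈ Finset.range n, U (T^[j] a) - ∫ b, U b ∂μ| ∂μ)
      atTop (𝓝 0) := by
  have hmp := hT.toMeasurePreserving
  set S : Lp ℝ 2 μ →ₗᵢ[ℝ] Lp ℝ 2 μ := Lp.compMeasurePreservingₗᵢ ℝ T hmp with hS
  set x : Lp ℝ 2 μ := hU.toLp U with hx
  have hnorm : ‖S.toContinuousLinearMap‖ ≤ 1 := S.norm_toContinuousLinearMap_le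
  have hconv := S.toContinuousLinearMap.tendsto_birkhoffAverage_orthogonalProjection hnorm x
  set y : Lp ℝ 2 μ := ((S.toContinuousLinearMap.eqLocus
    (1 : Lp ℝ 2 μ →L[ℝ] Lp ℝ 2 μ)).orthogonalProjectionOnto x : Lp ℝ 2 μ) with hy
  have hyfix : S y = y := ((S.toContinuousLinearMap.eqLocus
    (1 : Lp ℝ 2 μ →L[ℝ] Lp ℝ 2 μ)).orthogonalProjectionOnto x).2
  obtain ⟨c, hc⟩ : ∃ c : ℝ, (y : α → ℝ) =ᵐ[μ] Function.const α c := by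
    refine hT.ae_eq_const_of_ae_eq_comp_ae (Lp.aestronglyMeasurable y) ?_
    have h1 : (S y : α → ℝ) =ᵐ[μ] y ∘ T := Lp.coeFn_compMeasurePreserving y hmp
    rw [hyfix] at h1
    exact h1.symm
  have hiter : ∀ j : ℕ, ((S.toContinuousLinearMap)^[j] x : α → ℝ) =ᵐ[μ] fun a => U (T^[j] a) := by
    intro j
    have h1 : (S.toContinuousLinearMap)^[j] x =
        Lp.compMeasurePreserving (T^[j]) (hmp.iterate j) x := by
      rw [← Lp.compMeasurePreserving_iterate]
      rfl
    rw [h1]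
    refine (Lp.coeFn_compMeasurePreserving x (hmp.iterate j)).trans ?_
    exact (hmp.iterate j).quasiMeasurePreserving.ae_eq_comp hU.coeFn_toLp
  have havg : ∀ n : ℕ, ((birkhoffAverage ℝ S.toContinuousLinearMap id n x : Lp ℝ 2 μ) : α → ℝ) =ᵐ[μ]
      fun a => (n : ℝ)⁻¹ * ∑ j ∈ Finset.range n, U (T^[j] a) := by
    intro n
    unfold birkhoffAverage birkhoffSum
    refine (Lp.coeFn_smul _ _).trans ?_
    have h2 := Lp.coeFn_fun_finsetSum (Finset.range n)
      (fun j => id ((S.toContinuousLinearMap)^[j] x))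
    filter_upwards [h2, ae_all_iff.2 hiter] with a ha1 ha2
    rw [Pi.smul_apply, ha1, smul_eq_mul]
    congr 1
    exact Finset.sum_congr rfl fun j _ => ha2 j
  have hint : ∀ n : ℕ, n ≠ 0 →
      ∫ a, (n : ℝ)⁻¹ * ∑ j ∈ Finset.range n, U (T^[j] a) ∂μ = ∫ b, U b ∂μ := by
    intro n hn
    have hU1 : Integrable U μ := hU.integrable (by norm_num)
    have hj : ∀ j, Integrable (fun a => U (T^[j] a)) μ := fun j =>
      (hmp.iterate j).integrable_comp_of_integrable hU1
    rw [integral_const_mul, integral_finsetSum _ fun j _ => hj j]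
    have : ∀ j, ∫ a, U (T^[j] a) ∂μ = ∫ b, U b ∂μ := by
      intro j
      have h3 := integral_map (μ := μ) (φ := T^[j]) (hmp.iterate j).measurable.aemeasurable
        (f := U) (by rw [(hmp.iterate j).map_eq]; exact hU1.aestronglyMeasurable)
      rw [(hmp.iterate j).map_eq] at h3
      exact h3.symm
    simp only [this, Finset.sum_const, Finset.card_range, nsmul_eq_mul]
    field_simp
  have hdiff : ∀ n : ℕ, ∫ a, |(n : ℝ)⁻¹ * ∑ j ∈ Finset.range n, U (T^[j] a) - c| ∂μ ≤
      ‖birkhoffAverage ℝ S.toContinuousLinearMap id n x - y‖ := by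
    intro n
    refine le_trans (le_of_eq (integral_congr_ae ?_)) (integral_abs_sub_le_norm_sub _ _)
    filter_upwards [havg n, hc] with a ha1 ha2
    rw [ha1, ha2]
    rfl
  have hlim : Tendsto (fun n : ℕ =>
      ∫ a, |(n : ℝ)⁻¹ * ∑ j ∈ Finset.range n, U (T^[j] a) - c| ∂μ) atTop (𝓝 0) :=
    squeeze_zero (fun n => integral_nonneg fun _ => abs_nonneg _) hdiff
      (tendsto_iff_norm_sub_tendsto_zero.1 hconv)
  have hcU : ∫ b, U b ∂μ = c := by
    have h4 : ∀ᶠ n : ℕ in atTop, |∫ b, U b ∂μ - c| ≤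
        ∫ a, |(n : ℝ)⁻¹ * ∑ j ∈ Finset.range n, U (T^[j] a) - c| ∂μ := by
      filter_upwards [eventually_ne_atTop 0] with n hn
      have hi : Integrable (fun a => (n : ℝ)⁻¹ * ∑ j ∈ Finset.range n, U (T^[j] a)) μ :=
        (integrable_finsetSum _ fun j _ => (hmp.iterate j).integrable_comp_of_integrable
          (hU.integrable (by norm_num))).const_mul _
      have h5 : ∫ a, ((n : ℝ)⁻¹ * ∑ j ∈ Finset.range n, U (T^[j] a) - c) ∂μ =
          ∫ b, U b ∂μ - c := by
        rw [integral_sub hi (integrable_const c), hint n hn]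
        simp
      rw [← h5]
      exact abs_integral_le_integral_abs
    have h6 : |∫ b, U b ∂μ - c| ≤ 0 := ge_of_tendsto hlim h4
    have := abs_nonpos_iff.1 h6
    linarith
  rw [hcU]
  exact hlim

/-- The mean ergodic theorem in `L¹` for a centred integrable function. -/
theorem tendsto_integral_abs_average (hT : Ergodic T μ) {U : α → ℝ} (hU : Integrable U μ)
    (h0 : ∫ a, U a ∂μ = 0) :
    Tendsto (fun n : ℕ => ∫ a, |(n : ℝ)⁻¹ * ∑ j ∈ Finset.range n, U (T^[j] a)| ∂μ)
      atTop (𝓝 0) := by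
  have hmp := hT.toMeasurePreserving
  rw [Metric.tendsto_atTop]
  intro ε hε
  obtain ⟨s, hs1, hs2⟩ := (memLp_one_iff_integrable.2 hU).exists_simpleFunc_eLpNorm_sub_lt
    (by norm_num) (ε := ENNReal.ofReal (ε / 4)) (by simpa using hε)
  have hsi : Integrable s μ := memLp_one_iff_integrable.1 hs2
  have hs2' : MemLp s 2 μ := SimpleFunc.memLp_of_isFiniteMeasure s 2 μ
  have hD : ∫ a, |U a - s a| ∂μ < ε / 4 := by
    have h1 : ∫ a, |U a - s a| ∂μ = (eLpNorm (U - ⇑s) 1 μ).toReal := by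
      rw [eLpNorm_one_eq_lintegral_enorm,
        ← integral_norm_eq_lintegral_enorm (hU.sub hsi).aestronglyMeasurable]
      rfl
    rw [h1]
    exact (ENNReal.toReal_lt_of_lt_ofReal hs1)
  have hms : |∫ a, s a ∂μ| < ε / 4 := by
    have h2 : ∫ a, s a ∂μ = -∫ a, (U a - s a) ∂μ := by
      rw [integral_sub hU hsi, h0]
      ring
    rw [h2, abs_neg]
    exact lt_of_le_of_lt abs_integral_le_integral_abs hD
  obtain ⟨N, hN⟩ := (Metric.tendsto_atTop.1
    (tendsto_integral_abs_average_sub_of_memLp_two hT hs2')) (ε / 4) (by linarith)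
  refine ⟨max N 1, fun n hn => ?_⟩
  have hn1 : (n : ℝ) ≠ 0 := by
    have : 1 ≤ n := (le_max_right _ _).trans hn
    positivity
  have h3 := hN n ((le_max_left _ _).trans hn)
  rw [Real.dist_0_eq_abs, abs_of_nonneg (integral_nonneg fun _ => abs_nonneg _)] at h3 ⊢
  set D : α → ℝ := fun a => |U a - s a| with hDdef
  have hDi : Integrable D μ := (hU.sub hsi).abs
  have hDj : ∀ j, Integrable (fun a => D (T^[j] a)) μ := fun j =>
    (hmp.iterate j).integrable_comp_of_integrable hDi
  have hDeq : ∀ j, ∫ a, D (T^[j] a) ∂μ = ∫ a, D a ∂μ := by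
    intro j
    have h3 := integral_map (μ := μ) (φ := T^[j]) (hmp.iterate j).measurable.aemeasurable
      (f := D) (by rw [(hmp.iterate j).map_eq]; exact hDi.aestronglyMeasurable)
    rw [(hmp.iterate j).map_eq] at h3
    exact h3.symm
  have hsj : ∀ j, Integrable (fun a => s (T^[j] a)) μ := fun j =>
    (hmp.iterate j).integrable_comp_of_integrable hsi
  have hUj : ∀ j, Integrable (fun a => U (T^[j] a)) μ := fun j =>
    (hmp.iterate j).integrable_comp_of_integrable hU
  have hI1 : Integrable (fun a => (n : ℝ)⁻¹ * ∑ j ∈ Finset.range n, D (T^[j] a)) μ :=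
    (integrable_finsetSum _ fun j _ => hDj j).const_mul _
  have hI2 : Integrable
      (fun a => |(n : ℝ)⁻¹ * ∑ j ∈ Finset.range n, s (T^[j] a) - ∫ b, s b ∂μ|) μ :=
    (((integrable_finsetSum _ fun j _ => hsj j).const_mul _).sub (integrable_const _)).abs
  have hpt : ∀ a, |(n : ℝ)⁻¹ * ∑ j ∈ Finset.range n, U (T^[j] a)| ≤
      ((n : ℝ)⁻¹ * ∑ j ∈ Finset.range n, D (T^[j] a) +
        |(n : ℝ)⁻¹ * ∑ j ∈ Finset.range n, s (T^[j] a) - ∫ b, s b ∂μ|) + |∫ b, s b ∂μ| := by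
    intro a
    have e1 : (n : ℝ)⁻¹ * ∑ j ∈ Finset.range n, U (T^[j] a) =
        (n : ℝ)⁻¹ * ∑ j ∈ Finset.range n, (U (T^[j] a) - s (T^[j] a)) +
        ((n : ℝ)⁻¹ * ∑ j ∈ Finset.range n, s (T^[j] a) - ∫ b, s b ∂μ) + ∫ b, s b ∂μ := by
      rw [Finset.sum_sub_distrib]
      ring
    rw [e1]
    refine (abs_add_le _ _).trans (add_le_add_left ((abs_add_le _ _).trans
      (add_le_add_left ?_ _)) _)
    rw [abs_mul, abs_of_nonneg (by positivity : (0 : ℝ) ≤ (n : ℝ)⁻¹)]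
    exact mul_le_mul_of_nonneg_left (Finset.abs_sum_le_sum_abs _ _) (by positivity)
  have h4 : ∫ a, |(n : ℝ)⁻¹ * ∑ j ∈ Finset.range n, U (T^[j] a)| ∂μ ≤
      (∫ a, D a ∂μ +
        ∫ a, |(n : ℝ)⁻¹ * ∑ j ∈ Finset.range n, s (T^[j] a) - ∫ b, s b ∂μ| ∂μ) +
        |∫ b, s b ∂μ| := by
    refine (integral_mono (((integrable_finsetSum _ fun j _ => hUj j).const_mul _).abs)
      ((hI1.add hI2).add (integrable_const _)) hpt).trans (le_of_eq ?_)
    have e1 := integral_add (hI1.add hI2) (integrable_const |∫ b, s b ∂μ|)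
    have e2 := integral_add hI1 hI2
    simp only [Pi.add_apply] at e1 e2
    simp only [Pi.add_apply]
    rw [e1, e2, integral_const_mul, integral_finsetSum _ fun j _ => hDj j]
    simp only [hDeq, Finset.sum_const, Finset.card_range, nsmul_eq_mul]
    simp
    field_simp
  linarith

end MeanErgodic

/-! ### Stationarity and the conditional law -/

section Stationary

variable {P : Measure (Config d m)}

theorem P0_eq (P : Measure (Config d m)) :
    P0 P = (P (Omega0 d m))⁻¹ • P.restrict (Omega0 d m) := rfl

theorem ae_P0_mem (P : Measure (Config d m)) : ∀ᵐ ω ∂(P0 P), ω ∈ Omega0 d m :=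
  ae_cond_mem measurableSet_Omega0

theorem P0_le (s : Set (Config d m)) : P0 P s ≤ (P (Omega0 d m))⁻¹ * P s := by
  rw [P0_eq, Measure.smul_apply, smul_eq_mul]
  exact mul_le_mul_right (Measure.restrict_apply_le _ _) _

theorem integral_P0 (P : Measure (Config d m)) (F : Config d m → ℝ) :
    ∫ ω, F ω ∂(P0 P) = (P.real (Omega0 d m))⁻¹ * ∫ ω, (Omega0 d m).indicator F ω ∂P := by
  rw [P0_eq, integral_smul_measure, integral_indicator measurableSet_Omega0, ENNReal.toReal_inv]
  rfl

theorem lintegral_P0 (P : Measure (Config d m)) (F : Config d m → ℝ≥0∞) :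
    ∫⁻ ω, F ω ∂(P0 P) = (P (Omega0 d m))⁻¹ * ∫⁻ ω, (Omega0 d m).indicator F ω ∂P := by
  rw [P0_eq, lintegral_smul_measure, lintegral_indicator measurableSet_Omega0]
  rfl

theorem ae_reachable (hP : Admissible P) :
    ∀ᵐ ω ∂P, ∀ x ∈ infCluster ω, ∀ y ∈ infCluster ω, (openGraph ω).Reachable x y := by
  filter_upwards [hP.unique_cluster] with ω hω x hx y hy
  rw [← SimpleGraph.ConnectedComponent.eq]
  exact hω.unique hx hy

theorem Admissible.measurePreserving (hP : Admissible P) (x : Lat d) :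
    MeasurePreserving (shift x) P P := by
  by_cases hx : x = 0
  · subst hx
    have : (shift 0 : Config d m → Config d m) = id := by
      funext ω
      simp
    rw [this]
    exact MeasurePreserving.id P
  · exact (hP.ergodic x hx).toMeasurePreserving

/-- Shift invariance, for arbitrary sets (shifts are measurable equivalences). -/
theorem Admissible.measure_preimage (hP : Admissible P) (x : Lat d) (s : Set (Config d m)) :
    P (shift x ⁻¹' s) = P s :=
  MeasurePreserving.measure_preimage_equiv (f := shiftEquiv x) (hP.measurePreserving x) s

theorem Admissible.ae_shift (hP : Admissible P) (x : Lat d) {Q : Config d m → Prop}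
    (h : ∀ᵐ ω ∂P, Q ω) : ∀ᵐ ω ∂P, Q (shift x ω) :=
  (hP.measurePreserving x).quasiMeasurePreserving.ae h

variable [IsProbabilityMeasure P]

theorem Admissible.measure_Omega0_ne_zero (hP : Admissible P) : P (Omega0 d m) ≠ 0 := by
  intro h0
  have h1 : ∀ᵐ ω ∂P, ∀ x : Lat d, x ∉ infCluster ω := by
    rw [ae_all_iff]
    intro x
    have : ∀ᵐ ω ∂P, ω ∉ Omega0 d m := by
      rw [ae_iff]
      simpa using h0
    filter_upwards [hP.ae_shift x this] with ω hω
    rwa [shift_mem_Omega0] at hω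
  obtain ⟨ω, h2, h3⟩ := (h1.and hP.unique_cluster).exists
  obtain ⟨C, hC, -⟩ := h3
  obtain ⟨x, hx⟩ := C.nonempty_supp
  refine h2 x ?_
  change (SimpleGraph.ConnectedComponent.supp _).Infinite
  rw [SimpleGraph.ConnectedComponent.mem_supp_iff] at hx
  rwa [hx]

theorem Admissible.isProbabilityMeasure_P0 (hP : Admissible P) : IsProbabilityMeasure (P0 P) :=
  cond_isProbabilityMeasure hP.measure_Omega0_ne_zero

theorem ae_P0_iff {Q : Config d m → Prop} :
    (∀ᵐ ω ∂(P0 P), Q ω) ↔ ∀ᵐ ω ∂P, ω ∈ Omega0 d m → Q ω := by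
  rw [P0_eq, ← ae_restrict_iff' measurableSet_Omega0]
  have h : (P (Omega0 d m))⁻¹ ≠ 0 := ENNReal.inv_ne_zero.2 (measure_ne_top _ _)
  simp only [ae_iff, Measure.smul_apply, smul_eq_mul, mul_eq_zero, h, false_or]

/-- A property that holds almost surely when the origin lies in the infinite cluster holds
almost surely as seen from every point of the infinite cluster. -/
theorem ae_forall_mem_infCluster (hP : Admissible P) {Q : Config d m → Prop}
    (h : ∀ᵐ ω ∂(P0 P), Q ω) : ∀ᵐ ω ∂P, ∀ x ∈ infCluster ω, Q (shift x ω) := by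
  rw [ae_all_iff]
  intro x
  filter_upwards [hP.ae_shift x (ae_P0_iff.1 h)] with ω hω hx
  exact hω ((shift_mem_Omega0 ω x).2 hx)

theorem ae_P0_shift_of_openPath (hP : Admissible P) {Q : Config d m → Prop}
    (h : ∀ᵐ ω ∂(P0 P), Q ω) :
    ∀ᵐ ω ∂(P0 P), ∀ l : List (Dir d), OpenPath ω l → Q (shift (endpt l) ω) := by
  rw [ae_P0_iff]
  filter_upwards [ae_forall_mem_infCluster hP h] with ω hω h0 l hl
  exact hω _ ((shift_mem_Omega0 _ _).1 (shift_mem_Omega0_of_openPath h0 hl))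

theorem integrable_P0_iff (hP : Admissible P) {F : Config d m → ℝ} :
    Integrable F (P0 P) ↔ Integrable ((Omega0 d m).indicator F) P := by
  rw [P0_eq, integrable_smul_measure (ENNReal.inv_ne_zero.2 (measure_ne_top _ _))
    (ENNReal.inv_ne_top.2 hP.measure_Omega0_ne_zero), integrable_indicator_iff measurableSet_Omega0]
  rfl

/-- From every vertex, the half-line in every direction almost surely meets the infinite
cluster. -/
theorem ae_exists_nsmul_mem (hP : Admissible P) (e : Dir d) :
    ∀ᵐ ω ∂P, ∀ x : Lat d, ∃ k : ℕ, x + k • e.1 ∈ infCluster ω := by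
  have key : ∀ᵐ ω ∂P, ∃ k : ℕ, k • e.1 ∈ infCluster ω := by
    set E : Set (Config d m) := {ω | ∀ k : ℕ, k • e.1 ∉ infCluster ω} with hE
    have hEm : MeasurableSet E := by
      have : E = ⋂ k : ℕ, {ω | k • e.1 ∈ infCluster ω}ᶜ := by
        ext ω
        simp [hE]
      rw [this]
      exact MeasurableSet.iInter fun k => (measurableSet_mem_infCluster _).compl
    have hsub : E ⊆ shift e.1 ⁻¹' E := by
      intro ω hω k hk
      rw [mem_infCluster_shift, ← succ_nsmul'] at hk
      exact hω _ hk
    have h01 := (hP.ergodic e.1 (dir_ne_zero e)).ae_empty_or_univ_of_ae_le_preimage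
      hEm.nullMeasurableSet (LE.le.eventuallyLE hsub)
    have hEsub : E ⊆ (Omega0 d m)ᶜ := fun ω hω h => by
      have := hω 0
      rw [zero_smul] at this
      exact this h
    rcases h01 with h | h
    · have : P E = 0 := by rw [measure_congr h]; simp
      filter_upwards [measure_eq_zero_iff_ae_notMem.1 this] with ω hω
      simpa [hE] using hω
    · exfalso
      refine hP.measure_Omega0_ne_zero ?_
      have h2 : P Eᶜ = 0 := by
        rw [measure_congr h.compl]
        simp
      exact measure_mono_null (subset_compl_comm.1 hEsub) h2
  rw [ae_all_iff]
  intro x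
  filter_upwards [hP.ae_shift x key] with ω ⟨k, hk⟩
  exact ⟨k, by rwa [mem_infCluster_shift] at hk⟩

end Stationary

end Perc

namespace Perc

open Filter Topology

variable {d : ℕ} {m : Model}

/-! ### Cocycles along open paths -/

/-- `G` sums to zero along every closed open path through the origin. -/
def LoopFree (G : Config d m → Dir d → ℝ) (ω : Config d m) : Prop :=
  ∀ l : List (Dir d), OpenPath ω l → endpt l = 0 → total G ω l = 0

theorem LoopFree.total_revPath {G : Config d m → Dir d → ℝ} {ω : Config d m} (h : LoopFree G ω)
    {l : List (Dir d)} (hl : OpenPath ω l) :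
    total G (shift (endpt l) ω) (revPath l) = -total G ω l := by
  have h1 := h (l ++ revPath l) ((openPath_append _ _ _).2 ⟨hl, openPath_revPath hl⟩)
    (by rw [endpt_append, endpt_revPath, add_neg_cancel])
  rw [total_append] at h1
  linarith

theorem LoopFree.total_eq {G : Config d m → Dir d → ℝ} {ω : Config d m} (h : LoopFree G ω)
    {l l' : List (Dir d)} (hl : OpenPath ω l) (hl' : OpenPath ω l') (he : endpt l = endpt l') :
    total G ω l = total G ω l' := by
  have h1 := h (l ++ revPath l') ((openPath_append _ _ _).2 ⟨hl, by
      rw [he]; exact openPath_revPath hl'⟩)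
    (by rw [endpt_append, endpt_revPath, he, add_neg_cancel])
  rw [total_append, he, h.total_revPath hl'] at h1
  linarith

theorem LoopFree.antisymm {G : Config d m → Dir d → ℝ} {ω : Config d m} (h : LoopFree G ω)
    {e : Dir d} (he : (openGraph ω).Adj 0 e.1) : G (shift e.1 ω) (negDir e) = -G ω e := by
  have := h.total_revPath (l := [e]) ⟨he, trivial⟩
  simpa [revPath] using this

/-- The corrector does not depend on the path chosen in its definition. -/
theorem LoopFree.corrector_eq {G : Config d m → Dir d → ℝ} {ω : Config d m} (h : LoopFree G ω)
    {l : List (Dir d)} (hl : OpenPath ω l) {x : Lat d} (hx : endpt l = x) :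
    corrector G ω x = total G ω l := by
  have hr : (openGraph ω).Reachable 0 x := by
    rw [reachable_iff_openPath]
    exact ⟨l, by simpa using hl, by simpa using hx⟩
  obtain ⟨l', h1, h2, -, h4⟩ := exists_openPath_of_walk G ω hr.some
  rw [corrector, dif_pos hr, h4]
  rw [shift_zero] at h1 ⊢
  rw [zero_add] at h2
  exact h.total_eq h1 hl (h2.trans hx.symm)

/-- The bound on `G` is required only along open paths, since a gradient is controlled on the
infinite cluster only. -/
theorem abs_total_le {G : Config d m → Dir d → ℝ} {ω : Config d m} {A : ℝ}
    (hA : ∀ l : List (Dir d), OpenPath ω l → ∀ e, |G (shift (endpt l) ω) e| ≤ A)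
    {l : List (Dir d)} (hl : OpenPath ω l) : |total G ω l| ≤ A * l.length := by
  induction l generalizing ω with
  | nil => simp
  | cons e l ih =>
    have h0 : |G ω e| ≤ A := by simpa using hA [] trivial e
    have h1 := ih (ω := shift e.1 ω) (fun l' hl' e' => by
      have := hA (e :: l') ⟨hl.1, hl'⟩ e'
      rwa [endpt_cons, ← shift_shift] at this) hl.2
    rw [total_cons, List.length_cons]
    push_cast
    refine (abs_add_le _ _).trans ?_
    linarith

/-- The properties of a configuration, relative to a gradient `G` bounded by `A`, that hold
almost surely and are used as seen from all points of the infinite cluster. -/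
structure Regular (G : Config d m → Dir d → ℝ) (A : ℝ) (ω : Config d m) : Prop where
  reachable : ∀ x ∈ infCluster ω, ∀ y ∈ infCluster ω, (openGraph ω).Reachable x y
  exists_hit : ∀ (e : Dir d) (x : Lat d), ∃ k : ℕ, x + k • e.1 ∈ infCluster ω
  loopFree : ∀ x ∈ infCluster ω, LoopFree G (shift x ω)
  bounded : ∀ x ∈ infCluster ω, ∀ e, |G (shift x ω) e| ≤ A

/-- The increment `V_G(y) - V_G(x)` of the corrector between two points of the cluster. -/
noncomputable def increment (G : Config d m → Dir d → ℝ) (ω : Config d m) (x y : Lat d) : ℝ :=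
  corrector G (shift x ω) (y - x)

theorem increment_shift (G : Config d m → Dir d → ℝ) (ω : Config d m) (z x y : Lat d) :
    increment G (shift z ω) x y = increment G ω (z + x) (z + y) := by
  rw [increment, increment, shift_shift, add_sub_add_left_eq_sub]

section RegularLemmas

variable {G : Config d m → Dir d → ℝ} {A : ℝ} {ω : Config d m}

theorem Regular.abs_total_le (h : Regular G A ω) {x : Lat d} (hx : x ∈ infCluster ω)
    {l : List (Dir d)} (hl : OpenPath (shift x ω) l) :
    |total G (shift x ω) l| ≤ A * l.length := by
  refine Perc.abs_total_le (fun l' hl' e => ?_) hl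
  have := shift_mem_Omega0_of_openPath ((shift_mem_Omega0 ω x).2 hx) hl'
  rw [shift_shift, shift_mem_Omega0] at this
  rw [shift_shift]
  exact h.bounded _ this e

theorem Regular.increment_eq_total (h : Regular G A ω) {x : Lat d} (hx : x ∈ infCluster ω)
    {l : List (Dir d)} (hl : OpenPath (shift x ω) l) :
    increment G ω x (x + endpt l) = total G (shift x ω) l :=
  (h.loopFree x hx).corrector_eq hl (by abel)

theorem Regular.increment_self (h : Regular G A ω) {x : Lat d} (hx : x ∈ infCluster ω) :
    increment G ω x x = 0 := by
  simpa using h.increment_eq_total hx (openPath_nil _)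

theorem Regular.increment_add (h : Regular G A ω) {x y z : Lat d} (hx : x ∈ infCluster ω)
    (hy : y ∈ infCluster ω) (hz : z ∈ infCluster ω) :
    increment G ω x y + increment G ω y z = increment G ω x z := by
  obtain ⟨l, h1, rfl⟩ := (reachable_iff_openPath _ _ _).1 (h.reachable x hx y hy)
  obtain ⟨l', h2, rfl⟩ := (reachable_iff_openPath _ _ _).1 (h.reachable _ hy z hz)
  have h3 : OpenPath (shift x ω) (l ++ l') :=
    (openPath_append _ _ _).2 ⟨h1, by rwa [shift_shift]⟩
  have h4 := h.increment_eq_total hx h3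
  rw [endpt_append, ← add_assoc, total_append, shift_shift] at h4
  rw [h4, h.increment_eq_total hx h1, h.increment_eq_total hy h2]

theorem Regular.increment_symm (h : Regular G A ω) {x y : Lat d} (hx : x ∈ infCluster ω)
    (hy : y ∈ infCluster ω) : increment G ω y x = -increment G ω x y := by
  have := h.increment_add hx hy hx
  rw [h.increment_self hx] at this
  linarith

theorem Regular.abs_increment_le (h : Regular G A ω) {x y : Lat d} (hx : x ∈ infCluster ω)
    (hy : y ∈ infCluster ω) : |increment G ω x y| ≤ A * chemDist ω x y := by
  obtain ⟨l, h1, h2, h3⟩ := exists_openPath_length_eq_chemDist (h.reachable x hx y hy)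
  rw [← h2, h.increment_eq_total hx h1, h2, ← h3]
  exact h.abs_total_le hx h1

end RegularLemmas

theorem GradientClass.ae_loopFree {P : Measure (Config d m)} {G : Config d m → Dir d → ℝ}
    (hG : GradientClass P G) : ∀ᵐ ω ∂(P0 P), LoopFree G ω := by
  filter_upwards [hG.closed_loop, ae_P0_mem P] with ω h1 h0 l hl he
  obtain ⟨w, -, hw⟩ := exists_walk_of_openPath G ω 0 l (by simpa using hl)
  have h2 : ∀ (y : Lat d) (w : (openGraph ω).Walk 0 y), y = 0 → pathSum G ω w = 0 := by
    rintro y w rfl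
    exact h1 0 h0 w
  have := h2 _ w (by simp [he])
  rwa [hw, shift_zero] at this

theorem GradientClass.exists_bound {P : Measure (Config d m)} {G : Config d m → Dir d → ℝ}
    (hG : GradientClass P G) : ∃ A : ℝ, 0 < A ∧ ∀ᵐ ω ∂(P0 P), ∀ e, |G ω e| ≤ A := by
  choose A hA using hG.bounded
  refine ⟨1 + ∑ e, |A e|, by positivity, ?_⟩
  filter_upwards [ae_all_iff.2 hA] with ω hω e
  have := Finset.single_le_sum (f := fun e => |A e|) (fun _ _ => abs_nonneg _) (Finset.mem_univ e)
  have h2 := hω e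
  have h3 := le_abs_self (A e)
  linarith

theorem ae_regular {P : Measure (Config d m)} [IsProbabilityMeasure P] (hP : Admissible P)
    {G : Config d m → Dir d → ℝ} {A : ℝ} (hloop : ∀ᵐ ω ∂(P0 P), LoopFree G ω)
    (hA : ∀ᵐ ω ∂(P0 P), ∀ e, |G ω e| ≤ A) : ∀ᵐ ω ∂P, Regular G A ω := by
  filter_upwards [ae_reachable hP, ae_all_iff.2 fun e => ae_exists_nsmul_mem hP e,
    ae_forall_mem_infCluster hP hloop, ae_forall_mem_infCluster hP hA] with ω h1 h2 h3 h4
  exact ⟨h1, h2, h3, h4⟩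

/-! ### Projection to the cluster along a coordinate direction -/

/-- The first point of the infinite cluster on the half-line from `x` in direction `e`. -/
noncomputable def hitPt (e : Dir d) (ω : Config d m) (x : Lat d) : Lat d :=
  x + hit e (shift x ω) • e.1

theorem hitPt_shift (e : Dir d) (ω : Config d m) (z x : Lat d) :
    z + hitPt e (shift z ω) x = hitPt e ω (z + x) := by
  rw [hitPt, hitPt, shift_shift, add_assoc]

theorem hit_eq_zero {e : Dir d} {ω : Config d m} (h : ω ∈ Omega0 d m) : hit e ω = 0 := by
  apply Nat.sInf_eq_zero.2
  left
  simpa using h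

theorem hitPt_of_mem {e : Dir d} {ω : Config d m} {x : Lat d} (hx : x ∈ infCluster ω) :
    hitPt e ω x = x := by
  rw [hitPt, hit_eq_zero ((shift_mem_Omega0 ω x).2 hx)]
  simp

/-- The first arrival after the origin is the first hit as seen from the next vertex. -/
theorem arrival_eq_hit_add_one {e : Dir d} {ω : Config d m}
    (h : ∃ k : ℕ, e.1 + k • e.1 ∈ infCluster ω) : arrival ω e = hit e (shift e.1 ω) + 1 := by
  have hmem : ∀ k : ℕ, shift (k • e.1) (shift e.1 ω) ∈ Omega0 d m ↔
      shift ((k + 1) • e.1) ω ∈ Omega0 d m := by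
    intro k
    rw [shift_shift, succ_nsmul']
  have hne : {k : ℕ | shift (k • e.1) (shift e.1 ω) ∈ Omega0 d m}.Nonempty := by
    obtain ⟨k, hk⟩ := h
    refine ⟨k, ?_⟩
    change shift (k • e.1) (shift e.1 ω) ∈ Omega0 d m
    rwa [shift_shift, shift_mem_Omega0]
  have hin := Nat.sInf_mem hne
  apply le_antisymm
  · exact Nat.sInf_le ⟨by omega, (hmem _).1 hin⟩
  · have hne' : {k : ℕ | 1 ≤ k ∧ shift (k • e.1) ω ∈ Omega0 d m}.Nonempty :=
      ⟨_, by omega, (hmem _).1 hin⟩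
    obtain ⟨h1, h2⟩ := Nat.sInf_mem hne'
    obtain ⟨j, hj⟩ : ∃ j, arrival ω e = j + 1 := ⟨arrival ω e - 1, by
      have : 1 ≤ arrival ω e := h1
      omega⟩
    rw [hj]
    have h3 : shift ((j + 1) • e.1) ω ∈ Omega0 d m := by rw [← hj]; exact h2
    have : hit e (shift e.1 ω) ≤ j := Nat.sInf_le ((hmem j).2 h3)
    omega

/-- If the origin is not in the cluster, then the half-lines from it and from the next vertex have
the same first cluster point. -/
theorem hit_eq_hit_add_one {e : Dir d} {ω : Config d m} (h0 : ω ∉ Omega0 d m)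
    (h : ∃ k : ℕ, e.1 + k • e.1 ∈ infCluster ω) : hit e ω = hit e (shift e.1 ω) + 1 := by
  rw [← arrival_eq_hit_add_one h]
  unfold hit arrival
  congr 1
  ext k
  refine ⟨fun hk => ⟨?_, hk⟩, fun hk => hk.2⟩
  rcases Nat.eq_zero_or_pos k with rfl | hpos
  · exact absurd (by simpa using hk) h0
  · exact hpos

theorem Regular.hitPt_mem {G : Config d m → Dir d → ℝ} {A : ℝ} {ω : Config d m}
    (h : Regular G A ω) (e : Dir d) (x : Lat d) : hitPt e ω x ∈ infCluster ω := by
  obtain ⟨k, hk⟩ := h.exists_hit e x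
  have : shift (hit e (shift x ω) • e.1) (shift x ω) ∈ Omega0 d m :=
    Nat.sInf_mem (s := {k : ℕ | shift (k • e.1) (shift x ω) ∈ Omega0 d m}) ⟨k, by
      change shift (k • e.1) (shift x ω) ∈ Omega0 d m
      rwa [shift_shift, shift_mem_Omega0]⟩
  rwa [shift_shift, shift_mem_Omega0] at this

/-- The increment of the corrector up to the first arrival in direction `e`, extended by `0`
to configurations for which the origin is not in the infinite cluster. -/
noncomputable def arrivalIncrement (G : Config d m → Dir d → ℝ) (e : Dir d) :
    Config d m → ℝ :=
  (Omega0 d m).indicator fun ω => corrector G ω (arrivalPoint ω e)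

/-- If `x` is in the cluster, its projection is `x` and that of `x + e` is the next arrival point;
otherwise both projections agree and the increment is zero. -/
theorem Regular.arrivalIncrement_eq {G : Config d m → Dir d → ℝ} {A : ℝ} {ω : Config d m}
    (h : Regular G A ω) (e : Dir d) (x : Lat d) :
    arrivalIncrement G e (shift x ω) =
      increment G ω (hitPt e ω x) (hitPt e ω (x + e.1)) := by
  have hex : ∃ k : ℕ, e.1 + k • e.1 ∈ infCluster (shift x ω) := by
    obtain ⟨k, hk⟩ := h.exists_hit e (x + e.1)
    exact ⟨k, by rwa [mem_infCluster_shift, ← add_assoc]⟩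
  by_cases hx : shift x ω ∈ Omega0 d m
  · rw [arrivalIncrement, indicator_of_mem hx, hitPt_of_mem ((shift_mem_Omega0 ω x).1 hx),
      increment, arrivalPoint, arrival_eq_hit_add_one hex, hitPt, shift_shift, succ_nsmul']
    congr 1
    abel
  · rw [arrivalIncrement, indicator_of_notMem hx]
    have : hitPt e ω x = hitPt e ω (x + e.1) := by
      rw [hitPt, hitPt, hit_eq_hit_add_one hx hex, shift_shift, succ_nsmul', add_assoc]
    rw [this, h.increment_self (h.hitPt_mem _ _)]

theorem iterate_shift (x : Lat d) (n : ℕ) (ω : Config d m) :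
    (shift x)^[n] ω = shift (n • x) ω := by
  induction n generalizing ω with
  | zero => simp
  | succ n ih => rw [Function.iterate_succ_apply, ih, shift_shift, succ_nsmul']

/-- Increments of the corrector along a line are Birkhoff sums of the arrival increment under the
shift by `e`, so the ergodic theorem for the unconditioned law applies to them. -/
theorem Regular.sum_arrivalIncrement {G : Config d m → Dir d → ℝ} {A : ℝ} {ω : Config d m}
    (h : Regular G A ω) (e : Dir d) (n : ℕ) :
    ∑ j ∈ Finset.range n, arrivalIncrement G e ((shift e.1)^[j] ω) =
      increment G ω (hitPt e ω 0) (hitPt e ω (n • e.1)) := by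
  induction n with
  | zero => simp [h.increment_self (h.hitPt_mem e 0)]
  | succ n ih =>
    rw [Finset.sum_range_succ, ih, iterate_shift, h.arrivalIncrement_eq,
      h.increment_add (h.hitPt_mem _ _) (h.hitPt_mem _ _) (h.hitPt_mem _ _), succ_nsmul]

end Perc

namespace Perc

open Filter Topology

variable {d : ℕ} {m : Model}

/-! ### Probability estimates -/

section General

variable {α : Type*} [MeasurableSpace α] {μ : Measure α} [IsProbabilityMeasure μ]

theorem measureReal_mono_of_ae {s t : Set α} (h : ∀ᵐ a ∂μ, a ∈ s → a ∈ t) :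
    μ.real s ≤ μ.real t :=
  ENNReal.toReal_mono (measure_ne_top _ _) (measure_mono_ae h)

theorem exists_nat_measureReal_le {X : α → ℕ} (hX : Measurable X) {η : ℝ} (hη : 0 < η) :
    ∃ K : ℕ, ∀ k, K ≤ k → μ.real {a | k ≤ X a} ≤ η := by
  have h1 := tendsto_measure_iInter_atTop (μ := μ) (s := fun k : ℕ => {a | k ≤ X a})
    (fun k => (measurableSet_le measurable_const hX).nullMeasurableSet)
    (fun i j hij a (ha : j ≤ X a) => hij.trans ha) ⟨0, measure_ne_top _ _⟩
  have h2 : ⋂ k : ℕ, {a | k ≤ X a} = ∅ := by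
    ext a
    simp only [mem_iInter, mem_ofPred_eq, mem_empty_iff_false, iff_false, not_forall, not_le]
    exact ⟨X a + 1, Nat.lt_succ_self _⟩
  rw [h2, measure_empty] at h1
  have h3 := (ENNReal.tendsto_toReal ENNReal.zero_ne_top).comp h1
  obtain ⟨K, hK⟩ := eventually_atTop.1 (h3.eventually (gt_mem_nhds hη))
  exact ⟨K, fun k hk => (hK k hk).le⟩

/-- Markov's inequality for the number of events that occur; the events need not be
measurable. -/
theorem measureReal_card_ge_le {ι : Type*} (S : Finset ι) (B : ι → Set α) (K : ℝ) :
    K * μ.real {a | ∃ T ⊆ S, K ≤ (T.card : ℝ) ∧ ∀ x ∈ T, a ∈ B x} ≤ ∑ x ∈ S, μ.real (B x) := by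
  classical
  set f : α → ℝ := fun a => ∑ x ∈ S, (toMeasurable μ (B x)).indicator (fun _ => (1 : ℝ)) a
    with hf
  have hi : ∀ x ∈ S, Integrable ((toMeasurable μ (B x)).indicator fun _ => (1 : ℝ)) μ := fun x _ =>
    (integrable_const (1 : ℝ)).indicator (measurableSet_toMeasurable _ _)
  have hfi : Integrable f μ := integrable_finsetSum _ hi
  have h0 : ∀ a, 0 ≤ f a := fun a => Finset.sum_nonneg fun x _ =>
    indicator_nonneg (fun _ _ => zero_le_one) _
  have h1 := mul_meas_ge_le_integral_of_nonneg (μ := μ) (ae_of_all _ h0) hfi K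
  have h2 : ∫ a, f a ∂μ = ∑ x ∈ S, μ.real (B x) := by
    rw [hf, integral_finsetSum _ hi]
    refine Finset.sum_congr rfl fun x _ => ?_
    rw [integral_indicator_const _ (measurableSet_toMeasurable _ _), smul_eq_mul, mul_one,
      measureReal_def, measure_toMeasurable, measureReal_def]
  rw [h2] at h1
  rcases le_or_gt K 0 with hK | hK
  · exact (mul_nonpos_of_nonpos_of_nonneg hK measureReal_nonneg).trans
      (Finset.sum_nonneg fun _ _ => measureReal_nonneg)
  refine le_trans (mul_le_mul_of_nonneg_left (measureReal_mono ?_) hK.le) h1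
  rintro a ⟨T, hT, hK, hB⟩
  change K ≤ f a
  refine hK.trans ?_
  calc (T.card : ℝ) = ∑ x ∈ T, (toMeasurable μ (B x)).indicator (fun _ => (1 : ℝ)) a := by
        rw [Finset.sum_congr rfl fun x hx => indicator_of_mem
          (subset_toMeasurable μ (B x) (hB x hx)) _]
        simp
    _ ≤ f a := Finset.sum_le_sum_of_subset_of_nonneg hT fun x _ _ =>
        indicator_nonneg (fun _ _ => zero_le_one) _

end General

/-! ### Sublinearity of the corrector -/

section Sublinear

variable {P : Measure (Config d m)} {G : Config d m → Dir d → ℝ} {A : ℝ}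

/-- Stationarity of the increments between projected lattice points. -/
theorem measureReal_increment_shift (hP : Admissible P) (e e' : Dir d) (z x y : Lat d)
    (c : ℝ) :
    P.real {ω | c < |increment G ω (hitPt e ω (z + x)) (hitPt e' ω (z + y))|} =
      P.real {ω | c < |increment G ω (hitPt e ω x) (hitPt e' ω y)|} := by
  rw [measureReal_def, measureReal_def, ← hP.measure_preimage z {ω | c < |increment G ω
    (hitPt e ω x) (hitPt e' ω y)|}]
  congr 2
  ext ω
  simp only [mem_ofPred_eq, mem_preimage]
  rw [increment_shift, hitPt_shift, hitPt_shift]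

variable [IsProbabilityMeasure P]

theorem GradientClass.integrable_arrivalIncrement (hG : GradientClass P G)
    (hP : Admissible P) (e : Dir d) : Integrable (arrivalIncrement G e) P :=
  (integrable_P0_iff hP).1 (hG.mean_zero e).1

theorem GradientClass.integral_arrivalIncrement (hG : GradientClass P G)
    (hP : Admissible P) (e : Dir d) : ∫ ω, arrivalIncrement G e ω ∂P = 0 := by
  have h1 := (hG.mean_zero e).2
  rw [integral_P0] at h1
  refine (mul_eq_zero.1 h1).resolve_left (inv_ne_zero ?_)
  exact (ENNReal.toReal_pos hP.measure_Omega0_ne_zero (measure_ne_top _ _)).ne'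

/-- Along a coordinate direction the corrector is sublinear in probability: its increments are
Birkhoff sums of a centred integrable function. -/
theorem increment_axis_small (hP : Admissible P) (hG : GradientClass P G)
    (hreg : ∀ᵐ ω ∂P, Regular G A ω) (e : Dir d) {ε η : ℝ} (hε : 0 < ε) (hη : 0 < η) :
    ∃ n₀ : ℕ, ∀ n, n₀ ≤ n → ∀ k : ℕ, k ≤ n →
      P.real {ω | ε * n < |increment G ω (hitPt e ω 0) (hitPt e ω (k • e.1))|} ≤ η := by
  have hU := hG.integrable_arrivalIncrement hP e
  set a : ℕ → ℝ := fun k =>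
    ∫ ω, |∑ j ∈ Finset.range k, arrivalIncrement G e ((shift e.1)^[j] ω)| ∂P with ha
  have ha0 : ∀ k, 0 ≤ a k := fun k => integral_nonneg fun _ => abs_nonneg _
  have hlim := tendsto_integral_abs_average (hP.ergodic e.1 (dir_ne_zero e)) hU
    (hG.integral_arrivalIncrement hP e)
  have hδ : 0 < ε * η / 2 := by positivity
  obtain ⟨K, hK⟩ := eventually_atTop.1 (hlim.eventually (gt_mem_nhds hδ))
  set C : ℝ := ∑ k ∈ Finset.range (K + 1), a k with hC
  have hbound : ∀ k : ℕ, a k ≤ ε * η / 2 * k + C := by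
    intro k
    have hC0 : 0 ≤ C := Finset.sum_nonneg fun _ _ => ha0 _
    rcases Nat.lt_or_ge K k with hk | hk
    · have h1 := hK k hk.le
      have hk0 : (0 : ℝ) < k := by exact_mod_cast (Nat.zero_le K).trans_lt hk
      have h2 : ∫ ω, |(k : ℝ)⁻¹ *
          ∑ j ∈ Finset.range k, arrivalIncrement G e ((shift e.1)^[j] ω)| ∂P =
          (k : ℝ)⁻¹ * a k := by
        simp only [abs_mul, abs_of_nonneg (inv_nonneg.2 hk0.le)]
        rw [integral_const_mul]
      rw [h2, inv_mul_lt_iff₀ hk0] at h1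
      linarith
    · have h1 : a k ≤ C := Finset.single_le_sum (f := a) (fun _ _ => ha0 _)
        (Finset.mem_range.2 (Nat.lt_succ_of_le hk))
      have : 0 ≤ ε * η / 2 * k := by positivity
      linarith
  obtain ⟨n₁, hn₁⟩ := exists_nat_ge (2 * C / (ε * η))
  refine ⟨max n₁ 1, fun n hn k hk => ?_⟩
  have hn0 : (0 : ℝ) < n := by
    have : 1 ≤ n := (le_max_right _ _).trans hn
    exact_mod_cast this
  have hnC : C ≤ ε * η / 2 * n := by
    have h1 : 2 * C / (ε * η) ≤ n := hn₁.trans (by exact_mod_cast (le_max_left _ _).trans hn)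
    rw [div_le_iff₀ (by positivity)] at h1
    linarith
  have hmp := hP.measurePreserving e.1
  have hint : Integrable
      (fun ω => |∑ j ∈ Finset.range k, arrivalIncrement G e ((shift e.1)^[j] ω)|) P :=
    (integrable_finsetSum _ fun j _ => (hmp.iterate j).integrable_comp_of_integrable hU).abs
  have hmarkov := mul_meas_ge_le_integral_of_nonneg (μ := P)
    (ae_of_all _ fun ω => abs_nonneg _) hint (ε * n)
  have hmono : P.real {ω | ε * n < |increment G ω (hitPt e ω 0) (hitPt e ω (k • e.1))|} ≤
      P.real {ω | ε * n ≤
        |∑ j ∈ Finset.range k, arrivalIncrement G e ((shift e.1)^[j] ω)|} := by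
    refine measureReal_mono_of_ae ?_
    filter_upwards [hreg] with ω hω h
    rw [hω.sum_arrivalIncrement]
    exact le_of_lt h
  have hkn : (k : ℝ) ≤ n := by exact_mod_cast hk
  have h3 : ε * n * P.real {ω | ε * n < |increment G ω (hitPt e ω 0) (hitPt e ω (k • e.1))|} ≤
      ε * n * η := by
    refine (mul_le_mul_of_nonneg_left hmono (by positivity)).trans (hmarkov.trans ?_)
    refine (hbound k).trans ?_
    have : ε * η / 2 * k ≤ ε * η / 2 * n := mul_le_mul_of_nonneg_left hkn hδ.le
    linarith
  exact le_of_mul_le_mul_left h3 (by positivity)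

theorem measurable_chemDist_hitPt (e e' : Dir d) :
    Measurable fun ω : Config d m => chemDist ω (hitPt e ω 0) (hitPt e' ω 0) := by
  have h1 : Measurable fun q : (ℕ × ℕ) × Config d m =>
      chemDist q.2 (0 + q.1.1 • e.1) (0 + q.1.2 • e'.1) :=
    measurable_from_prod_countable_right fun j =>
      measurable_chemDist (0 + j.1 • e.1) (0 + j.2 • e'.1)
  have h2 : Measurable fun ω : Config d m => (((hit e (shift 0 ω), hit e' (shift 0 ω)), ω) :
      (ℕ × ℕ) × Config d m) :=
    (((measurable_hit e).comp (measurable_shift 0)).prodMk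
      ((measurable_hit e').comp (measurable_shift 0))).prodMk measurable_id
  exact h1.comp h2

/-- Changing the direction of projection moves the projected point over a chemical distance whose
law does not depend on `n`, so that it contributes a negligible increment. -/
theorem increment_change_small (hreg : ∀ᵐ ω ∂P, Regular G A ω) (hA : 0 < A) (e e' : Dir d)
    {ε η : ℝ} (hε : 0 < ε) (hη : 0 < η) :
    ∃ n₀ : ℕ, ∀ n, n₀ ≤ n →
      P.real {ω | ε * n < |increment G ω (hitPt e ω 0) (hitPt e' ω 0)|} ≤ η := by
  obtain ⟨K, hK⟩ := exists_nat_measureReal_le (μ := P) (measurable_chemDist_hitPt e e') hη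
  obtain ⟨n₀, hn₀⟩ := exists_nat_ge (A * K / ε)
  refine ⟨n₀, fun n hn => le_trans (measureReal_mono_of_ae ?_) (hK K le_rfl)⟩
  filter_upwards [hreg] with ω hω h
  have h1 := hω.abs_increment_le (hω.hitPt_mem e 0) (hω.hitPt_mem e' 0)
  have h2 : ε * n < _ := h
  have h3 : A * K ≤ ε * n := by
    have : A * K / ε ≤ n := hn₀.trans (by exact_mod_cast hn)
    rw [div_le_iff₀ hε] at this
    linarith
  have h4 : A * K < A * chemDist ω (hitPt e ω 0) (hitPt e' ω 0) := by linarith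
  have h5 := lt_of_mul_lt_mul_left h4 hA.le
  have h6 : K < chemDist ω (hitPt e ω 0) (hitPt e' ω 0) := by exact_mod_cast h5
  exact h6.le

/-- The cocycle property of the increments, with a union bound. -/
theorem measureReal_increment_triangle (hreg : ∀ᵐ ω ∂P, Regular G A ω) (e₁ e₂ e₃ : Dir d)
    (x y z : Lat d) (a b : ℝ) :
    P.real {ω | a + b < |increment G ω (hitPt e₁ ω x) (hitPt e₃ ω z)|} ≤
      P.real {ω | a < |increment G ω (hitPt e₁ ω x) (hitPt e₂ ω y)|} +
      P.real {ω | b < |increment G ω (hitPt e₂ ω y) (hitPt e₃ ω z)|} := by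
  refine le_trans (measureReal_mono_of_ae ?_) (measureReal_union_le _ _)
  filter_upwards [hreg] with ω hω h
  have h1 : a + b < _ := h
  rw [← hω.increment_add (hω.hitPt_mem e₁ x) (hω.hitPt_mem e₂ y) (hω.hitPt_mem e₃ z)] at h1
  by_contra hcon
  simp only [mem_union, mem_ofPred_eq, not_or, not_lt] at hcon
  have := abs_add_le (increment G ω (hitPt e₁ ω x) (hitPt e₂ ω y))
    (increment G ω (hitPt e₂ ω y) (hitPt e₃ ω z))
  linarith [hcon.1, hcon.2]

/-- Sublinearity along one coordinate direction for points that are all projected in the fixed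
direction `e₀`: change to direction `e`, move along the axis, and change back. -/
theorem increment_step_small (hP : Admissible P) (hG : GradientClass P G)
    (hreg : ∀ᵐ ω ∂P, Regular G A ω) (hA : 0 < A) (e₀ e : Dir d) {ε η : ℝ} (hε : 0 < ε)
    (hη : 0 < η) :
    ∃ n₀ : ℕ, ∀ n : ℕ, n₀ ≤ n → ∀ k : ℤ, |k| ≤ n → ∀ x,
      P.real {ω | ε * n < |increment G ω (hitPt e₀ ω x) (hitPt e₀ ω (x + k • e.1))|} ≤ η := by
  obtain ⟨n₁, h₁⟩ := increment_axis_small hP hG hreg e (ε := ε / 3) (η := η / 3)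
    (by positivity) (by positivity)
  obtain ⟨n₂, h₂⟩ := increment_change_small hreg hA e₀ e (ε := ε / 3) (η := η / 3)
    (by positivity) (by positivity)
  obtain ⟨n₃, h₃⟩ := increment_change_small hreg hA e e₀ (ε := ε / 3) (η := η / 3)
    (by positivity) (by positivity)
  have key : ∀ n : ℕ, max n₁ (max n₂ n₃) ≤ n → ∀ k : ℕ, k ≤ n → ∀ x,
      P.real {ω | ε * n < |increment G ω (hitPt e₀ ω x) (hitPt e₀ ω (x + k • e.1))|} ≤ η := by
    intro n hn k hk x
    have e1 := h₁ n ((le_max_left _ _).trans hn) k hk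
    have e2 := h₂ n (((le_max_left _ _).trans (le_max_right _ _)).trans hn)
    have e3 := h₃ n (((le_max_right _ _).trans (le_max_right _ _)).trans hn)
    have t1 := measureReal_increment_shift (G := G) hP e₀ e₀ x 0 (k • e.1) (ε * n)
    rw [add_zero] at t1
    have t2 := measureReal_increment_triangle hreg e₀ e e₀ 0 0 (k • e.1) (ε / 3 * n)
      (ε / 3 * n + ε / 3 * n)
    have t3 := measureReal_increment_triangle hreg e e e₀ 0 (k • e.1) (k • e.1) (ε / 3 * n)
      (ε / 3 * n)
    have t4 := measureReal_increment_shift (G := G) hP e e₀ (k • e.1) 0 0 (ε / 3 * n)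
    rw [add_zero] at t4
    have t5 : ε / 3 * n + (ε / 3 * n + ε / 3 * n) = ε * n := by ring
    rw [t5] at t2
    rw [t1]
    linarith
  refine ⟨max n₁ (max n₂ n₃), fun n hn k hk x => ?_⟩
  obtain ⟨j, rfl | rfl⟩ := k.eq_nat_or_neg
  · have hj : j ≤ n := by simpa using hk
    simpa using key n hn j hj x
  · have hj : j ≤ n := by simpa using hk
    have := key n hn j hj (x + (-(j : ℤ)) • e.1)
    refine le_trans (measureReal_mono_of_ae ?_) this
    filter_upwards [hreg] with ω hω h
    have h1 : ε * n < _ := h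
    have h2 : x + (-(j : ℤ)) • e.1 + j • e.1 = x := by simp
    change ε * n < _
    rw [h2, hω.increment_symm (hω.hitPt_mem _ _) (hω.hitPt_mem _ _), abs_neg]
    exact h1

/-- The increment to any point of the box is small in probability, by moving along one coordinate
after the other. The bound holds for each point separately, not for all points at once. -/
theorem increment_box_small (hP : Admissible P) (hG : GradientClass P G)
    (hreg : ∀ᵐ ω ∂P, Regular G A ω) (hA : 0 < A) (e₀ : Dir d) {ε η : ℝ} (hε : 0 < ε)
    (hη : 0 < η) :
    ∃ n₀ : ℕ, ∀ n : ℕ, n₀ ≤ n → ∀ x ∈ box d n,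
      P.real {ω | ε * n < |increment G ω (hitPt e₀ ω 0) (hitPt e₀ ω x)|} ≤ η := by
  have key : ∀ s : Finset (Fin d), ∀ ε η : ℝ, 0 < ε → 0 < η →
      ∃ n₀ : ℕ, ∀ n : ℕ, n₀ ≤ n → ∀ x ∈ box d n,
      P.real {ω | ε * n < |increment G ω (hitPt e₀ ω 0)
        (hitPt e₀ ω (∑ i ∈ s, x i • (coordDir i).1))|} ≤ η := by
    intro s
    induction s using Finset.induction_on with
    | empty =>
      intro ε η hε hη
      refine ⟨0, fun n _ x _ => ?_⟩
      have h0 : P.real (∅ : Set (Config d m)) ≤ η := by simpa using hη.le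
      refine le_trans (measureReal_mono_of_ae ?_) h0
      filter_upwards [hreg] with ω hω h
      simp only [Finset.sum_empty] at h
      rw [hω.increment_self (hω.hitPt_mem _ _), abs_zero] at h
      have : 0 ≤ ε * n := by positivity
      exact absurd h (not_lt.2 this)
    | insert i s hi ih =>
      intro ε η hε hη
      obtain ⟨n₁, h₁⟩ := ih (ε / 2) (η / 2) (by positivity) (by positivity)
      obtain ⟨n₂, h₂⟩ := increment_step_small hP hG hreg hA e₀ (coordDir i) (ε := ε / 2)
        (η := η / 2) (by positivity) (by positivity)
      refine ⟨max n₁ n₂, fun n hn x hx => ?_⟩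
      have e1 := h₁ n ((le_max_left _ _).trans hn) x hx
      have e2 := h₂ n ((le_max_right _ _).trans hn) (x i) (mem_box.1 hx i)
        (∑ i ∈ s, x i • (coordDir i).1)
      have e3 := measureReal_increment_triangle hreg e₀ e₀ e₀ 0 (∑ i ∈ s, x i • (coordDir i).1)
        (∑ i ∈ s, x i • (coordDir i).1 + x i • (coordDir i).1) (ε / 2 * n) (ε / 2 * n)
      have t : ε / 2 * n + ε / 2 * n = ε * n := by ring
      rw [t] at e3
      rw [Finset.sum_insert hi, add_comm (x i • (coordDir i).1)]
      linarith
  obtain ⟨n₀, hn₀⟩ := key Finset.univ ε η hε hη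
  refine ⟨n₀, fun n hn x hx => ?_⟩
  have hx' : ∑ i, x i • (coordDir i).1 = x := by
    funext j
    simp [coordDir, Finset.sum_apply, Pi.single_apply]
  have := hn₀ n hn x hx
  rwa [hx'] at this

end Sublinear

end Perc

namespace Perc

open Filter Topology

variable {d : ℕ} {m : Model}

/-! ### Uniform sublinearity on boxes -/

section UniformSublinear

variable {P : Measure (Config d m)} [IsProbabilityMeasure P] {G : Config d m → Dir d → ℝ}
  {A : ℝ}

/-- Stretched logarithmic tails beat every polynomial. -/
theorem tendsto_pow_mul_exp_neg_log_rpow (a b : ℝ) (p : ℕ) (ha : 0 < a) (hb : 0 < b) :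
    Tendsto (fun M : ℕ => (M : ℝ) ^ p * Real.exp (-a * (Real.log M) ^ (1 + b))) atTop (𝓝 0) := by
  have hlog : Tendsto (fun M : ℕ => Real.log (M : ℝ)) atTop atTop :=
    Real.tendsto_log_atTop.comp tendsto_natCast_atTop_atTop
  have h1 : ∀ᶠ L : ℝ in atTop, (p + 1) / a ≤ L ^ b :=
    (tendsto_rpow_atTop hb).eventually (eventually_ge_atTop _)
  have h2 : Tendsto (fun M : ℕ => Real.exp (-Real.log (M : ℝ))) atTop (𝓝 0) :=
    Real.tendsto_exp_neg_atTop_nhds_zero.comp hlog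
  refine squeeze_zero' (Eventually.of_forall fun M => by positivity) ?_ h2
  filter_upwards [hlog.eventually h1, hlog.eventually (eventually_gt_atTop 0),
    eventually_gt_atTop 0] with M hM hM0 hpos
  have hMp : (0 : ℝ) < M := by exact_mod_cast hpos
  have h3 : (M : ℝ) ^ p = Real.exp (p * Real.log M) := by
    rw [Real.exp_nat_mul, Real.exp_log hMp]
  rw [h3, ← Real.exp_add, Real.exp_le_exp, Real.rpow_add hM0, Real.rpow_one]
  have h4 : (p + 1 : ℝ) ≤ a * Real.log M ^ b := by
    rw [div_le_iff₀ ha] at hM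
    linarith
  nlinarith [mul_le_mul_of_nonneg_right h4 hM0.le]

/-- With high probability the chemical distance is comparable to the lattice distance for all
pairs of cluster points in a large box that are not too close to each other. -/
theorem chemDist_box_small (hP : Admissible P) :
    ∃ c : ℝ, 0 < c ∧ ∀ K : ℕ, ∀ η : ℝ, 0 < η → ∃ M₀ : ℕ, ∀ M : ℕ, M₀ ≤ M →
      P.real {ω | ∃ y ∈ box d (K * M), ∃ z ∈ box d (K * M), y ∈ infCluster ω ∧
        z ∈ infCluster ω ∧ (M : ℤ) ≤ l1 (z - y) ∧
        c * (l1 (z - y) : ℝ) ≤ (chemDist ω y z : ℝ)} ≤ η := by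
  obtain ⟨c₁, c₂, c₃, c₄, h₁, h₂, h₃, h₄, hchem⟩ := hP.chem_dist
  refine ⟨c₁, h₁, fun K η hη => ?_⟩
  have hlim := (tendsto_pow_mul_exp_neg_log_rpow c₃ c₄ (d + d) h₃ h₄).const_mul
    ((2 * K + 1 : ℝ) ^ (d + d) * c₂)
  rw [mul_zero] at hlim
  obtain ⟨M₀, hM₀⟩ := eventually_atTop.1 (hlim.eventually (gt_mem_nhds hη))
  refine ⟨max M₀ 1, fun M hM => ?_⟩
  have hM1 : 1 ≤ M := (le_max_right _ _).trans hM
  set E : Lat d × Lat d → Set (Config d m) := fun q => {ω | q.1 ∈ infCluster ω ∧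
    q.2 ∈ infCluster ω ∧ (M : ℤ) ≤ l1 (q.2 - q.1) ∧
    c₁ * (l1 (q.2 - q.1) : ℝ) ≤ (chemDist ω q.1 q.2 : ℝ)} with hE
  have hsub : {ω : Config d m | ∃ y ∈ box d (K * M), ∃ z ∈ box d (K * M), y ∈ infCluster ω ∧
        z ∈ infCluster ω ∧ (M : ℤ) ≤ l1 (z - y) ∧
        c₁ * (l1 (z - y) : ℝ) ≤ (chemDist ω y z : ℝ)} ⊆
      ⋃ q ∈ box d (K * M) ×ˢ box d (K * M), E q := by
    rintro ω ⟨y, hy, z, hz, h⟩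
    exact mem_biUnion (x := (y, z)) (Finset.mem_coe.2 (Finset.mk_mem_product hy hz)) h
  have hEq : ∀ q, P.real (E q) ≤ c₂ * Real.exp (-c₃ * (Real.log M) ^ (1 + c₄)) := by
    rintro ⟨y, z⟩
    by_cases hMl : (M : ℤ) ≤ l1 (z - y)
    · have hne : z - y ≠ 0 := by
        intro h0
        rw [h0, l1_zero] at hMl
        omega
      have hle : P.real (E (y, z)) ≤ P.real {ω | c₁ * (l1 (z - y) : ℝ) ≤
          (chemDist ω 0 (z - y) : ℝ) ∧ 0 ∈ infCluster ω ∧ z - y ∈ infCluster ω} := by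
        rw [measureReal_def, measureReal_def, ← hP.measure_preimage y {ω | c₁ * (l1 (z - y) : ℝ) ≤
          (chemDist ω 0 (z - y) : ℝ) ∧ 0 ∈ infCluster ω ∧ z - y ∈ infCluster ω}]
        refine ENNReal.toReal_mono (measure_ne_top _ _) (measure_mono ?_)
        rintro ω ⟨h1, h2, h3, h4⟩
        refine ⟨?_, ?_, ?_⟩
        · rw [chemDist_shift]
          simpa using h4
        · rw [mem_infCluster_shift]
          simpa using h1
        · rw [mem_infCluster_shift]
          simpa using h2
      refine hle.trans ((hchem _ hne).trans ?_)
      have hMR : (M : ℝ) ≤ (l1 (z - y) : ℝ) := by exact_mod_cast hMl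
      have hM1R : (1 : ℝ) ≤ M := by exact_mod_cast hM1
      have h5 : Real.log M ^ (1 + c₄) ≤ Real.log (l1 (z - y)) ^ (1 + c₄) :=
        Real.rpow_le_rpow (Real.log_nonneg hM1R) (Real.log_le_log (by linarith) hMR) (by linarith)
      refine mul_le_mul_of_nonneg_left (Real.exp_le_exp.2 ?_) h₂.le
      nlinarith
    · have : E (y, z) = ∅ := by
        ext ω
        simp [hE, hMl]
      rw [this, measureReal_empty]
      positivity
  have hcard : ((box d (K * M) ×ˢ box d (K * M)).card : ℝ) ≤
      (2 * K + 1 : ℝ) ^ (d + d) * (M : ℝ) ^ (d + d) := by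
    rw [Finset.card_product, card_box, ← pow_add, ← mul_pow]
    push_cast
    have hM1R : (1 : ℝ) ≤ M := by exact_mod_cast hM1
    refine pow_le_pow_left₀ (by positivity) ?_ _
    nlinarith
  calc P.real _ ≤ P.real (⋃ q ∈ box d (K * M) ×ˢ box d (K * M), E q) :=
        measureReal_mono hsub (measure_ne_top _ _)
    _ ≤ ∑ q ∈ box d (K * M) ×ˢ box d (K * M), P.real (E q) := measureReal_biUnion_finset_le _ _
    _ ≤ (box d (K * M) ×ˢ box d (K * M)).card •
        (c₂ * Real.exp (-c₃ * (Real.log M) ^ (1 + c₄))) :=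
        Finset.sum_le_card_nsmul _ _ _ fun q _ => hEq q
    _ ≤ ((2 * K + 1 : ℝ) ^ (d + d) * (M : ℝ) ^ (d + d)) *
        (c₂ * Real.exp (-c₃ * (Real.log M) ^ (1 + c₄))) := by
        rw [nsmul_eq_mul]
        exact mul_le_mul_of_nonneg_right hcard (by positivity)
    _ ≤ η := by
        have := (hM₀ M ((le_max_left _ _).trans hM)).le
        refine le_trans (le_of_eq ?_) this
        ring

/-- The corrector is sublinear in probability, uniformly on large boxes. Most lattice points in
a box project to a cluster point with small corrector; every cluster point lies at moderate
distance from such a point, and there the corrector changes at most by the chemical distance. -/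
theorem corrector_box_small (hd : 0 < d) (hP : Admissible P) (hG : GradientClass P G) {ε η : ℝ}
    (hε : 0 < ε) (hη : 0 < η) :
    ∃ n : ℕ, 1 ≤ n ∧ P.real {ω | ω ∈ Omega0 d m ∧ ∃ y ∈ infCluster ω, y ∈ box d n ∧
      ε * n < |increment G ω 0 y|} ≤ η := by
  classical
  obtain ⟨A, hA, hbd⟩ := hG.exists_bound
  have hreg := ae_regular hP hG.ae_loopFree hbd
  obtain ⟨c, hc, hchem⟩ := chemDist_box_small hP
  set i₀ : Fin d := ⟨0, hd⟩
  set e₀ : Dir d := coordDir i₀ with he₀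
  -- the side length `M` of the small cubes is the fraction `1 / r` of the size of the box
  obtain ⟨r, hr⟩ := exists_nat_ge (6 * A * c * d / ε + 1)
  have hr1 : (1 : ℝ) ≤ r := by
    have : 0 ≤ 6 * A * c * d / ε := by positivity
    linarith
  have hr1' : 1 ≤ r := by exact_mod_cast hr1
  have hrε : 6 * A * c * d ≤ ε * r := by
    have h1 : 6 * A * c * d / ε ≤ r := by linarith
    rw [div_le_iff₀ hε] at h1
    linarith
  set θ : ℝ := η / (4 * (7 * r : ℝ) ^ d) with hθ
  have hθ0 : 0 < θ := by positivity
  obtain ⟨n₁, hn₁⟩ := increment_box_small hP hG hreg hA e₀ (ε := ε / 6) (η := θ)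
    (by positivity) hθ0
  obtain ⟨n₂, hn₂⟩ := exists_nat_measureReal_le (μ := P) (measurable_hit e₀) hθ0
  obtain ⟨n₃, hn₃⟩ := hchem (4 * r) (η / 2) (by positivity)
  set M : ℕ := max (max n₁ n₂) (max n₃ 1) with hMdef
  have hM1 : 1 ≤ M := (le_max_right _ _).trans (le_max_right _ _)
  have hMn₁ : n₁ ≤ M := (le_max_left _ _).trans (le_max_left _ _)
  have hMn₂ : n₂ ≤ M := (le_max_right _ _).trans (le_max_left _ _)
  have hMn₃ : n₃ ≤ M := (le_max_left _ _).trans (le_max_right _ _)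
  have hMR : (1 : ℝ) ≤ M := by exact_mod_cast hM1
  set B : Lat d → Set (Config d m) := fun x =>
    {ω | ε / 6 * ((3 * r * M : ℕ) : ℝ) < |increment G ω (hitPt e₀ ω 0) (hitPt e₀ ω x)|} ∪
    {ω | M ≤ hit e₀ (shift x ω)} with hB
  have hBx : ∀ x ∈ box d (3 * r * M), P.real (B x) ≤ 2 * θ := by
    intro x hx
    have h1 := hn₁ (3 * r * M) (hMn₁.trans (by nlinarith)) x hx
    have h2 : P.real {ω | M ≤ hit e₀ (shift x ω)} ≤ θ := by
      have h3 := hP.measure_preimage x {ω : Config d m | M ≤ hit e₀ ω}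
      have h4 : P.real {ω | M ≤ hit e₀ (shift x ω)} = P.real {ω | M ≤ hit e₀ ω} := by
        rw [measureReal_def, measureReal_def, ← h3]
        rfl
      rw [h4]
      exact hn₂ M hMn₂
    refine (measureReal_union_le _ _).trans ?_
    linarith
  set F : Set (Config d m) := {ω | ∃ T ⊆ box d (3 * r * M), (M : ℝ) ^ d ≤ (T.card : ℝ) ∧
    ∀ x ∈ T, ω ∈ B x} with hF
  have hFle : P.real F ≤ η / 2 := by
    have h1 := measureReal_card_ge_le (μ := P) (box d (3 * r * M)) B ((M : ℝ) ^ d)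
    have h2 : ∑ x ∈ box d (3 * r * M), P.real (B x) ≤ (M : ℝ) ^ d * (η / 2) := by
      refine (Finset.sum_le_card_nsmul _ _ _ hBx).trans ?_
      rw [card_box, nsmul_eq_mul]
      push_cast
      have h3 : (2 * (3 * r * M) + 1 : ℝ) ^ d ≤ (7 * r : ℝ) ^ d * (M : ℝ) ^ d := by
        rw [← mul_pow]
        refine pow_le_pow_left₀ (by positivity) ?_ _
        nlinarith
      refine (mul_le_mul_of_nonneg_right h3 (by positivity)).trans (le_of_eq ?_)
      rw [hθ]
      field_simp
      ring
    exact le_of_mul_le_mul_left (h1.trans h2) (by positivity)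
  set E : Set (Config d m) := {ω | ∃ y ∈ box d (4 * r * M), ∃ z ∈ box d (4 * r * M),
    y ∈ infCluster ω ∧ z ∈ infCluster ω ∧ (M : ℤ) ≤ l1 (z - y) ∧
    c * (l1 (z - y) : ℝ) ≤ (chemDist ω y z : ℝ)} with hEdef
  have hEle : P.real E ≤ η / 2 := hn₃ M hMn₃
  refine ⟨r * M, Nat.mul_pos hr1' hM1, ?_⟩
  have hfin : P.real (F ∪ E) ≤ η := (measureReal_union_le _ _).trans (by linarith)
  refine le_trans (measureReal_mono_of_ae ?_) hfin
  filter_upwards [hreg] with ω hω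
  rintro ⟨h0, y, hyC, hyb, hlt⟩
  by_contra hcon
  rw [mem_union, not_or] at hcon
  obtain ⟨hnF, hnE⟩ := hcon
  have h0C : (0 : Lat d) ∈ infCluster ω := h0
  -- a cube at moderate distance from `y`, on the side of the projection direction
  set Q : Finset (Lat d) := Fintype.piFinset fun i => Finset.Ico (y i + M) (y i + 2 * M) with hQ
  have hQcard : Q.card = M ^ d := by
    simp only [hQ, Fintype.card_piFinset, Int.card_Ico]
    rw [Finset.prod_congr rfl fun i _ => show ((y i + 2 * M - (y i + M)).toNat = M) by omega]
    simp
  have hyi : ∀ i, |y i| ≤ (r * M : ℕ) := mem_box.1 hyb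
  have hrM : (M : ℤ) ≤ r * M := by
    have : M ≤ r * M := Nat.le_mul_of_pos_left _ hr1'
    exact_mod_cast this
  have hQsub : Q ⊆ box d (3 * r * M) := by
    intro x hx
    rw [mem_box]
    intro i
    have h1 := Finset.mem_Ico.1 (Fintype.mem_piFinset.1 hx i)
    have h2 := abs_le.1 (hyi i)
    push_cast at h2 ⊢
    rw [abs_le]
    constructor <;> nlinarith
  obtain ⟨x, hxQ, hxB⟩ : ∃ x ∈ Q, ω ∉ B x := by
    by_contra hall
    push Not at hall
    exact hnF ⟨Q, hQsub, by rw [hQcard]; push_cast; exact le_rfl, hall⟩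
  rw [hB] at hxB
  simp only [mem_union, mem_ofPred_eq, not_or, not_lt, not_le] at hxB
  obtain ⟨hx1, hx2⟩ := hxB
  set z : Lat d := hitPt e₀ ω x with hz
  have hzC : z ∈ infCluster ω := hω.hitPt_mem e₀ x
  have hzi : ∀ i, y i + M ≤ z i ∧ z i ≤ y i + 3 * M := by
    intro i
    have h1 := Finset.mem_Ico.1 (Fintype.mem_piFinset.1 hxQ i)
    have h2 : z i = x i + hit e₀ (shift x ω) * (if i = i₀ then 1 else 0) := by
      rw [hz, hitPt, he₀]
      simp [coordDir, Pi.single_apply]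
    rw [h2]
    have h3 : (hit e₀ (shift x ω) : ℤ) < M := by exact_mod_cast hx2
    have h4 : (0 : ℤ) ≤ hit e₀ (shift x ω) := Int.natCast_nonneg _
    split_ifs <;> constructor <;> linarith
  have hzb : z ∈ box d (4 * r * M) := by
    rw [mem_box]
    intro i
    have h2 := abs_le.1 (hyi i)
    have h1 := hzi i
    push_cast at h2 ⊢
    rw [abs_le]
    constructor <;> nlinarith
  have hyb' : y ∈ box d (4 * r * M) := by
    rw [mem_box]
    intro i
    refine (hyi i).trans ?_
    push_cast
    nlinarith
  have hl1 : (M : ℤ) ≤ l1 (z - y) := by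
    refine le_trans ?_ (abs_apply_le_l1 (z - y) i₀)
    refine le_trans ?_ (le_abs_self _)
    have := (hzi i₀).1
    simp only [Pi.sub_apply]
    linarith
  have hl2 : l1 (z - y) ≤ d * (3 * M) := by
    unfold l1
    refine (Finset.sum_le_card_nsmul _ _ (3 * (M : ℤ)) fun i _ => ?_).trans (le_of_eq (by simp))
    have := hzi i
    simp only [Pi.sub_apply]
    rw [abs_le]
    constructor <;> linarith
  have hdist : (chemDist ω y z : ℝ) ≤ c * (d * (3 * M)) := by
    have h1 : (chemDist ω y z : ℝ) < c * (l1 (z - y) : ℝ) := by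
      by_contra hcon
      exact hnE ⟨y, hyb', z, hzb, hyC, hzC, hl1, not_lt.1 hcon⟩
    have h2 : (l1 (z - y) : ℝ) ≤ d * (3 * M) := by exact_mod_cast hl2
    exact h1.le.trans (mul_le_mul_of_nonneg_left h2 hc.le)
  rw [hitPt_of_mem h0C] at hx1
  have e1 := hω.increment_add h0C hzC hyC
  have e2 := hω.abs_increment_le hyC hzC
  rw [hω.increment_symm hyC hzC] at e1
  have e3 : |increment G ω 0 y| ≤ |increment G ω 0 z| + |increment G ω y z| := by
    rw [← e1, ← sub_eq_add_neg]
    exact abs_sub _ _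
  have e4 : A * (chemDist ω y z : ℝ) ≤ A * (c * (d * (3 * M))) :=
    mul_le_mul_of_nonneg_left hdist hA.le
  have e5 : A * (c * (d * (3 * M))) ≤ ε * r / 2 * M := by
    have := mul_le_mul_of_nonneg_right hrε (by positivity : (0 : ℝ) ≤ M / 2)
    nlinarith
  push_cast at hx1 hlt
  nlinarith

end UniformSublinear

end Perc

namespace Perc

open Filter Topology

variable {d : ℕ} {m : Model}

/-! ### Gradients are orthogonal to stationary flows -/

/-- The mass flow of a stationary environment process: `ψ(ω,e)` is the mass that moves from `ω` to
`τ_e ω`, and stationarity says that `ψ` annihilates the gradients of bounded functions. -/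
structure IsFlow (P : Measure (Config d m)) (ψ : Config d m → Dir d → ℝ) : Prop where
  integrable : ∀ e, Integrable (fun ω => ψ ω e) (P0 P)
  nonneg : ∀ᵐ ω ∂(P0 P), ∀ e, 0 ≤ ψ ω e
  support : ∀ᵐ ω ∂(P0 P), ∀ e : Dir d, ¬ (openGraph ω).Adj 0 e.1 → ψ ω e = 0
  stationary : ∀ g : Config d m → ℝ, Measurable g → (∃ C : ℝ, ∀ ω, |g ω| ≤ C) →
    ∫ ω, ∑ e, ψ ω e * (g ω - g (shift e.1 ω)) ∂(P0 P) = 0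

/-- The price of a path of length `t`: `ε` per step up to length `n`, and `A` per step beyond. -/
noncomputable def pathCost (ε A : ℝ) (n t : ℕ) : ℝ := ε * (min t n : ℕ) + A * (t - n : ℕ)

/-- The least value of `∑ G + cost` over the open paths from the origin. It is an approximate
potential of `G`; the truncation at `-A n` is inactive for regular configurations. -/
noncomputable def approxPotential (G : Config d m → Dir d → ℝ) (ε A : ℝ) (n : ℕ)
    (ω : Config d m) : ℝ :=
  open Classical in
  ⨅ l : List (Dir d), if OpenPath ω l then
    max (total G ω l + pathCost ε A n l.length) (-(A * n)) else 0

section ApproxPotential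

variable {G : Config d m → Dir d → ℝ} {ε A : ℝ} {n : ℕ} {ω : Config d m}

theorem approxPotential_bddBelow (hA : 0 ≤ A) (ω : Config d m) : BddBelow (range
    fun l : List (Dir d) => open Classical in if OpenPath ω l then
      max (total G ω l + pathCost ε A n l.length) (-(A * n)) else 0) := by
  refine ⟨-(A * n), ?_⟩
  rintro _ ⟨l, rfl⟩
  dsimp only
  split_ifs
  · exact le_max_right _ _
  · have : 0 ≤ A * n := by positivity
    linarith

theorem approxPotential_le (hA : 0 ≤ A) {l : List (Dir d)} (hl : OpenPath ω l) :
    approxPotential G ε A n ω ≤ max (total G ω l + pathCost ε A n l.length) (-(A * n)) := by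
  refine (ciInf_le (approxPotential_bddBelow hA ω) l).trans (le_of_eq ?_)
  rw [if_pos hl]

theorem approxPotential_nonpos (hA : 0 ≤ A) : approxPotential G ε A n ω ≤ 0 := by
  refine (approxPotential_le hA (openPath_nil ω)).trans ?_
  have : 0 ≤ A * n := by positivity
  simp [pathCost, this]

theorem neg_le_approxPotential (hA : 0 ≤ A) : -(A * n) ≤ approxPotential G ε A n ω := by
  refine le_ciInf fun l => ?_
  split_ifs
  · exact le_max_right _ _
  · have : 0 ≤ A * n := by positivity
    linarith

theorem abs_approxPotential_le (hA : 0 ≤ A) : |approxPotential G ε A n ω| ≤ A * n :=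
  abs_le.2 ⟨neg_le_approxPotential hA,
    (approxPotential_nonpos hA).trans (by positivity)⟩

/-- The infimum runs over the countable set of all lists of directions; this is the reason for
taking lists, with a default value for those that are not open paths. -/
theorem measurable_approxPotential (hG : ∀ e, Measurable fun ω => G ω e) :
    Measurable (approxPotential G ε A n) := by
  refine Measurable.iInf fun l => ?_
  exact Measurable.ite (measurableSet_openPath l)
    (((measurable_total hG l).add_const _).max measurable_const) measurable_const

theorem pathCost_succ_le (hε : ε ≤ A) (t : ℕ) :
    pathCost ε A n (t + 1) ≤ pathCost ε A n t + A := by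
  unfold pathCost
  rcases Nat.lt_or_ge t n with h | h
  · rw [min_eq_left h.le, min_eq_left (show t + 1 ≤ n from h), Nat.sub_eq_zero_of_le h.le,
      Nat.sub_eq_zero_of_le (show t + 1 ≤ n from h)]
    push_cast
    linarith
  · rw [min_eq_right h, min_eq_right (h.trans (Nat.le_succ t)), Nat.succ_sub h]
    push_cast
    linarith

theorem pathCost_succ_of_lt {t : ℕ} (h : t < n) :
    pathCost ε A n (t + 1) = pathCost ε A n t + ε := by
  unfold pathCost
  rw [min_eq_left h.le, min_eq_left (show t + 1 ≤ n from h), Nat.sub_eq_zero_of_le h.le,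
    Nat.sub_eq_zero_of_le (show t + 1 ≤ n from h)]
  push_cast
  ring

/-- Prepending one step changes the approximate potential in the right way, up to the price `s`
of that step; only paths that can compete with the empty path need to be considered. -/
theorem Regular.approxPotential_shift_le (h : Regular G A ω) (h0 : ω ∈ Omega0 d m)
    (hε : 0 ≤ ε) (hA : 0 ≤ A) {e : Dir d} (he : (openGraph ω).Adj 0 e.1) {s : ℝ}
    (hs : ∀ l, OpenPath ω l → total G ω l + pathCost ε A n l.length < 0 ∨ l = [] →
      pathCost ε A n (l.length + 1) ≤ pathCost ε A n l.length + s) :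
    approxPotential G ε A n (shift e.1 ω) ≤ approxPotential G ε A n ω - G ω e + s := by
  have hloop : LoopFree G ω := by simpa using h.loopFree 0 h0
  have hreg' : ∀ l, OpenPath (shift e.1 ω) l →
      -(A * n) ≤ total G (shift e.1 ω) l + pathCost ε A n l.length := by
    intro l hl
    have h1 := h.abs_total_le (x := e.1)
      ((shift_mem_Omega0 _ _).1 (shift_mem_Omega0_of_adj h0 he)) hl
    have h2 := (abs_le.1 h1).1
    have h3 : (l.length : ℝ) ≤ (l.length - n : ℕ) + n := by
      exact_mod_cast (le_tsub_add : l.length ≤ l.length - n + n)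
    have h4 : A * l.length ≤ A * ((l.length - n : ℕ) + n) := mul_le_mul_of_nonneg_left h3 hA
    have h5 : 0 ≤ ε * (min l.length n : ℕ) := by positivity
    unfold pathCost
    linarith
  have key : ∀ l, OpenPath ω l → total G ω l + pathCost ε A n l.length < 0 ∨ l = [] →
      approxPotential G ε A n (shift e.1 ω) ≤
        total G ω l + pathCost ε A n l.length - G ω e + s := by
    intro l hl hcase
    have hop : OpenPath (shift e.1 ω) (negDir e :: l) := by
      refine ⟨(adj_negDir ω e).2 he, ?_⟩
      rw [shift_shift]
      simpa using hl
    refine (approxPotential_le hA hop).trans ?_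
    rw [max_eq_left (hreg' _ hop), total_cons, hloop.antisymm he, shift_shift, List.length_cons]
    have := hs l hl hcase
    simp only [negDir_val, add_neg_cancel, shift_zero]
    linarith
  have hnil := key [] trivial (Or.inr rfl)
  simp only [total_nil, List.length_nil, zero_add] at hnil
  have hpc : pathCost ε A n 0 = 0 := by simp [pathCost]
  rw [hpc] at hnil
  suffices approxPotential G ε A n (shift e.1 ω) + G ω e - s ≤ approxPotential G ε A n ω by
    linarith
  refine le_ciInf fun l => ?_
  split_ifs with hl
  · refine le_trans ?_ (le_max_left _ _)
    by_cases hneg : total G ω l + pathCost ε A n l.length < 0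
    · have := key l hl (Or.inl hneg)
      linarith
    · linarith
  · linarith

end ApproxPotential

theorem pathSum_neg (G : Config d m → Dir d → ℝ) (ω : Config d m) {x y : Lat d}
    (w : (openGraph ω).Walk x y) : pathSum (fun ω e => -G ω e) ω w = -pathSum G ω w := by
  unfold pathSum
  induction w.darts with
  | nil => simp
  | cons a l ih =>
    simp only [List.map_cons, List.sum_cons, ih]
    ring

theorem corrector_neg (G : Config d m → Dir d → ℝ) (ω : Config d m) (x : Lat d) :
    corrector (fun ω e => -G ω e) ω x = -corrector G ω x := by
  unfold corrector
  split_ifs with h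
  · exact pathSum_neg G ω _
  · simp

theorem GradientClass.neg {P : Measure (Config d m)} {G : Config d m → Dir d → ℝ}
    (hG : GradientClass P G) : GradientClass P fun ω e => -G ω e where
  measurable e := (hG.measurable e).neg
  bounded e := by simpa using hG.bounded e
  closed_loop := by
    filter_upwards [hG.closed_loop] with ω hω x hx w
    rw [pathSum_neg, hω x hx w, neg_zero]
  mean_zero e := by
    simp only [corrector_neg]
    exact ⟨(hG.mean_zero e).1.neg, by rw [integral_neg, (hG.mean_zero e).2, neg_zero]⟩

section Orthogonality

variable {P : Measure (Config d m)} [IsProbabilityMeasure P] {G : Config d m → Dir d → ℝ}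

/-- Small sets carry little mass, for sets that need not be measurable and probabilities taken
before conditioning. -/
theorem exists_pos_setIntegral_le (hP : Admissible P) {φ : Config d m → ℝ}
    (hφ : Integrable φ (P0 P)) (h0 : 0 ≤ᵐ[P0 P] φ) {ε : ℝ} (hε : 0 < ε) :
    ∃ η : ℝ, 0 < η ∧ ∀ s : Set (Config d m), P.real s ≤ η →
      ∫ ω in toMeasurable (P0 P) s, φ ω ∂(P0 P) ≤ ε := by
  have hlt : ∫⁻ ω, ENNReal.ofReal (φ ω) ∂(P0 P) ≠ ∞ := by
    rw [← ofReal_integral_eq_lintegral_ofReal hφ h0]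
    exact ENNReal.ofReal_ne_top
  obtain ⟨δ, hδ, hs⟩ := exists_pos_setLIntegral_lt_of_measure_lt hlt
    (ε := ENNReal.ofReal ε) (by simpa using hε)
  set κ : ℝ≥0∞ := min δ 1 * P (Omega0 d m) with hκ
  have hκ0 : κ ≠ 0 := mul_ne_zero (by simp [hδ.ne']) hP.measure_Omega0_ne_zero
  have hκt : κ ≠ ∞ := ENNReal.mul_ne_top (by simp) (measure_ne_top _ _)
  have hκr : 0 < κ.toReal := ENNReal.toReal_pos hκ0 hκt
  refine ⟨κ.toReal / 2, by positivity, fun s hsη => ?_⟩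
  have h1 : P s < κ := by
    rw [← ENNReal.toReal_lt_toReal (measure_ne_top _ _) hκt]
    exact lt_of_le_of_lt hsη (by linarith)
  have h2 : P0 P (toMeasurable (P0 P) s) < δ := by
    rw [measure_toMeasurable]
    refine lt_of_le_of_lt (P0_le s) (lt_of_lt_of_le ?_ (min_le_left δ 1))
    rw [mul_comm, ← div_eq_mul_inv]
    exact ENNReal.div_lt_of_lt_mul h1
  have h3 := hs _ h2
  rw [integral_eq_lintegral_of_nonneg_ae (ae_restrict_of_ae h0) hφ.aestronglyMeasurable.restrict]
  exact (ENNReal.toReal_lt_of_lt_ofReal h3).le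

/-- The gradient `G` is compared with the gradient of its approximate potential, which the flow
annihilates. The error is `ε` where the corrector is at least `-ε n` on the box of size `n`, because
only paths shorter than `n` compete there, and it is at most `A` on the small remaining set. For
each `ε` a suitable `n` is fixed, and then `ε` tends to zero. -/
theorem IsFlow.integral_gradient_nonpos (hd : 0 < d) (hP : Admissible P)
    (hG : GradientClass P G) {ψ : Config d m → Dir d → ℝ} (hψ : IsFlow P ψ) :
    ∫ ω, ∑ e, ψ ω e * G ω e ∂(P0 P) ≤ 0 := by
  obtain ⟨A, hA, hbd⟩ := hG.exists_bound
  have hreg := ae_regular hP hG.ae_loopFree hbd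
  have hreg0 : ∀ᵐ ω ∂(P0 P), Regular G A ω := ae_P0_iff.2 (hreg.mono fun _ h _ => h)
  set φ : Config d m → ℝ := fun ω => ∑ e, ψ ω e with hφ
  have hφi : Integrable φ (P0 P) := integrable_finsetSum _ fun e _ => hψ.integrable e
  have hφ0 : 0 ≤ᵐ[P0 P] φ := by
    filter_upwards [hψ.nonneg] with ω hω
    exact Finset.sum_nonneg fun e _ => hω e
  have hψG : Integrable (fun ω => ∑ e, ψ ω e * G ω e) (P0 P) := by
    refine integrable_finsetSum _ fun e _ => ?_
    refine (hψ.integrable e).mul_bdd (c := A) (hG.measurable e).aestronglyMeasurable ?_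
    filter_upwards [hbd] with ω hω
    exact hω e
  have key : ∀ ε : ℝ, 0 < ε → ε ≤ A →
      ∫ ω, ∑ e, ψ ω e * G ω e ∂(P0 P) ≤ ε * (∫ ω, φ ω ∂(P0 P) + A) := by
    intro ε hε hεA
    obtain ⟨η, hη, hsmall⟩ := exists_pos_setIntegral_le hP hφi hφ0 hε
    obtain ⟨n, hn, hbad⟩ := corrector_box_small hd hP hG hε hη
    set s : Set (Config d m) := {ω | ω ∈ Omega0 d m ∧ ∃ y ∈ infCluster ω, y ∈ box d n ∧
      ε * n < |increment G ω 0 y|} with hs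
    set B := toMeasurable (P0 P) s with hB
    have hBm : MeasurableSet B := measurableSet_toMeasurable _ _
    set g := approxPotential G ε A n with hg
    have hgm : Measurable g := measurable_approxPotential hG.measurable
    have hgb : ∀ ω, |g ω| ≤ A * n := fun ω => abs_approxPotential_le hA.le
    have hψg : Integrable (fun ω => ∑ e, ψ ω e * (g ω - g (shift e.1 ω))) (P0 P) := by
      refine integrable_finsetSum _ fun e _ => ?_
      refine (hψ.integrable e).mul_bdd (c := A * n + A * n)
        (hgm.sub (hgm.comp (measurable_shift e.1))).aestronglyMeasurable (ae_of_all _ fun ω => ?_)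
      exact (abs_sub _ _).trans (add_le_add (hgb _) (hgb _))
    have hpt : ∀ᵐ ω ∂(P0 P), ∑ e, ψ ω e * G ω e ≤
        ∑ e, ψ ω e * (g ω - g (shift e.1 ω)) + (ε * φ ω + A * B.indicator φ ω) := by
      filter_upwards [hψ.nonneg, hψ.support, hreg0, ae_P0_mem P] with ω h1 h2 h3 h4
      have hφω : 0 ≤ φ ω := Finset.sum_nonneg fun e _ => h1 e
      have hstep : ∀ r : ℝ, (∀ e : Dir d, (openGraph ω).Adj 0 e.1 →
          g (shift e.1 ω) ≤ g ω - G ω e + r) →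
          ∑ e, ψ ω e * G ω e ≤ ∑ e, ψ ω e * (g ω - g (shift e.1 ω)) + r * φ ω := by
        intro r hr
        rw [hφ, Finset.mul_sum, ← Finset.sum_add_distrib]
        refine Finset.sum_le_sum fun e _ => ?_
        by_cases he : (openGraph ω).Adj 0 e.1
        · have := mul_le_mul_of_nonneg_left (hr e he) (h1 e)
          linarith
        · rw [h2 e he]
          simp
      by_cases hωB : ω ∈ B
      · rw [indicator_of_mem hωB]
        have := hstep A fun e he => h3.approxPotential_shift_le h4 hε.le hA.le he
          fun l _ _ => pathCost_succ_le hεA _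
        have : 0 ≤ ε * φ ω := by positivity
        linarith
      · rw [indicator_of_notMem hωB]
        have hωs : ω ∉ s := fun h => hωB (subset_toMeasurable _ _ h)
        have hgood : ∀ l, OpenPath ω l → l.length ≤ n → -(ε * n) ≤ total G ω l := by
          intro l hl hln
          by_contra hcon
          push Not at hcon
          refine hωs ⟨h4, endpt l, ?_, ?_, ?_⟩
          · exact (shift_mem_Omega0 _ _).1 (shift_mem_Omega0_of_openPath h4 hl)
          · exact mem_box_of_l1_le ((l1_endpt_le l).trans (by exact_mod_cast hln))
          · have := h3.increment_eq_total (x := 0) h4 (l := l) (by simpa using hl)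
            rw [zero_add, shift_zero] at this
            rw [this]
            exact lt_of_lt_of_le (by linarith) (neg_le_abs _)
        have := hstep ε fun e he => h3.approxPotential_shift_le h4 hε.le hA.le he ?_
        · linarith
        · rintro l hl (hneg | rfl)
          · refine le_of_eq (pathCost_succ_of_lt ?_)
            by_contra hlen
            push Not at hlen
            -- a path longer than `n` has paid at least as much as `G` can return
            have hsplit : l.take n ++ l.drop n = l := List.take_append_drop n l
            have hop := (openPath_append ω (l.take n) (l.drop n)).1 (by rwa [hsplit])
            have ht := total_append G ω (l.take n) (l.drop n)
            rw [hsplit] at ht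
            have e1 := hgood _ hop.1 (by simp)
            have e2 := h3.abs_total_le
              ((shift_mem_Omega0 _ _).1 (shift_mem_Omega0_of_openPath h4 hop.1)) hop.2
            have e3 := (abs_le.1 e2).1
            rw [List.length_drop] at e3
            unfold pathCost at hneg
            rw [min_eq_right hlen] at hneg
            linarith
          · exact le_of_eq (pathCost_succ_of_lt hn)
    have hBi : Integrable (B.indicator φ) (P0 P) := hφi.indicator hBm
    calc ∫ ω, ∑ e, ψ ω e * G ω e ∂(P0 P)
        ≤ ∫ ω, (∑ e, ψ ω e * (g ω - g (shift e.1 ω)) +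
          (ε * φ ω + A * B.indicator φ ω)) ∂(P0 P) :=
          integral_mono_ae hψG (hψg.add ((hφi.const_mul ε).add (hBi.const_mul A))) hpt
      _ = ε * ∫ ω, φ ω ∂(P0 P) + A * ∫ ω in B, φ ω ∂(P0 P) := by
          have e1 : ∫ ω, (∑ e, ψ ω e * (g ω - g (shift e.1 ω)) +
              (ε * φ ω + A * B.indicator φ ω)) ∂(P0 P) = _ :=
            integral_add hψg ((hφi.const_mul ε).add (hBi.const_mul A))
          have e2 : ∫ ω, (ε * φ ω + A * B.indicator φ ω) ∂(P0 P) = _ :=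
            integral_add (hφi.const_mul ε) (hBi.const_mul A)
          rw [e1, hψ.stationary g hgm ⟨_, hgb⟩, e2,
            integral_const_mul, integral_const_mul, integral_indicator hBm, zero_add]
      _ ≤ ε * (∫ ω, φ ω ∂(P0 P) + A) := by
          have := mul_le_mul_of_nonneg_left (hsmall s hbad) hA.le
          linarith
  have hI : 0 ≤ ∫ ω, φ ω ∂(P0 P) := integral_nonneg_of_ae hφ0
  by_contra hcon
  push Not at hcon
  set J := ∫ ω, ∑ e, ψ ω e * G ω e ∂(P0 P) with hJ
  set I := ∫ ω, φ ω ∂(P0 P) + A with hIdef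
  have hIpos : 0 < I := by linarith
  have h1 := key (min A (J / (2 * I))) (lt_min hA (by positivity)) (min_le_left _ _)
  have h2 : min A (J / (2 * I)) * I ≤ J / (2 * I) * I :=
    mul_le_mul_of_nonneg_right (min_le_right _ _) hIpos.le
  have h3 : J / (2 * I) * I = J / 2 := by field_simp
  linarith

/-- The integral of a gradient of mean zero against a stationary flow vanishes. -/
theorem IsFlow.integral_gradient_eq_zero (hd : 0 < d) (hP : Admissible P)
    (hG : GradientClass P G) {ψ : Config d m → Dir d → ℝ} (hψ : IsFlow P ψ) :
    ∫ ω, ∑ e, ψ ω e * G ω e ∂(P0 P) = 0 := by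
  refine le_antisymm (hψ.integral_gradient_nonpos hd hP hG) ?_
  have h := hψ.integral_gradient_nonpos hd hP hG.neg
  simp only [mul_neg, Finset.sum_neg_distrib] at h
  rw [integral_neg] at h
  linarith

end Orthogonality

end Perc

namespace Perc

open Filter Topology

variable {d : ℕ} {m : Model}

/-! ### The simple random walk kernel and the Gibbs inequality -/

theorem openInd_of_adj {ω : Config d m} {e : Dir d} (h : (openGraph ω).Adj 0 e.1) :
    openInd ω e = 1 := if_pos h

theorem openInd_of_not_adj {ω : Config d m} {e : Dir d} (h : ¬ (openGraph ω).Adj 0 e.1) :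
    openInd ω e = 0 := if_neg h

theorem openInd_nonneg (ω : Config d m) (e : Dir d) : 0 ≤ openInd ω e := by
  unfold openInd
  split_ifs <;> norm_num

theorem openInd_le_one (ω : Config d m) (e : Dir d) : openInd ω e ≤ 1 := by
  unfold openInd
  split_ifs <;> norm_num

theorem measurable_openInd (e : Dir d) : Measurable fun ω : Config d m => openInd ω e := by
  classical
  exact Measurable.ite (measurableSet_adj 0 e.1) measurable_const measurable_const

theorem measurable_stepProb (e : Dir d) : Measurable fun ω : Config d m => stepProb ω e :=
  (measurable_openInd e).div (Finset.measurable_sum _ fun e' _ => measurable_openInd e')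

theorem one_le_sum_openInd {ω : Config d m} (h : ω ∈ Omega0 d m) : 1 ≤ ∑ e, openInd ω e := by
  obtain ⟨e, he⟩ := exists_adj_of_mem_Omega0 h
  rw [← openInd_of_adj he]
  exact Finset.single_le_sum (f := fun e => openInd ω e) (fun e _ => openInd_nonneg ω e)
    (Finset.mem_univ e)

theorem sum_openInd_le (ω : Config d m) : ∑ e, openInd ω e ≤ Fintype.card (Dir d) := by
  refine (Finset.sum_le_card_nsmul _ _ 1 fun e _ => openInd_le_one ω e).trans ?_
  simp

theorem stepProb_nonneg (ω : Config d m) (e : Dir d) : 0 ≤ stepProb ω e :=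
  div_nonneg (openInd_nonneg ω e) (Finset.sum_nonneg fun e _ => openInd_nonneg ω e)

theorem stepProb_le_one (ω : Config d m) (e : Dir d) : stepProb ω e ≤ 1 :=
  div_le_one_of_le₀ (Finset.single_le_sum (f := fun e => openInd ω e)
    (fun e _ => openInd_nonneg ω e) (Finset.mem_univ e))
    (Finset.sum_nonneg fun e _ => openInd_nonneg ω e)

theorem openInd_mul_stepProb (ω : Config d m) (e : Dir d) :
    openInd ω e * stepProb ω e = stepProb ω e := by
  by_cases h : (openGraph ω).Adj 0 e.1
  · rw [openInd_of_adj h, one_mul]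
  · rw [stepProb, openInd_of_not_adj h]
    simp

theorem stepProb_eq_zero_iff {ω : Config d m} (h0 : ω ∈ Omega0 d m) (e : Dir d) :
    stepProb ω e = 0 ↔ ¬ (openGraph ω).Adj 0 e.1 := by
  have h1 := one_le_sum_openInd h0
  constructor
  · intro h hadj
    rw [stepProb, openInd_of_adj hadj] at h
    have : (0 : ℝ) < 1 / ∑ e', openInd ω e' := by positivity
    exact this.ne' h
  · intro h
    rw [stepProb, openInd_of_not_adj h, zero_div]

theorem sum_stepProb {ω : Config d m} (h0 : ω ∈ Omega0 d m) : ∑ e, stepProb ω e = 1 := by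
  have h1 := one_le_sum_openInd h0
  unfold stepProb
  rw [← Finset.sum_div, div_self (by linarith)]

theorem inv_card_le_stepProb {ω : Config d m} (h0 : ω ∈ Omega0 d m) {e : Dir d}
    (he : (openGraph ω).Adj 0 e.1) : (Fintype.card (Dir d) : ℝ)⁻¹ ≤ stepProb ω e := by
  rw [stepProb, openInd_of_adj he, one_div]
  exact inv_anti₀ (by linarith [one_le_sum_openInd h0]) (sum_openInd_le ω)

theorem one_le_card_dir {ω : Config d m} (h0 : ω ∈ Omega0 d m) :
    (1 : ℝ) ≤ Fintype.card (Dir d) := (one_le_sum_openInd h0).trans (sum_openInd_le ω)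

/-- The integrand of the relative entropy is bounded, although the logarithm is not. -/
theorem abs_mul_log_div_stepProb_le {ω : Config d m} (h0 : ω ∈ Omega0 d m) (e : Dir d) {k : ℝ}
    (hk : k ∈ Icc (0 : ℝ) 1) (hz : k = 0 ↔ stepProb ω e = 0) :
    |k * Real.log (k / stepProb ω e)| ≤ 1 + Real.log (Fintype.card (Dir d)) := by
  have hcard := one_le_card_dir h0
  have hlog := Real.log_nonneg hcard
  by_cases hk0 : k = 0
  · rw [hk0, zero_mul, abs_zero]
    linarith
  have hs0 : stepProb ω e ≠ 0 := fun h => hk0 (hz.2 h)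
  have hadj : (openGraph ω).Adj 0 e.1 := by
    by_contra h
    exact hs0 ((stepProb_eq_zero_iff h0 e).2 h)
  have hkpos : 0 < k := lt_of_le_of_ne hk.1 (Ne.symm hk0)
  have hspos : 0 < stepProb ω e := lt_of_le_of_ne (stepProb_nonneg ω e) (Ne.symm hs0)
  rw [Real.log_div hk0 hs0, mul_sub]
  have h1 : |k * Real.log k| ≤ 1 := by
    rw [mul_comm]
    exact (Real.abs_log_mul_self_lt k hkpos hk.2).le
  have h2 : |Real.log (stepProb ω e)| ≤ Real.log (Fintype.card (Dir d)) := by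
    rw [abs_of_nonpos (Real.log_nonpos hspos.le (stepProb_le_one ω e))]
    have := Real.log_le_log (by positivity) (inv_card_le_stepProb h0 hadj)
    rw [Real.log_inv] at this
    linarith
  have h3 : |k * Real.log (stepProb ω e)| ≤ Real.log (Fintype.card (Dir d)) := by
    rw [abs_mul, abs_of_pos hkpos]
    calc k * |Real.log (stepProb ω e)| ≤ 1 * |Real.log (stepProb ω e)| :=
          mul_le_mul_of_nonneg_right hk.2 (abs_nonneg _)
      _ ≤ _ := by rw [one_mul]; exact h2
  exact (abs_sub _ _).trans (add_le_add h1 h3)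

/-- The Gibbs variational inequality on a finite set. -/
theorem sum_mul_sub_log_le {ι : Type*} (s : Finset ι) (k p F : ι → ℝ)
    (hk : ∀ i ∈ s, 0 ≤ k i) (hp : ∀ i ∈ s, 0 ≤ p i) (hkp : ∀ i ∈ s, p i = 0 → k i = 0)
    (hk1 : ∑ i ∈ s, k i = 1) :
    ∑ i ∈ s, k i * (F i - Real.log (k i / p i)) ≤ Real.log (∑ i ∈ s, p i * Real.exp (F i)) := by
  set Z := ∑ i ∈ s, p i * Real.exp (F i) with hZ
  have hZ0 : 0 < Z := by
    obtain ⟨i, hi, hki⟩ : ∃ i ∈ s, k i ≠ 0 := by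
      by_contra! h
      rw [Finset.sum_eq_zero h] at hk1
      exact zero_ne_one hk1
    refine Finset.sum_pos' (fun i hi => mul_nonneg (hp i hi) (Real.exp_pos _).le) ⟨i, hi, ?_⟩
    exact mul_pos (lt_of_le_of_ne (hp i hi) fun h => hki (hkp i hi h.symm)) (Real.exp_pos _)
  have hterm : ∀ i ∈ s, k i * (F i - Real.log (k i / p i)) ≤
      k i * Real.log Z + (p i * Real.exp (F i) / Z - k i) := by
    intro i hi
    by_cases hki : k i = 0
    · rw [hki]
      have : 0 ≤ p i * Real.exp (F i) / Z :=
        div_nonneg (mul_nonneg (hp i hi) (Real.exp_pos _).le) hZ0.le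
      simpa using this
    · have hkpos : 0 < k i := lt_of_le_of_ne (hk i hi) (Ne.symm hki)
      have hppos : 0 < p i := lt_of_le_of_ne (hp i hi) fun h => hki (hkp i hi h.symm)
      have h1 := Real.log_le_sub_one_of_pos (x := p i * Real.exp (F i) / (k i * Z)) (by positivity)
      rw [Real.log_div (by positivity) (by positivity), Real.log_mul hppos.ne' (by positivity),
        Real.log_mul hki hZ0.ne', Real.log_exp] at h1
      rw [Real.log_div hki hppos.ne']
      have h2 := mul_le_mul_of_nonneg_left h1 hkpos.le
      have h3 : k i * (p i * Real.exp (F i) / (k i * Z) - 1) = p i * Real.exp (F i) / Z - k i := by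
        field_simp
      rw [h3] at h2
      linarith
  refine (Finset.sum_le_sum hterm).trans (le_of_eq ?_)
  rw [Finset.sum_add_distrib, ← Finset.sum_mul, hk1, Finset.sum_sub_distrib, ← Finset.sum_div,
    ← hZ, hk1, div_self hZ0.ne']
  ring

/-! ### The saddle expression is at most the gradient infimum -/

section Saddle

variable {P : Measure (Config d m)} {f : Config d m × Dir d → ℝ}

/-- The reward minus the relative entropy production of one step of the kernel `k`. -/
noncomputable def stepGain (f : Config d m × Dir d → ℝ) (k : Config d m → Dir d → ℝ)
    (ω : Config d m) : ℝ :=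
  ∑ e, k ω e * (f (ω, e) - Real.log (k ω e / stepProb ω e))

theorem measurable_stepGain (hf : ∀ e, Measurable fun ω => f (ω, e))
    {k : Config d m → Dir d → ℝ} (hk : ∀ e, Measurable fun ω => k ω e) :
    Measurable (stepGain f k) :=
  Finset.measurable_sum _ fun e _ => (hk e).mul
    ((hf e).sub (((hk e).div (measurable_stepProb e)).log))

theorem abs_stepGain_le {C : ℝ} (hC : ∀ q, |f q| ≤ C) {k : Config d m → Dir d → ℝ}
    (hk : ∀ ω e, k ω e ∈ Icc (0 : ℝ) 1)
    (hz : ∀ ω ∈ Omega0 d m, ∀ e, k ω e = 0 ↔ stepProb ω e = 0) {ω : Config d m}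
    (h0 : ω ∈ Omega0 d m) :
    |stepGain f k ω| ≤ Fintype.card (Dir d) * (C + (1 + Real.log (Fintype.card (Dir d)))) := by
  refine (Finset.abs_sum_le_sum_abs _ _).trans
    ((Finset.sum_le_card_nsmul _ _ (C + (1 + Real.log (Fintype.card (Dir d))))
      fun e _ => ?_).trans (le_of_eq (by rw [nsmul_eq_mul, Finset.card_univ])))
  rw [mul_sub]
  refine (abs_sub _ _).trans (add_le_add ?_ (abs_mul_log_div_stepProb_le h0 e (hk ω e) (hz ω h0 e)))
  rw [abs_mul, abs_of_nonneg (hk ω e).1]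
  calc k ω e * |f (ω, e)| ≤ 1 * |f (ω, e)| :=
        mul_le_mul_of_nonneg_right (hk ω e).2 (abs_nonneg _)
    _ ≤ C := by rw [one_mul]; exact hC _

theorem IsDensity.integrable_mul_bdd {φ : Config d m → ℝ} (hφ : IsDensity P φ)
    {g : Config d m → ℝ} (hg : Measurable g) {C : ℝ} (hC : ∀ ω ∈ Omega0 d m, |g ω| ≤ C) :
    Integrable (fun ω => φ ω * g ω) (P0 P) := by
  refine hφ.integrable.mul_bdd (c := C) hg.aestronglyMeasurable ?_
  filter_upwards [ae_P0_mem P] with ω hω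
  exact hC ω hω

theorem IsKernel.le_card {k : Config d m → Dir d → ℝ} (hk : IsKernel P k)
    {g : Config d m → ℝ} {C : ℝ} (hC : ∀ ω, |g ω| ≤ C) (ω : Config d m) :
    |∑ e, k ω e * (g ω - g (shift e.1 ω))| ≤ Fintype.card (Dir d) * (C + C) := by
  refine (Finset.abs_sum_le_sum_abs _ _).trans
    ((Finset.sum_le_card_nsmul _ _ (C + C) fun e _ => ?_).trans
      (le_of_eq (by rw [nsmul_eq_mul, Finset.card_univ])))
  rw [abs_mul, abs_of_nonneg (hk.mem_Icc ω e).1]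
  calc k ω e * |g ω - g (shift e.1 ω)| ≤ 1 * |g ω - g (shift e.1 ω)| :=
        mul_le_mul_of_nonneg_right (hk.mem_Icc ω e).2 (abs_nonneg _)
    _ ≤ C + C := by rw [one_mul]; exact (abs_sub _ _).trans (add_le_add (hC _) (hC _))

/-- The saddle functional is affine in the gradient part. -/
theorem integral_saddle_eq (hf : ∀ e, Measurable fun ω => f (ω, e)) {C : ℝ}
    (hC : ∀ q, |f q| ≤ C) {φ : Config d m → ℝ} (hφ : IsDensity P φ)
    {k : Config d m → Dir d → ℝ} (hk : IsKernel P k) {g : Config d m → ℝ} (hg : Measurable g)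
    (hgb : ∃ C : ℝ, ∀ ω, |g ω| ≤ C) :
    ∫ ω, φ ω * ∑ e, k ω e * (f (ω, e) - Real.log (k ω e / stepProb ω e)
        + (g ω - g (shift e.1 ω))) ∂(P0 P) =
      ∫ ω, φ ω * stepGain f k ω ∂(P0 P) +
        ∫ ω, ∑ e, φ ω * k ω e * (g ω - g (shift e.1 ω)) ∂(P0 P) := by
  obtain ⟨C', hC'⟩ := hgb
  have h1 : Integrable (fun ω => φ ω * stepGain f k ω) (P0 P) :=
    hφ.integrable_mul_bdd (measurable_stepGain hf hk.measurable)
      fun ω h0 => abs_stepGain_le hC hk.mem_Icc hk.zero_iff h0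
  have h2 : Integrable (fun ω => φ ω * ∑ e, k ω e * (g ω - g (shift e.1 ω))) (P0 P) :=
    hφ.integrable_mul_bdd (Finset.measurable_sum _ fun e _ => (hk.measurable e).mul
      (hg.sub (hg.comp (measurable_shift e.1)))) fun ω _ => hk.le_card hC' ω
  have h3 : ∀ ω, φ ω * ∑ e, k ω e * (g ω - g (shift e.1 ω)) =
      ∑ e, φ ω * k ω e * (g ω - g (shift e.1 ω)) := fun ω => by
    rw [Finset.mul_sum]
    exact Finset.sum_congr rfl fun e _ => by ring
  simp only [← h3]
  rw [← integral_add h1 h2]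
  refine integral_congr_ae (ae_of_all _ fun ω => ?_)
  simp only [stepGain]
  rw [← mul_add, ← Finset.sum_add_distrib]
  congr 1
  exact Finset.sum_congr rfl fun e _ => by ring

/-- A density that is invariant for a kernel on the open edges defines a flow. -/
theorem isFlow_of_kernel {φ : Config d m → ℝ} (hφ : IsDensity P φ) {k : Config d m → Dir d → ℝ}
    (hk : IsKernel P k) (hst : ∀ g : Config d m → ℝ, Measurable g → (∃ C : ℝ, ∀ ω, |g ω| ≤ C) →
      ∫ ω, ∑ e, φ ω * k ω e * (g ω - g (shift e.1 ω)) ∂(P0 P) = 0) :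
    IsFlow P fun ω e => φ ω * k ω e where
  integrable e := hφ.integrable_mul_bdd (hk.measurable e) (C := 1) fun ω _ => by
    rw [abs_of_nonneg (hk.mem_Icc ω e).1]
    exact (hk.mem_Icc ω e).2
  nonneg := ae_of_all _ fun ω e => mul_nonneg (hφ.nonneg ω) (hk.mem_Icc ω e).1
  support := by
    filter_upwards [ae_P0_mem P] with ω h0 e he
    rw [(hk.zero_iff ω h0 e).2 ((stepProb_eq_zero_iff h0 e).2 he), mul_zero]
  stationary := hst

variable [IsProbabilityMeasure P]

/-- Adding a gradient to the reward does not change the mean along a stationary flow, so the Gibbs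
inequality bounds the gain. -/
theorem IsFlow.integral_stepGain_le (hd : 0 < d) (hP : Admissible P)
    (hf : ∀ e, Measurable fun ω => f (ω, e)) {C : ℝ} (hC : ∀ q, |f q| ≤ C)
    {φ : Config d m → ℝ} (hφ : IsDensity P φ) {k : Config d m → Dir d → ℝ} (hk : IsKernel P k)
    (hflow : IsFlow P fun ω e => φ ω * k ω e) {G : Config d m → Dir d → ℝ}
    (hG : GradientClass P G) :
    ((∫ ω, φ ω * stepGain f k ω ∂(P0 P) : ℝ) : EReal) ≤ Lam P f G := by
  have := hP.isProbabilityMeasure_P0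
  have hess : ∀ᵐ ω ∂(P0 P), ((Real.log (∑ e, openInd ω e * stepProb ω e *
      Real.exp (f (ω, e) + G ω e)) : ℝ) : EReal) ≤ Lam P f G := ae_le_essSup
  induction hL : Lam P f G using EReal.rec with
  | bot =>
    obtain ⟨ω, hω⟩ := hess.exists
    rw [hL] at hω
    exact absurd hω (not_le.2 (EReal.bot_lt_coe _))
  | top => exact le_top
  | coe r =>
    rw [EReal.coe_le_coe_iff]
    have h1 : Integrable (fun ω => φ ω * stepGain f k ω) (P0 P) :=
      hφ.integrable_mul_bdd (measurable_stepGain hf hk.measurable)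
        fun ω h0 => abs_stepGain_le hC hk.mem_Icc hk.zero_iff h0
    have h2 : Integrable (fun ω => ∑ e, φ ω * k ω e * G ω e) (P0 P) := by
      obtain ⟨A, -, hA⟩ := hG.exists_bound
      refine integrable_finsetSum _ fun e _ => ?_
      refine (hflow.integrable e).mul_bdd (c := A) (hG.measurable e).aestronglyMeasurable ?_
      filter_upwards [hA] with ω hω
      exact hω e
    have h3 := hflow.integral_gradient_eq_zero hd hP hG
    have h4 : ∫ ω, φ ω * stepGain f k ω ∂(P0 P) =
        ∫ ω, (φ ω * stepGain f k ω + ∑ e, φ ω * k ω e * G ω e) ∂(P0 P) := by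
      rw [integral_add h1 h2, h3, add_zero]
    have h5 : r = ∫ ω, φ ω * r ∂(P0 P) := by
      rw [integral_mul_const, hφ.integral_eq_one, one_mul]
    rw [h4, h5]
    refine integral_mono_ae (h1.add h2) (hφ.integrable.mul_const r) ?_
    filter_upwards [hess, hk.sum_eq_one, ae_P0_mem P] with ω hω hsum h0
    rw [hL, EReal.coe_le_coe_iff] at hω
    have h6 := sum_mul_sub_log_le Finset.univ (k ω) (stepProb ω) (fun e => f (ω, e) + G ω e)
      (fun e _ => (hk.mem_Icc ω e).1) (fun e _ => stepProb_nonneg ω e)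
      (fun e _ h => (hk.zero_iff ω h0 e).2 h) hsum
    simp only [openInd_mul_stepProb] at hω
    have h7 : φ ω * stepGain f k ω + ∑ e, φ ω * k ω e * G ω e =
        φ ω * ∑ e, k ω e * (f (ω, e) + G ω e - Real.log (k ω e / stepProb ω e)) := by
      rw [stepGain, Finset.mul_sum, Finset.mul_sum, ← Finset.sum_add_distrib]
      exact Finset.sum_congr rfl fun e _ => by ring
    change φ ω * stepGain f k ω + ∑ e, φ ω * k ω e * G ω e ≤ φ ω * r
    rw [h7]
    exact mul_le_mul_of_nonneg_left (h6.trans hω) (hφ.nonneg ω)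

/-- Only pairs of density and kernel that are stationary have a finite infimum over `g`; for those
the Gibbs inequality applies. -/
theorem HBarSaddle_le_infLam (hd : 0 < d) (hP : Admissible P)
    (hf : ∀ e, Measurable fun ω => f (ω, e)) {C : ℝ} (hC : ∀ q, |f q| ≤ C) :
    HBarSaddle P f ≤ infLam P f := by
  refine iSup₂_le fun φ hφ => iSup₂_le fun k hk => le_iInf₂ fun G hG => ?_
  by_cases hst : ∀ g : Config d m → ℝ, Measurable g → (∃ C : ℝ, ∀ ω, |g ω| ≤ C) →
      ∫ ω, ∑ e, φ ω * k ω e * (g ω - g (shift e.1 ω)) ∂(P0 P) = 0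
  · refine (iInf₂_le (fun _ => 0) ⟨measurable_const, 0, by simp⟩).trans ?_
    rw [integral_saddle_eq hf hC hφ hk measurable_const ⟨0, by simp⟩,
      hst (fun _ => 0) measurable_const ⟨0, by simp⟩, add_zero]
    exact (isFlow_of_kernel hφ hk hst).integral_stepGain_le hd hP hf hC hφ hk hG
  · -- a violated stationarity condition drives the infimum to `-∞` by scaling `g`
    push Not at hst
    obtain ⟨g, hg, ⟨C', hC'⟩, hne⟩ := hst
    set I := ∫ ω, ∑ e, φ ω * k ω e * (g ω - g (shift e.1 ω)) ∂(P0 P) with hI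
    set J := ∫ ω, φ ω * stepGain f k ω ∂(P0 P) with hJ
    have hbot : (⨅ (g : Config d m → ℝ) (_ : Measurable g ∧ ∃ C : ℝ, ∀ ω, |g ω| ≤ C),
        ((∫ ω, φ ω * ∑ e, k ω e * (f (ω, e) - Real.log (k ω e / stepProb ω e)
          + (g ω - g (shift e.1 ω))) ∂(P0 P) : ℝ) : EReal)) = ⊥ := by
      rw [EReal.eq_bot_iff_forall_lt]
      intro y
      set t : ℝ := (y - 1 - J) / I with ht
      have hgt : Measurable fun ω => t * g ω := hg.const_mul t
      have hgtb : ∃ C : ℝ, ∀ ω, |t * g ω| ≤ C := ⟨|t| * C', fun ω => by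
        rw [abs_mul]
        exact mul_le_mul_of_nonneg_left (hC' ω) (abs_nonneg _)⟩
      refine lt_of_le_of_lt (iInf₂_le (fun ω => t * g ω) ⟨hgt, hgtb⟩) ?_
      rw [integral_saddle_eq hf hC hφ hk hgt hgtb, EReal.coe_lt_coe_iff]
      have h1 : ∫ ω, ∑ e, φ ω * k ω e * (t * g ω - t * g (shift e.1 ω)) ∂(P0 P) = t * I := by
        rw [hI, ← integral_const_mul]
        refine integral_congr_ae (ae_of_all _ fun ω => ?_)
        simp only [Finset.mul_sum]
        exact Finset.sum_congr rfl fun e _ => by ring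
      rw [h1, ht, div_mul_cancel₀ _ hne]
      linarith
    rw [hbot]
    exact bot_le

end Saddle

end Perc

namespace Perc

open Filter Topology

variable {d : ℕ} {m : Model}

/-! ### Pair measures and their disintegration -/

section PairMeasure

theorem slice_apply (μ : Measure (Config d m × Dir d)) (e : Dir d) {s : Set (Config d m)}
    (hs : MeasurableSet s) : slice μ e s = μ (s ×ˢ {e}) := by
  rw [slice, Measure.map_apply measurable_fst hs,
    Measure.restrict_apply (measurable_fst hs)]
  congr 1
  ext ⟨ω, e'⟩
  simp

/-- A measure on the product is the sum of its slices. -/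
theorem eq_sum_map_slice (μ : Measure (Config d m × Dir d)) :
    μ = ∑ e, (slice μ e).map fun ω => (ω, e) := by
  ext s hs
  rw [Measure.finsetSum_apply]
  have h1 : ∀ e, ((slice μ e).map fun ω => (ω, e)) s = μ (s ∩ univ ×ˢ {e}) := by
    intro e
    have hm : Measurable fun ω : Config d m => (ω, e) := measurable_prodMk_right
    rw [Measure.map_apply hm hs, slice_apply _ _ (hm hs)]
    congr 1
    ext ⟨ω, e'⟩
    simp only [mem_prod, mem_preimage, mem_singleton_iff, mem_inter_iff, mem_univ, true_and]
    constructor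
    · rintro ⟨h1, rfl⟩
      exact ⟨h1, rfl⟩
    · rintro ⟨h1, rfl⟩
      exact ⟨h1, rfl⟩
  simp only [h1]
  rw [← measure_biUnion_finset]
  · congr 1
    ext ⟨ω, e'⟩
    simp
  · intro e _ e' _ hne
    rw [Function.onFun, Set.disjoint_left]
    rintro ⟨ω, e''⟩ ⟨-, -, h1⟩ ⟨-, -, h2⟩
    exact hne (h1.symm.trans h2)
  · exact fun e _ => hs.inter (MeasurableSet.univ.prod (measurableSet_singleton e))

theorem measurable_pair {F : Config d m → Dir d → ℝ} (hF : ∀ e, Measurable fun ω => F ω e) :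
    Measurable fun q : Config d m × Dir d => F q.1 q.2 :=
  measurable_from_prod_countable_left hF

theorem integrable_pair {μ : Measure (Config d m × Dir d)} {F : Config d m → Dir d → ℝ}
    (hF : ∀ e, Measurable fun ω => F ω e) (hi : ∀ e, Integrable (fun ω => F ω e) (slice μ e)) :
    Integrable (fun q : Config d m × Dir d => F q.1 q.2) μ := by
  rw [eq_sum_map_slice μ, integrable_finsetSum_measure]
  intro e _
  rw [integrable_map_measure (measurable_pair hF).aestronglyMeasurable
    measurable_prodMk_right.aemeasurable]
  exact hi e

theorem integral_pair {μ : Measure (Config d m × Dir d)} {F : Config d m → Dir d → ℝ}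
    (hF : ∀ e, Measurable fun ω => F ω e) (hi : ∀ e, Integrable (fun ω => F ω e) (slice μ e)) :
    ∫ q, F q.1 q.2 ∂μ = ∑ e, ∫ ω, F ω e ∂(slice μ e) := by
  conv_lhs => rw [eq_sum_map_slice μ]
  rw [integral_finsetSum_measure]
  · refine Finset.sum_congr rfl fun e _ => ?_
    rw [integral_map measurable_prodMk_right.aemeasurable
      (measurable_pair hF).aestronglyMeasurable]
  · intro e _
    rw [integrable_map_measure (measurable_pair hF).aestronglyMeasurable
      measurable_prodMk_right.aemeasurable]
    exact hi e

theorem marg1_eq_sum_slice (μ : Measure (Config d m × Dir d)) :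
    marg1 μ = ∑ e, slice μ e := by
  conv_lhs => rw [eq_sum_map_slice μ, marg1]
  ext s hs
  rw [Measure.map_apply measurable_fst hs, Measure.finsetSum_apply, Measure.finsetSum_apply]
  refine Finset.sum_congr rfl fun e _ => ?_
  rw [Measure.map_apply measurable_prodMk_right (measurable_fst hs)]
  rfl

theorem slice_absolutelyContinuous (μ : Measure (Config d m × Dir d)) (e : Dir d) :
    slice μ e ≪ marg1 μ := by
  rw [marg1_eq_sum_slice]
  intro s hs
  rw [Measure.finsetSum_apply, Finset.sum_eq_zero_iff] at hs
  exact hs e (Finset.mem_univ e)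

theorem measurable_condStep (μ : Measure (Config d m × Dir d)) (e : Dir d) :
    Measurable fun ω => condStep μ ω e := Measure.measurable_rnDeriv _ _

theorem isProbabilityMeasure_marg1 (μ : Measure (Config d m × Dir d)) [IsProbabilityMeasure μ] :
    IsProbabilityMeasure (marg1 μ) := Measure.isProbabilityMeasure_map measurable_fst.aemeasurable

theorem isFiniteMeasure_slice (μ : Measure (Config d m × Dir d)) [IsProbabilityMeasure μ]
    (e : Dir d) : IsFiniteMeasure (slice μ e) :=
  inferInstanceAs (IsFiniteMeasure ((μ.restrict _).map _))

theorem ae_sum_condStep (μ : Measure (Config d m × Dir d)) [IsProbabilityMeasure μ] :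
    ∀ᵐ ω ∂(marg1 μ), ∑ e, condStep μ ω e = 1 := by
  have := isProbabilityMeasure_marg1 μ
  have := isFiniteMeasure_slice μ
  refine ae_eq_of_forall_setLIntegral_eq_of_sigmaFinite
    (Finset.measurable_sum _ fun e _ => measurable_condStep μ e) measurable_const
    fun s hs _ => ?_
  rw [lintegral_finsetSum _ fun e _ => measurable_condStep μ e, setLIntegral_one]
  conv_rhs => rw [marg1_eq_sum_slice]
  rw [Measure.finsetSum_apply]
  exact Finset.sum_congr rfl fun e _ =>
    Measure.setLIntegral_rnDeriv (slice_absolutelyContinuous μ e) s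

end PairMeasure

/-! ### Pair measures give densities and kernels -/

section PairToKernel

variable {P : Measure (Config d m)} {μ : Measure (Config d m × Dir d)}

/-- The density of the first marginal. -/
noncomputable def margDensity (P : Measure (Config d m)) (μ : Measure (Config d m × Dir d))
    (ω : Config d m) : ℝ := ((marg1 μ).rnDeriv (P0 P) ω).toReal

/-- Configurations at which the conditional step distribution is a probability vector with the
support of the simple random walk. -/
def goodStep (μ : Measure (Config d m × Dir d)) : Set (Config d m) :=
  {ω | ∑ e, condStep μ ω e = 1 ∧ ∀ e : Dir d, 0 < condStep μ ω e ↔ (openGraph ω).Adj 0 e.1}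

/-- The conditional step distribution, replaced by the simple random walk where it degenerates. -/
noncomputable def stepKernel (μ : Measure (Config d m × Dir d)) (ω : Config d m) (e : Dir d) : ℝ :=
  open Classical in if ω ∈ goodStep μ then (condStep μ ω e).toReal else stepProb ω e

theorem measurableSet_goodStep (μ : Measure (Config d m × Dir d)) :
    MeasurableSet (goodStep μ) := by
  have : goodStep μ = {ω | ∑ e, condStep μ ω e = 1} ∩
      ⋂ e : Dir d, {ω | 0 < condStep μ ω e ↔ (openGraph ω).Adj 0 e.1} := by
    ext ω
    simp [goodStep]
  rw [this]
  refine MeasurableSet.inter ?_ (MeasurableSet.iInter fun e => ?_)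
  · exact (Finset.measurable_sum _ fun e _ => measurable_condStep μ e) (measurableSet_singleton 1)
  · exact MeasurableSet.iff (measurableSet_lt measurable_const (measurable_condStep μ e))
      (measurableSet_adj 0 e.1)

theorem condStep_le_one {ω : Config d m} (h : ω ∈ goodStep μ) (e : Dir d) :
    condStep μ ω e ≤ 1 := by
  rw [← h.1]
  exact Finset.single_le_sum (f := fun e => condStep μ ω e) (fun _ _ => zero_le)
    (Finset.mem_univ e)

/-- The conditional step distribution is only determined almost everywhere, whereas a kernel must
have the support of the simple random walk at every configuration of `Ω_0`. -/
theorem isKernel_stepKernel (P : Measure (Config d m)) (μ : Measure (Config d m × Dir d)) :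
    IsKernel P (stepKernel μ) where
  measurable e := by
    classical
    exact Measurable.ite (measurableSet_goodStep μ) (measurable_condStep μ e).ennreal_toReal
      (measurable_stepProb e)
  mem_Icc ω e := by
    unfold stepKernel
    split_ifs with h
    · exact ⟨ENNReal.toReal_nonneg, by
        simpa using ENNReal.toReal_mono ENNReal.one_ne_top (condStep_le_one h e)⟩
    · exact ⟨stepProb_nonneg ω e, stepProb_le_one ω e⟩
  sum_eq_one := by
    filter_upwards [ae_P0_mem P] with ω h0
    by_cases h : ω ∈ goodStep μ
    · simp only [stepKernel, h, if_true]
      rw [← ENNReal.toReal_sum, h.1, ENNReal.toReal_one]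
      exact fun e _ => ne_top_of_le_ne_top ENNReal.one_ne_top (condStep_le_one h e)
    · simp only [stepKernel, h, if_false]
      exact sum_stepProb h0
  zero_iff ω h0 e := by
    unfold stepKernel
    split_ifs with h
    · rw [stepProb_eq_zero_iff h0, ← h.2 e, ENNReal.toReal_eq_zero_iff, not_lt,
        nonpos_iff_eq_zero, or_iff_left]
      exact ne_top_of_le_ne_top ENNReal.one_ne_top (condStep_le_one h e)
    · rfl

theorem MStar.ae_goodStep (hμ : MStar P μ) : ∀ᵐ ω ∂(marg1 μ), ω ∈ goodStep μ := by
  have := hμ.prob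
  filter_upwards [ae_sum_condStep μ, hμ.ac.ae_le hμ.pos_iff] with ω h1 h2
  exact ⟨h1, h2⟩

variable [IsProbabilityMeasure P]

theorem MStar.isDensity (hP : Admissible P) (hμ : MStar P μ) :
    IsDensity P (margDensity P μ) := by
  have := hμ.prob
  have := isProbabilityMeasure_marg1 μ
  have := hP.isProbabilityMeasure_P0
  exact
  { measurable := (Measure.measurable_rnDeriv _ _).ennreal_toReal
    nonneg := fun _ => ENNReal.toReal_nonneg
    integrable := Measure.integrable_toReal_rnDeriv
    integral_eq_one := by
      unfold margDensity
      rw [Measure.integral_toReal_rnDeriv hμ.ac]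
      simp }

/-- Integrals against a pair measure in terms of its density and kernel. -/
theorem MStar.integral_eq (hP : Admissible P) (hμ : MStar P μ) {F : Config d m → Dir d → ℝ}
    (hF : ∀ e, Measurable fun ω => F ω e) {C : ℝ}
    (hC : ∀ ω ∈ Omega0 d m, ∀ e, |stepKernel μ ω e * F ω e| ≤ C) :
    Integrable (fun q : Config d m × Dir d => F q.1 q.2) μ ∧
      ∫ q, F q.1 q.2 ∂μ = ∫ ω, margDensity P μ ω * ∑ e, stepKernel μ ω e * F ω e ∂(P0 P) := by
  have := hμ.prob
  have := isProbabilityMeasure_marg1 μ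
  have := isFiniteMeasure_slice μ
  have := hP.isProbabilityMeasure_P0
  have hφ := hμ.isDensity hP
  have hk := isKernel_stepKernel P μ
  have hkF : ∀ e, Integrable (fun ω => margDensity P μ ω * (stepKernel μ ω e * F ω e)) (P0 P) :=
    fun e => hφ.integrable_mul_bdd ((hk.measurable e).mul (hF e)) fun ω h0 => hC ω h0 e
  have hcond : ∀ e, (fun ω => (condStep μ ω e).toReal • F ω e) =ᵐ[marg1 μ]
      fun ω => stepKernel μ ω e * F ω e := by
    intro e
    filter_upwards [hμ.ae_goodStep] with ω hω
    rw [stepKernel, if_pos hω, smul_eq_mul]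
  have hi : ∀ e, Integrable (fun ω => F ω e) (slice μ e) := by
    intro e
    rw [← integrable_rnDeriv_smul_iff (slice_absolutelyContinuous μ e)]
    refine Integrable.congr ?_ (hcond e).symm
    rw [← integrable_rnDeriv_smul_iff hμ.ac]
    exact hkF e
  refine ⟨integrable_pair hF hi, ?_⟩
  rw [integral_pair hF hi]
  simp only [Finset.mul_sum]
  rw [integral_finsetSum _ fun e _ => hkF e]
  refine Finset.sum_congr rfl fun e _ => ?_
  rw [← integral_rnDeriv_smul (slice_absolutelyContinuous μ e)]
  refine (integral_congr_ae (hcond e)).trans ?_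
  rw [← integral_rnDeriv_smul hμ.ac]
  rfl

/-- The reward minus the relative entropy of a pair measure is the mean gain of its kernel. -/
theorem MStar.integral_sub_entropy {f : Config d m × Dir d → ℝ} (hP : Admissible P)
    (hf : ∀ e, Measurable fun ω => f (ω, e)) {C : ℝ} (hC : ∀ q, |f q| ≤ C) (hμ : MStar P μ) :
    ∫ q, f q ∂μ - ∫ q, Real.log ((condStep μ q.1 q.2).toReal / stepProb q.1 q.2) ∂μ =
      ∫ ω, margDensity P μ ω * stepGain f (stepKernel μ) ω ∂(P0 P) := by
  have hk := isKernel_stepKernel P μ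
  have habs : ∀ (a : ℝ) ω e, |stepKernel μ ω e * a| ≤ |a| := by
    intro a ω e
    rw [abs_mul, abs_of_nonneg (hk.mem_Icc ω e).1]
    exact mul_le_of_le_one_left (abs_nonneg _) (hk.mem_Icc ω e).2
  have hlogm : ∀ e, Measurable fun ω => Real.log (stepKernel μ ω e / stepProb ω e) := fun e =>
    ((hk.measurable e).div (measurable_stepProb e)).log
  have h1 := hμ.integral_eq hP (F := fun ω e => f (ω, e)) hf (C := C)
    fun ω _ e => (habs _ ω e).trans (hC _)
  have h2 := hμ.integral_eq hP (F := fun ω e => Real.log (stepKernel μ ω e / stepProb ω e)) hlogm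
    fun ω h0 e => abs_mul_log_div_stepProb_le h0 e (hk.mem_Icc ω e) (hk.zero_iff ω h0 e)
  have h3 : ∫ q, Real.log ((condStep μ q.1 q.2).toReal / stepProb q.1 q.2) ∂μ =
      ∫ q, Real.log (stepKernel μ q.1 q.2 / stepProb q.1 q.2) ∂μ := by
    refine integral_congr_ae ?_
    filter_upwards [ae_of_ae_map measurable_fst.aemeasurable hμ.ae_goodStep] with q hq
    rw [stepKernel, if_pos hq]
  have h4 : ∫ q, f q ∂μ = ∫ q, f (q.1, q.2) ∂μ := rfl
  have hgain := hμ.integral_eq hP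
    (F := fun ω e => f (ω, e) - Real.log (stepKernel μ ω e / stepProb ω e))
    (fun e => (hf e).sub (hlogm e)) (C := C + (1 + Real.log (Fintype.card (Dir d))))
    fun ω h0 e => by
      rw [mul_sub]
      exact (abs_sub _ _).trans (add_le_add ((habs _ ω e).trans (hC _))
        (abs_mul_log_div_stepProb_le h0 e (hk.mem_Icc ω e) (hk.zero_iff ω h0 e)))
  rw [h3, h4, ← integral_sub h1.1 h2.1, hgain.2]
  rfl

/-- A pair measure with equal marginals gives a density and a kernel for which the term with `g`
vanishes. -/
theorem HBar_le_HBarSaddle {f : Config d m × Dir d → ℝ} (hP : Admissible P)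
    (hf : ∀ e, Measurable fun ω => f (ω, e)) {C : ℝ} (hC : ∀ q, |f q| ≤ C) :
    HBar P f ≤ HBarSaddle P f := by
  refine iSup₂_le fun μ hμ => ?_
  have := hμ.prob
  have hφ := hμ.isDensity hP
  have hk := isKernel_stepKernel P μ
  refine le_iSup₂_of_le (margDensity P μ) hφ (le_iSup₂_of_le (stepKernel μ) hk ?_)
  refine le_iInf₂ fun g hg => ?_
  rw [entropyI, if_pos hμ, ← EReal.coe_sub, EReal.coe_le_coe_iff,
    integral_saddle_eq hf hC hφ hk hg.1 hg.2, hμ.integral_sub_entropy hP hf hC]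
  refine le_add_of_nonneg_right (le_of_eq ?_)
  have hgm : ∀ e : Dir d, Measurable fun ω : Config d m => g ω - g (shift e.1 ω) := fun e =>
    hg.1.sub (hg.1.comp (measurable_shift e.1))
  obtain ⟨C', hC'⟩ := hg.2
  have h4 := hμ.integral_eq hP (F := fun ω e => g ω - g (shift e.1 ω)) hgm (C := C' + C')
    fun ω _ e => by
      rw [abs_mul, abs_of_nonneg (hk.mem_Icc ω e).1]
      exact (mul_le_of_le_one_left (abs_nonneg _) (hk.mem_Icc ω e).2).trans
        ((abs_sub _ _).trans (add_le_add (hC' _) (hC' _)))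
  have hsm : Measurable fun q : Config d m × Dir d => shift q.2.1 q.1 :=
    measurable_from_prod_countable_left fun e => measurable_shift e.1
  have hgi1 : Integrable (fun q : Config d m × Dir d => g q.1) μ :=
    Integrable.of_bound (hg.1.comp measurable_fst).aestronglyMeasurable C'
      (ae_of_all _ fun q => hC' _)
  have hgi2 : Integrable (fun q : Config d m × Dir d => g (shift q.2.1 q.1)) μ :=
    Integrable.of_bound (hg.1.comp hsm).aestronglyMeasurable C' (ae_of_all _ fun q => hC' _)
  have h5 : ∫ q, (g q.1 - g (shift q.2.1 q.1)) ∂μ = 0 := by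
    rw [integral_sub hgi1 hgi2, sub_eq_zero]
    have e1 : ∫ ω, g ω ∂(marg1 μ) = ∫ q, g q.1 ∂μ :=
      integral_map measurable_fst.aemeasurable hg.1.aestronglyMeasurable
    have e2 : ∫ ω, g ω ∂(marg2 μ) = ∫ q, g (shift q.2.1 q.1) ∂μ :=
      integral_map hsm.aemeasurable hg.1.aestronglyMeasurable
    rw [← e1, ← e2, hμ.marginals]
  rw [← h5, h4.2]
  refine integral_congr_ae (ae_of_all _ fun ω => ?_)
  simp only [Finset.mul_sum, mul_assoc]

end PairToKernel

end Perc

namespace Perc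

open Filter Topology
open scoped RealInnerProductSpace Pointwise

variable {d : ℕ} {m : Model}

/-! ### Separation in Hilbert space -/

section Hilbert

variable {H : Type*} [NormedAddCommGroup H] [InnerProductSpace ℝ H] [CompleteSpace H]

/-- A decreasing sequence of nonempty closed convex bounded sets has a common point: the elements
of least norm form a Cauchy sequence. -/
theorem nonempty_iInter_of_convex {C : ℕ → Set H} (hanti : Antitone C)
    (hne : ∀ n, (C n).Nonempty) (hcl : ∀ n, IsClosed (C n)) (hconv : ∀ n, Convex ℝ (C n))
    {R : ℝ} (hR : ∀ n, ∀ x ∈ C n, ‖x‖ ≤ R) : (⋂ n, C n).Nonempty := by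
  have hmin : ∀ n, ∃ p ∈ C n, ∀ w ∈ C n, ‖p‖ ^ 2 ≤ ⟪p, w⟫ := by
    intro n
    obtain ⟨p, hp, hpi⟩ := exists_norm_eq_iInf_of_complete_convex (hne n)
      (hcl n).isComplete (hconv n) 0
    refine ⟨p, hp, fun w hw => ?_⟩
    have := (norm_eq_iInf_iff_real_inner_le_zero (hconv n) hp).1 hpi w hw
    rw [zero_sub, inner_neg_left, inner_sub_right, real_inner_self_eq_norm_sq] at this
    linarith
  choose p hp hpw using hmin
  have hdiff : ∀ n k, n ≤ k → ‖p k - p n‖ ^ 2 ≤ ‖p k‖ ^ 2 - ‖p n‖ ^ 2 := by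
    intro n k hnk
    have h1 := hpw n (p k) (hanti hnk (hp k))
    rw [norm_sub_sq_real, real_inner_comm]
    linarith
  have hmono : Monotone fun n => ‖p n‖ ^ 2 := by
    intro n k hnk
    have := hdiff n k hnk
    have h2 : 0 ≤ ‖p k - p n‖ ^ 2 := by positivity
    dsimp only
    linarith
  have hbdd : BddAbove (range fun n => ‖p n‖ ^ 2) := by
    refine ⟨R ^ 2, ?_⟩
    rintro _ ⟨n, rfl⟩
    exact pow_le_pow_left₀ (norm_nonneg _) (hR n _ (hp n)) 2
  have hlim := tendsto_atTop_ciSup hmono hbdd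
  have hcauchy : CauchySeq p := by
    rw [Metric.cauchySeq_iff']
    intro ε hε
    obtain ⟨n, hn⟩ := eventually_atTop.1
      (hlim.eventually (lt_mem_nhds (show (⨆ n, ‖p n‖ ^ 2) - ε ^ 2 < ⨆ n, ‖p n‖ ^ 2 by
        have : 0 < ε ^ 2 := by positivity
        linarith)))
    refine ⟨n, fun k hk => ?_⟩
    have h1 := hdiff n k hk
    have h2 := hn n le_rfl
    have h3 : ‖p k‖ ^ 2 ≤ ⨆ n, ‖p n‖ ^ 2 := le_ciSup hbdd k
    rw [dist_eq_norm]
    exact lt_of_pow_lt_pow_left₀ 2 hε.le (by linarith)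
  obtain ⟨x, hx⟩ := cauchySeq_tendsto_of_complete hcauchy
  refine ⟨x, mem_iInter.2 fun n => (hcl n).mem_of_tendsto hx ?_⟩
  filter_upwards [eventually_ge_atTop n] with k hk
  exact hanti hk (hp k)

/-- Strict separation of a closed convex set from a disjoint closed subspace, when the points of
the subspace that are close to the convex set are bounded. -/
theorem exists_separating_vector {A : Set H} {N : Submodule ℝ H} (hAne : A.Nonempty)
    (hA : IsClosed A) (hAconv : Convex ℝ A) (hN : IsClosed (N : Set H))
    (hdisj : ∀ x ∈ A, x ∉ N) {R : ℝ} (hR : ∀ a ∈ A, ∀ h ∈ N, ‖a - h‖ < 1 → ‖h‖ ≤ R) :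
    ∃ ψ : H, ∃ δ : ℝ, 0 < δ ∧ (∀ h ∈ N, ⟪ψ, h⟫ = 0) ∧ ∀ a ∈ A, ⟪ψ, a⟫ ≤ -δ := by
  have hpos : ∃ δ > 0, ∀ a ∈ A, ∀ h ∈ N, δ ≤ ‖a - h‖ := by
    by_contra! hcon
    set C : ℕ → Set H := fun n => (N : Set H) ∩ Metric.cthickening (1 / (n + 2 : ℝ)) A with hC
    have hCne : ∀ n, (C n).Nonempty := by
      intro n
      obtain ⟨a, ha, h, hh, hlt⟩ := hcon (1 / (n + 2 : ℝ)) (by positivity)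
      refine ⟨h, hh, Metric.mem_cthickening_of_dist_le h a _ _ ha ?_⟩
      rw [dist_comm, dist_eq_norm]
      exact hlt.le
    have hanti : Antitone C := by
      intro n k hnk
      refine inter_subset_inter_right _ (Metric.cthickening_mono ?_ A)
      have : (n : ℝ) ≤ k := by exact_mod_cast hnk
      exact one_div_le_one_div_of_le (by positivity) (by linarith)
    obtain ⟨x, hx⟩ := nonempty_iInter_of_convex hanti hCne
      (fun n => hN.inter Metric.isClosed_cthickening)
      (fun n => N.convex.inter (hAconv.cthickening _)) (R := R) (by
        rintro n x ⟨hxN, hxA⟩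
        have h1 : x ∈ Metric.thickening 1 A := by
          refine Metric.cthickening_subset_thickening' one_pos ?_ A hxA
          rw [div_lt_one (by positivity)]
          have : (0 : ℝ) ≤ n := Nat.cast_nonneg n
          linarith
        obtain ⟨a, ha, hlt⟩ := Metric.mem_thickening_iff.1 h1
        rw [dist_comm, dist_eq_norm] at hlt
        exact hR a ha x hxN hlt)
    have hxN : x ∈ N := (mem_iInter.1 hx 0).1
    have hxA : x ∈ A := by
      rw [← hA.closure_eq, Metric.mem_closure_iff_infDist_zero hAne]
      refine le_antisymm (le_of_forall_pos_lt_add fun ε hε => ?_) Metric.infDist_nonneg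
      obtain ⟨n, hn⟩ := exists_nat_one_div_lt hε
      have h2 := (Metric.cthickening_eq_preimage_infEDist _ A ▸ (mem_iInter.1 hx n).2 :
        x ∈ (fun x => Metric.infEDist x A) ⁻¹' Iic (ENNReal.ofReal (1 / (n + 2 : ℝ))))
      have h3 : Metric.infDist x A ≤ 1 / (n + 2 : ℝ) :=
        ENNReal.toReal_le_of_le_ofReal (by positivity) h2
      have h4 : 1 / (n + 2 : ℝ) ≤ 1 / (n + 1 : ℝ) :=
        one_div_le_one_div_of_le (by positivity) (by linarith)
      linarith
    exact hdisj x hxA hxN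
  obtain ⟨δ₀, hδ₀, hdist⟩ := hpos
  have h0 : (0 : H) ∉ closure (A - (N : Set H)) := by
    rw [Metric.mem_closure_iff]
    push Not
    refine ⟨δ₀, hδ₀, ?_⟩
    rintro _ ⟨a, ha, h, hh, rfl⟩
    rw [dist_zero_left]
    exact hdist a ha h hh
  obtain ⟨ℓ, u, hu0, hu⟩ := geometric_hahn_banach_point_closed (hAconv.sub N.convex).closure
    isClosed_closure h0
  rw [map_zero] at hu0
  have hsep : ∀ a ∈ A, ∀ h ∈ N, u < ℓ a - ℓ h := by
    intro a ha h hh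
    rw [← map_sub]
    exact hu _ (subset_closure ⟨a, ha, h, hh, rfl⟩)
  have hzero : ∀ h ∈ N, ℓ h = 0 := by
    intro h hh
    by_contra hne
    obtain ⟨a, ha⟩ := hAne
    have h1 := hsep a ha (((ℓ a) / ℓ h) • h) (N.smul_mem _ hh)
    rw [map_smul, smul_eq_mul, div_mul_cancel₀ _ hne] at h1
    linarith
  refine ⟨-(InnerProductSpace.toDual ℝ H).symm ℓ, u, hu0, fun h hh => ?_, fun a ha => ?_⟩
  · rw [inner_neg_left, InnerProductSpace.toDual_symm_apply, hzero h hh, neg_zero]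
  · rw [inner_neg_left, InnerProductSpace.toDual_symm_apply]
    have := hsep a ha 0 N.zero_mem
    rw [map_zero] at this
    linarith

end Hilbert

/-! ### The measure on open directed edges at the origin -/

/-- The measure on pairs with given slices. -/
noncomputable def pairMeasure (ρ : Dir d → Measure (Config d m)) :
    Measure (Config d m × Dir d) :=
  ∑ e, (ρ e).map fun ω => (ω, e)

theorem measurableEmbedding_pair (e : Dir d) :
    MeasurableEmbedding fun ω : Config d m => (ω, e) :=
  MeasurableEmbedding.prodMk_right MeasurableEmbedding.id e

theorem slice_pairMeasure (ρ : Dir d → Measure (Config d m)) (e : Dir d) :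
    slice (pairMeasure ρ) e = ρ e := by
  ext s hs
  rw [slice_apply _ _ hs, pairMeasure, Measure.finsetSum_apply,
    Finset.sum_eq_single e]
  · rw [(measurableEmbedding_pair e).map_apply]
    congr 1
    ext ω
    simp
  · intro e' _ hne
    rw [(measurableEmbedding_pair e').map_apply]
    have : (fun ω : Config d m => (ω, e')) ⁻¹' s ×ˢ {e} = ∅ := by
      ext ω
      simp [hne]
    rw [this, measure_empty]
  · simp

theorem pairMeasure_apply (ρ : Dir d → Measure (Config d m)) (s : Set (Config d m × Dir d)) :
    pairMeasure ρ s = ∑ e, ρ e ((fun ω => (ω, e)) ⁻¹' s) := by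
  rw [pairMeasure, Measure.finsetSum_apply]
  exact Finset.sum_congr rfl fun e _ => (measurableEmbedding_pair e).map_apply _ _

theorem ae_pairMeasure_iff (ρ : Dir d → Measure (Config d m)) {p : Config d m × Dir d → Prop} :
    (∀ᵐ q ∂(pairMeasure ρ), p q) ↔ ∀ e, ∀ᵐ ω ∂(ρ e), p (ω, e) := by
  simp only [ae_iff, pairMeasure_apply, Finset.sum_eq_zero_iff, Finset.mem_univ, true_implies]
  rfl

theorem integrable_pairMeasure_iff {ρ : Dir d → Measure (Config d m)}
    {F : Config d m × Dir d → ℝ} :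
    Integrable F (pairMeasure ρ) ↔ ∀ e, Integrable (fun ω => F (ω, e)) (ρ e) := by
  rw [pairMeasure, integrable_finsetSum_measure]
  simp only [Finset.mem_univ, true_implies]
  exact forall_congr' fun e => (measurableEmbedding_pair e).integrable_map_iff

theorem integral_pairMeasure {ρ : Dir d → Measure (Config d m)} {F : Config d m × Dir d → ℝ}
    (hF : Integrable F (pairMeasure ρ)) :
    ∫ q, F q ∂(pairMeasure ρ) = ∑ e, ∫ ω, F (ω, e) ∂(ρ e) := by
  have hF' := hF
  rw [pairMeasure, integrable_finsetSum_measure] at hF'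
  rw [pairMeasure, integral_finsetSum_measure hF']
  exact Finset.sum_congr rfl fun e _ => (measurableEmbedding_pair e).integral_map _

theorem lintegral_pairMeasure (ρ : Dir d → Measure (Config d m))
    (F : Config d m × Dir d → ℝ≥0∞) :
    ∫⁻ q, F q ∂(pairMeasure ρ) = ∑ e, ∫⁻ ω, F (ω, e) ∂(ρ e) := by
  rw [pairMeasure, lintegral_finsetSum_measure]
  exact Finset.sum_congr rfl fun e _ => (measurableEmbedding_pair e).lintegral_map _

/-- The law `ℙ_0` times counting measure on directions, restricted to open edges. -/
noncomputable def dartMeasure (P : Measure (Config d m)) : Measure (Config d m × Dir d) :=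
  pairMeasure fun e => (P0 P).restrict {ω | (openGraph ω).Adj 0 e.1}

theorem ae_dartMeasure_iff {P : Measure (Config d m)} {p : Config d m × Dir d → Prop} :
    (∀ᵐ q ∂(dartMeasure P), p q) ↔
      ∀ᵐ ω ∂(P0 P), ∀ e : Dir d, (openGraph ω).Adj 0 e.1 → p (ω, e) := by
  rw [dartMeasure, ae_pairMeasure_iff, ae_all_iff]
  exact forall_congr' fun e => ae_restrict_iff' (measurableSet_adj 0 e.1)

theorem indicator_adj_eq (F : Config d m → ℝ) (e : Dir d) :
    {ω : Config d m | (openGraph ω).Adj 0 e.1}.indicator F = fun ω => openInd ω e * F ω := by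
  funext ω
  by_cases h : (openGraph ω).Adj 0 e.1
  · rw [indicator_of_mem (show ω ∈ {ω : Config d m | (openGraph ω).Adj 0 e.1} from h),
      openInd_of_adj h, one_mul]
  · rw [indicator_of_notMem (show ω ∉ {ω : Config d m | (openGraph ω).Adj 0 e.1} from h),
      openInd_of_not_adj h, zero_mul]

theorem integrable_dartMeasure_iff {P : Measure (Config d m)} {F : Config d m × Dir d → ℝ} :
    Integrable F (dartMeasure P) ↔ ∀ e, Integrable (fun ω => openInd ω e * F (ω, e)) (P0 P) := by
  rw [dartMeasure, integrable_pairMeasure_iff]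
  refine forall_congr' fun e => ?_
  rw [← indicator_adj_eq (fun ω => F (ω, e)), integrable_indicator_iff (measurableSet_adj 0 e.1)]
  rfl

theorem integral_dartMeasure {P : Measure (Config d m)} {F : Config d m × Dir d → ℝ}
    (hF : Integrable F (dartMeasure P)) :
    ∫ q, F q ∂(dartMeasure P) = ∫ ω, ∑ e, openInd ω e * F (ω, e) ∂(P0 P) := by
  rw [integral_finsetSum _ fun e _ => integrable_dartMeasure_iff.1 hF e]
  rw [dartMeasure, integral_pairMeasure hF]
  refine Finset.sum_congr rfl fun e _ => ?_
  rw [← indicator_adj_eq (fun ω => F (ω, e)), integral_indicator (measurableSet_adj 0 e.1)]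

/-- Reversal of a directed edge at the origin, as seen from its other endpoint. -/
noncomputable def revDart (q : Config d m × Dir d) : Config d m × Dir d :=
  (shift q.2.1 q.1, negDir q.2)

theorem measurable_revDart : Measurable (revDart : Config d m × Dir d → Config d m × Dir d) :=
  measurable_from_prod_countable_left fun e =>
    (measurable_shift e.1).prodMk (measurable_const (a := negDir e))

section Dart

variable {P : Measure (Config d m)}

theorem dartMeasure_apply (s : Set (Config d m × Dir d)) (hs : MeasurableSet s) :
    dartMeasure P s = ∑ e : Dir d, (P (Omega0 d m))⁻¹ *
      P ({ω | (ω, e) ∈ s ∧ (openGraph ω).Adj 0 e.1} ∩ Omega0 d m) := by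
  rw [dartMeasure, pairMeasure_apply]
  refine Finset.sum_congr rfl fun e _ => ?_
  have h1 : MeasurableSet ((fun ω : Config d m => (ω, e)) ⁻¹' s) :=
    (measurableEmbedding_pair e).measurable hs
  rw [Measure.restrict_apply h1, P0_eq, Measure.smul_apply, smul_eq_mul,
    Measure.restrict_apply (h1.inter (measurableSet_adj 0 e.1))]
  rfl

/-- Reversal of edges preserves the measure: both endpoints of an open edge lie in the infinite
cluster as soon as one of them does, and the unconditioned law is invariant under shifts. -/
theorem measurePreserving_revDart (hP : Admissible P) :
    MeasurePreserving revDart (dartMeasure P) (dartMeasure P) := by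
  refine ⟨measurable_revDart, ?_⟩
  ext s hs
  rw [Measure.map_apply measurable_revDart hs, dartMeasure_apply _ (measurable_revDart hs),
    dartMeasure_apply _ hs]
  refine Fintype.sum_equiv ⟨negDir, negDir, negDir_negDir, negDir_negDir⟩ _ _ fun e => ?_
  congr 1
  rw [← hP.measure_preimage e.1 ({ω | (ω, _) ∈ s ∧ _} ∩ Omega0 d m)]
  congr 1
  ext ω
  simp only [Equiv.coe_fn_mk, mem_inter_iff, mem_preimage, mem_ofPred_eq]
  rw [adj_negDir]
  constructor
  · rintro ⟨⟨h1, h2⟩, h3⟩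
    exact ⟨⟨h1, h2⟩, shift_mem_Omega0_of_adj h3 h2⟩
  · rintro ⟨⟨h1, h2⟩, h3⟩
    refine ⟨⟨h1, h2⟩, ?_⟩
    have := shift_mem_Omega0_of_adj h3 ((adj_negDir ω e).2 h2)
    rw [shift_shift] at this
    simpa using this

theorem isFiniteMeasure_dartMeasure [IsProbabilityMeasure P] (hP : Admissible P) :
    IsFiniteMeasure (dartMeasure P) := by
  have := hP.isProbabilityMeasure_P0
  refine ⟨?_⟩
  rw [dartMeasure, pairMeasure_apply]
  exact ENNReal.sum_lt_top.2 fun e _ => measure_lt_top _ _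

end Dart

end Perc

namespace Perc

open Filter Topology

variable {d : ℕ} {m : Model}

/-! ### Limits of gradients of bounded functions -/

section MeanZero

variable {P : Measure (Config d m)}

/-- Second moments of a function carried by `Ω_0` do not increase under shifts. -/
theorem lintegral_shift_le (hP : Admissible P) {D : Config d m → ℝ≥0∞} (hD : Measurable D)
    (h0 : ∀ ω, ω ∉ Omega0 d m → D ω = 0) (x : Lat d) :
    ∫⁻ ω, D (shift x ω) ∂(P0 P) ≤ ∫⁻ ω, D ω ∂(P0 P) := by
  rw [lintegral_P0, lintegral_P0]
  refine mul_le_mul_right ?_ _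
  have h1 : (Omega0 d m).indicator D = D := by
    funext ω
    by_cases h : ω ∈ Omega0 d m
    · rw [indicator_of_mem h]
    · rw [indicator_of_notMem h, h0 ω h]
  rw [h1, ← (hP.measurePreserving x).lintegral_comp hD]
  exact lintegral_mono fun ω => indicator_le_self _ _ _

theorem measurable_shift_nat_smul {X : Config d m → ℕ} (hX : Measurable X) (e : Dir d)
    {g : Config d m → ℝ} (hg : Measurable g) : Measurable fun ω => g (shift (X ω • e.1) ω) := by
  have h1 : Measurable fun q : ℕ × Config d m => g (shift (q.1 • e.1) q.2) :=
    measurable_from_prod_countable_right fun j => hg.comp (measurable_shift (j • e.1))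
  exact h1.comp (hX.prodMk measurable_id)

/-- The shift to the first arrival point preserves `ℙ_0`, in the form of the vanishing of the mean
of a coboundary. The transfer function is the value at the first cluster point on a half-line. -/
theorem integral_arrival_coboundary [IsProbabilityMeasure P] (hP : Admissible P)
    {g : Config d m → ℝ} (hg : Measurable g) (hgb : ∃ C : ℝ, ∀ ω, |g ω| ≤ C) (e : Dir d) :
    Integrable (fun ω => g ω - g (shift (arrivalPoint ω e) ω)) (P0 P) ∧
      ∫ ω, (g ω - g (shift (arrivalPoint ω e) ω)) ∂(P0 P) = 0 := by
  obtain ⟨C, hC⟩ := hgb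
  have := hP.isProbabilityMeasure_P0
  have hm : Measurable fun ω => g ω - g (shift (arrivalPoint ω e) ω) :=
    hg.sub (measurable_shift_nat_smul (measurable_arrival e) e hg)
  refine ⟨Integrable.of_bound hm.aestronglyMeasurable (C + C) (ae_of_all _ fun ω =>
    (abs_sub _ _).trans (add_le_add (hC _) (hC _))), ?_⟩
  set H : Config d m → ℝ := fun ω => g (shift (hit e ω • e.1) ω) with hH
  have hHm : Measurable H := measurable_shift_nat_smul (measurable_hit e) e hg
  have hHi : Integrable H P := Integrable.of_bound hHm.aestronglyMeasurable C
    (ae_of_all _ fun ω => hC _)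
  have hmp := hP.measurePreserving e.1
  have h1 : ∫ ω, (H ω - H (shift e.1 ω)) ∂P = 0 := by
    have hHi' : Integrable (fun ω => H (shift e.1 ω)) P := hmp.integrable_comp_of_integrable hHi
    rw [integral_sub hHi hHi', sub_eq_zero]
    have h2 := integral_map (μ := P) hmp.measurable.aemeasurable (f := H)
      hHm.aestronglyMeasurable
    rwa [hmp.map_eq] at h2
  rw [integral_P0]
  refine mul_eq_zero_of_right _ (Eq.trans (integral_congr_ae ?_) h1)
  filter_upwards [ae_exists_nsmul_mem hP e] with ω hω
  have hex : ∃ k : ℕ, e.1 + k • e.1 ∈ infCluster ω := hω e.1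
  have hshift : shift (hit e (shift e.1 ω) • e.1) (shift e.1 ω) =
      shift ((hit e (shift e.1 ω) + 1) • e.1) ω := by
    rw [shift_shift, succ_nsmul']
  by_cases h0 : ω ∈ Omega0 d m
  · rw [indicator_of_mem h0]
    simp only [hH]
    rw [hit_eq_zero h0, zero_smul, shift_zero, hshift, ← arrival_eq_hit_add_one hex]
    rfl
  · rw [indicator_of_notMem h0]
    simp only [hH]
    rw [hshift, ← hit_eq_hit_add_one h0 hex, sub_self]

/-- The distance of two fields on the open edges at the origin. -/
noncomputable def edgeDefect (G G' : Config d m → Dir d → ℝ) : Config d m → ℝ≥0∞ :=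
  (Omega0 d m).indicator fun ω => ∑ e, ENNReal.ofReal (openInd ω e) * ‖G ω e - G' ω e‖ₑ

/-- Two fields that differ by at most `B` at all points of a path have sums along it that differ
by at most `B` times the length. -/
theorem enorm_total_sub_le {G G' : Config d m → Dir d → ℝ} {ω : Config d m}
    (h0 : ω ∈ Omega0 d m) {B : ℝ≥0∞} {l : List (Dir d)} (hl : OpenPath ω l)
    (hB : ∀ l', l' <+: l → edgeDefect G G' (shift (endpt l') ω) ≤ B) :
    ‖total G ω l - total G' ω l‖ₑ ≤ l.length * B := by
  induction l generalizing ω with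
  | nil => simp
  | cons e l ih =>
    have h1 := ih (shift_mem_Omega0_of_adj h0 hl.1) hl.2 fun l' hl' => by
      have := hB (e :: l') (by simpa using hl')
      rwa [endpt_cons, ← shift_shift] at this
    have h2 : ‖G ω e - G' ω e‖ₑ ≤ B := by
      refine le_trans ?_ (hB [] (List.nil_prefix))
      rw [endpt_nil, shift_zero, edgeDefect, indicator_of_mem h0]
      refine le_trans ?_ (Finset.single_le_sum
        (f := fun e => ENNReal.ofReal (openInd ω e) * ‖G ω e - G' ω e‖ₑ)
        (fun _ _ => zero_le) (Finset.mem_univ e))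
      rw [openInd_of_adj hl.1]
      simp
    have h3 : total G ω (e :: l) - total G' ω (e :: l) =
        (G ω e - G' ω e) + (total G (shift e.1 ω) l - total G' (shift e.1 ω) l) := by
      simp only [total_cons]
      ring
    rw [h3, List.length_cons]
    push_cast
    rw [add_mul, one_mul, add_comm _ B]
    exact (enorm_add_le _ _).trans (add_le_add h2 h1)

/-- The path is replaced by a box that contains it, so that the bound depends on the path only
through its length. -/
theorem enorm_total_sub_le_sum_box {G G' : Config d m → Dir d → ℝ} {ω : Config d m}
    (h0 : ω ∈ Omega0 d m) {l : List (Dir d)} (hl : OpenPath ω l) :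
    ‖total G ω l - total G' ω l‖ₑ ≤
      l.length * ∑ x ∈ box d l.length, edgeDefect G G' (shift x ω) := by
  refine enorm_total_sub_le h0 hl fun l' hl' => ?_
  refine Finset.single_le_sum (f := fun x => edgeDefect G G' (shift x ω))
    (fun _ _ => zero_le) (mem_box_of_l1_le ((l1_endpt_le l').trans ?_))
  exact_mod_cast hl'.length_le

/-- The chemical distance to the first arrival point. -/
noncomputable def arrivalDist (e : Dir d) (ω : Config d m) : ℕ :=
  chemDist ω 0 (arrivalPoint ω e)

theorem measurable_arrivalDist (e : Dir d) :
    Measurable (arrivalDist e : Config d m → ℕ) := by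
  have h1 : Measurable fun q : ℕ × Config d m => chemDist q.2 0 (q.1 • e.1) :=
    measurable_from_prod_countable_right fun j => measurable_chemDist 0 (j • e.1)
  exact h1.comp ((measurable_arrival e).prodMk measurable_id)

/-- A moment of the arrival distance; finite because of the exponential tails. -/
theorem tsum_arrivalDist_ne_top [IsProbabilityMeasure P] (hP : Admissible P) (e : Dir d) :
    ∑' k : ℕ, (k : ℝ≥0∞) * (2 * k + 1 : ℝ≥0∞) ^ d *
      (P0 P {ω | arrivalDist e ω = k}) ^ (1 / 2 : ℝ) ≠ ∞ := by
  have := hP.isProbabilityMeasure_P0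
  obtain ⟨c₅, c₆, h₅, h₆, htail⟩ := hP.arrival_tail
  set r : ℝ := Real.exp (-c₆ / 2) with hr
  have hr1 : ‖r‖ < 1 := by
    rw [Real.norm_of_nonneg (Real.exp_pos _).le, Real.exp_lt_one_iff]
    linarith
  set K : ℝ := (c₅ * Real.exp c₆) ^ (1 / 2 : ℝ) with hK
  have hK0 : 0 ≤ K := by positivity
  have hsum : Summable fun k : ℕ => 3 ^ d * K * ((k : ℝ) ^ (d + 1) * r ^ k) :=
    (summable_pow_mul_geometric_of_norm_lt_one (d + 1) hr1).mul_left _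
  refine ne_top_of_le_ne_top hsum.tsum_ofReal_ne_top (ENNReal.tsum_le_tsum fun k => ?_)
  rcases Nat.eq_zero_or_pos k with rfl | hk
  · simp
  have h1 : P0 P {ω | arrivalDist e ω = k} ≤
      ENNReal.ofReal (c₅ * Real.exp (-c₆ * ((k - 1 : ℕ) : ℝ))) := by
    rw [← ENNReal.ofReal_toReal (measure_ne_top (P0 P) {ω | arrivalDist e ω = k})]
    refine ENNReal.ofReal_le_ofReal (le_trans ?_ (htail e (k - 1)))
    refine measureReal_mono ?_ (measure_ne_top _ _)
    intro ω (hω : arrivalDist e ω = k)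
    change k - 1 < arrivalDist e ω
    omega
  have h2 : (P0 P {ω | arrivalDist e ω = k}) ^ (1 / 2 : ℝ) ≤ ENNReal.ofReal (K * r ^ k) := by
    refine (ENNReal.rpow_le_rpow h1 (by norm_num)).trans (le_of_eq ?_)
    rw [ENNReal.ofReal_rpow_of_nonneg (by positivity) (by norm_num)]
    congr 1
    have e1 : c₅ * Real.exp (-c₆ * ((k - 1 : ℕ) : ℝ)) =
        c₅ * Real.exp c₆ * Real.exp (-c₆ * k) := by
      rw [mul_assoc, ← Real.exp_add, Nat.cast_sub hk]
      congr 2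
      push_cast
      ring
    rw [e1, Real.mul_rpow (by positivity) (by positivity), ← Real.exp_mul, hr, ← Real.exp_nat_mul]
    congr 2
    ring
  have h3 : (k : ℝ≥0∞) * (2 * k + 1 : ℝ≥0∞) ^ d ≤
      ENNReal.ofReal (3 ^ d * (k : ℝ) ^ (d + 1)) := by
    have e1 : (k : ℝ≥0∞) * (2 * k + 1 : ℝ≥0∞) ^ d = ((k * (2 * k + 1) ^ d : ℕ) : ℝ≥0∞) := by
      push_cast
      rfl
    have e2 : 3 ^ d * (k : ℝ) ^ (d + 1) = ((k * (3 * k) ^ d : ℕ) : ℝ) := by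
      push_cast
      rw [mul_pow, pow_succ]
      ring
    rw [e1, e2, ENNReal.ofReal_natCast]
    have : k * (2 * k + 1) ^ d ≤ k * (3 * k) ^ d :=
      Nat.mul_le_mul_left _ (Nat.pow_le_pow_left (by omega) _)
    exact_mod_cast this
  refine (mul_le_mul' h3 h2).trans (le_of_eq ?_)
  rw [← ENNReal.ofReal_mul (by positivity)]
  congr 1
  ring

/-- The sum of a field over the box spanned by the arrival distance is controlled by its second
moment, by Cauchy-Schwarz on the level sets of the arrival distance. -/
theorem lintegral_sum_box_arrivalDist_le (hP : Admissible P) (e : Dir d)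
    {D : Config d m → ℝ≥0∞} (hD : Measurable D) (h0 : ∀ ω, ω ∉ Omega0 d m → D ω = 0) :
    ∫⁻ ω, (arrivalDist e ω : ℝ≥0∞) *
        ∑ x ∈ box d (arrivalDist e ω), D (shift x ω) ∂(P0 P) ≤
      (∑' k : ℕ, (k : ℝ≥0∞) * (2 * k + 1 : ℝ≥0∞) ^ d *
        (P0 P {ω | arrivalDist e ω = k}) ^ (1 / 2 : ℝ)) *
      (∫⁻ ω, D ω ^ (2 : ℝ) ∂(P0 P)) ^ (1 / 2 : ℝ) := by
  have hlev : ∀ k : ℕ, MeasurableSet {ω : Config d m | arrivalDist e ω = k} := fun k =>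
    measurable_arrivalDist e (measurableSet_singleton k)
  have hpt : ∀ ω : Config d m, (arrivalDist e ω : ℝ≥0∞) *
      ∑ x ∈ box d (arrivalDist e ω), D (shift x ω) =
      ∑' k : ℕ, {ω | arrivalDist e ω = k}.indicator
        (fun ω => (k : ℝ≥0∞) * ∑ x ∈ box d k, D (shift x ω)) ω := by
    intro ω
    rw [tsum_eq_single (arrivalDist e ω)]
    · rw [indicator_of_mem (by exact rfl)]
    · intro k hk
      rw [indicator_of_notMem]
      exact fun h => hk (Eq.symm h)
  have hDx : ∀ x : Lat d, Measurable fun ω => D (shift x ω) := fun x =>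
    hD.comp (measurable_shift x)
  have hkm : ∀ k : ℕ, Measurable fun ω => (k : ℝ≥0∞) * ∑ x ∈ box d k, D (shift x ω) := fun k =>
    (Finset.measurable_sum _ fun x _ => hDx x).const_mul _
  rw [lintegral_congr hpt, lintegral_tsum fun k => ((hkm k).indicator (hlev k)).aemeasurable,
    ← ENNReal.tsum_mul_right]
  refine ENNReal.tsum_le_tsum fun k => ?_
  set I := (∫⁻ ω, D ω ^ (2 : ℝ) ∂(P0 P)) ^ (1 / 2 : ℝ) with hI
  set p := (P0 P {ω : Config d m | arrivalDist e ω = k}) ^ (1 / 2 : ℝ) with hp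
  have hx : ∀ x : Lat d, ∫⁻ ω, {ω | arrivalDist e ω = k}.indicator (fun _ => (1 : ℝ≥0∞)) ω *
      D (shift x ω) ∂(P0 P) ≤ p * I := by
    intro x
    refine (ENNReal.lintegral_mul_le_Lp_mul_Lq (P0 P) Real.HolderConjugate.two_two
      (measurable_const.indicator (hlev k)).aemeasurable (hDx x).aemeasurable).trans ?_
    refine mul_le_mul' (le_of_eq ?_) (ENNReal.rpow_le_rpow ?_ (by norm_num))
    · rw [hp]
      congr 1
      rw [← lintegral_indicator_one (hlev k)]
      refine lintegral_congr fun ω => ?_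
      by_cases h : arrivalDist e ω = k
      · simp [h]
      · simp [h]
    · refine lintegral_shift_le hP (D := fun ω => D ω ^ (2 : ℝ)) (hD.pow_const _) (fun ω h => ?_) x
      simp [h0 ω h]
  have hrew : ∀ ω : Config d m, {ω | arrivalDist e ω = k}.indicator
      (fun ω => (k : ℝ≥0∞) * ∑ x ∈ box d k, D (shift x ω)) ω =
      (k : ℝ≥0∞) * ∑ x ∈ box d k, {ω | arrivalDist e ω = k}.indicator
        (fun _ => (1 : ℝ≥0∞)) ω * D (shift x ω) := by
    intro ω
    by_cases h : arrivalDist e ω = k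
    · simp [h]
    · simp [h]
  have hmul : ∀ x : Lat d, Measurable fun ω => {ω | arrivalDist e ω = k}.indicator
      (fun _ => (1 : ℝ≥0∞)) ω * D (shift x ω) := fun x =>
    (measurable_const.indicator (hlev k)).mul (hDx x)
  rw [lintegral_congr hrew, lintegral_const_mul _ (Finset.measurable_sum _ fun x _ => hmul x),
    lintegral_finsetSum _ fun x _ => hmul x]
  calc (k : ℝ≥0∞) * ∑ x ∈ box d k, _ ≤ (k : ℝ≥0∞) * ((box d k).card • (p * I)) :=
        mul_le_mul_right (Finset.sum_le_card_nsmul _ _ _ fun x _ => hx x) _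
    _ = (k : ℝ≥0∞) * (2 * k + 1 : ℝ≥0∞) ^ d * p * I := by
        rw [card_box, nsmul_eq_mul]
        push_cast
        ring

/-- The second moment of the edge defect is the distance in `L²` of the open directed edges. -/
theorem lintegral_edgeDefect_le (P : Measure (Config d m)) {G G' : Config d m → Dir d → ℝ}
    (hG : ∀ e, Measurable fun ω => G ω e) (hG' : ∀ e, Measurable fun ω => G' ω e) :
    (∫⁻ ω, edgeDefect G G' ω ^ (2 : ℝ) ∂(P0 P)) ^ (1 / 2 : ℝ) ≤
      (Fintype.card (Dir d) : ℝ≥0∞) ^ (1 / 2 : ℝ) *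
      eLpNorm (fun q : Config d m × Dir d => G q.1 q.2 - G' q.1 q.2) 2 (dartMeasure P) := by
  have h1 : ∀ ω, edgeDefect G G' ω ^ (2 : ℝ) ≤ (Fintype.card (Dir d) : ℝ≥0∞) *
      ∑ e : Dir d, {ω : Config d m | (openGraph ω).Adj 0 e.1}.indicator
        (fun ω => ‖G ω e - G' ω e‖ₑ ^ (2 : ℝ)) ω := by
    intro ω
    refine (ENNReal.rpow_le_rpow (indicator_le_self _ _ ω) (by norm_num)).trans ?_
    refine (ENNReal.rpow_sum_le_const_mul_sum_rpow _ _ (by norm_num)).trans (le_of_eq ?_)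
    congr 1
    · rw [Finset.card_univ]
      norm_num
    · refine Finset.sum_congr rfl fun e _ => ?_
      by_cases h : (openGraph ω).Adj 0 e.1
      · simp [openInd_of_adj h, h]
      · simp [openInd_of_not_adj h, h]
  have hm : ∀ e : Dir d, Measurable ({ω : Config d m | (openGraph ω).Adj 0 e.1}.indicator
      (fun ω => ‖G ω e - G' ω e‖ₑ ^ (2 : ℝ))) := fun e =>
    (((hG e).sub (hG' e)).enorm.pow_const _).indicator (measurableSet_adj 0 e.1)
  have h2 : ∫⁻ ω, edgeDefect G G' ω ^ (2 : ℝ) ∂(P0 P) ≤ (Fintype.card (Dir d) : ℝ≥0∞) *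
      ∫⁻ q : Config d m × Dir d, ‖G q.1 q.2 - G' q.1 q.2‖ₑ ^ (2 : ℝ) ∂(dartMeasure P) := by
    refine (lintegral_mono h1).trans (le_of_eq ?_)
    rw [lintegral_const_mul _ (Finset.measurable_sum _ fun e _ => hm e),
      lintegral_finsetSum _ fun e _ => hm e, dartMeasure, lintegral_pairMeasure]
    congr 1
    exact Finset.sum_congr rfl fun e _ => lintegral_indicator (measurableSet_adj 0 e.1) _
  refine (ENNReal.rpow_le_rpow h2 (by norm_num)).trans (le_of_eq ?_)
  rw [ENNReal.mul_rpow_of_nonneg _ _ (by norm_num),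
    eLpNorm_eq_lintegral_rpow_enorm_toReal (by norm_num) (by norm_num)]
  norm_num

theorem total_gradient (g : Config d m → ℝ) (ω : Config d m) (l : List (Dir d)) :
    total (fun ω e => g ω - g (shift e.1 ω)) ω l = g ω - g (shift (endpt l) ω) := by
  induction l generalizing ω with
  | nil => simp
  | cons e l ih =>
    rw [total_cons, ih, shift_shift, endpt_cons]
    ring

theorem tendsto_total {G : Config d m → Dir d → ℝ} {Gn : ℕ → Config d m → Dir d → ℝ}
    {ω : Config d m} {l : List (Dir d)} (hl : OpenPath ω l)
    (h : ∀ l, OpenPath ω l → ∀ e : Dir d, (openGraph (shift (endpt l) ω)).Adj 0 e.1 →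
      Tendsto (fun n => Gn n (shift (endpt l) ω) e) atTop (𝓝 (G (shift (endpt l) ω) e))) :
    Tendsto (fun n => total (Gn n) ω l) atTop (𝓝 (total G ω l)) := by
  induction l generalizing ω with
  | nil => simp
  | cons e l ih =>
    refine Tendsto.add ?_ (ih hl.2 fun l' hl' e' he' => ?_)
    · simpa using h [] trivial e (by simpa using hl.1)
    · have := h (e :: l') ⟨hl.1, hl'⟩ e'
      rw [endpt_cons, ← shift_shift] at this
      exact this he'

/-- A bounded field that is the limit, in `L²` and almost surely on open edges, of gradients of
bounded functions belongs to the class of gradients. -/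
theorem gradientClass_of_tendsto [IsProbabilityMeasure P] (hP : Admissible P)
    {G : Config d m → Dir d → ℝ} (hGm : ∀ e, Measurable fun ω => G ω e)
    (hGb : ∀ e, ∃ A : ℝ, ∀ᵐ ω ∂(P0 P), |G ω e| ≤ A)
    {g : ℕ → Config d m → ℝ} (hg : ∀ n, Measurable (g n)) (hgb : ∀ n, ∃ C : ℝ, ∀ ω, |g n ω| ≤ C)
    (hL2 : Tendsto (fun n => eLpNorm (fun q : Config d m × Dir d =>
      (g n q.1 - g n (shift q.2.1 q.1)) - G q.1 q.2) 2 (dartMeasure P)) atTop (𝓝 0))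
    (hae : ∀ᵐ ω ∂(P0 P), ∀ e : Dir d, (openGraph ω).Adj 0 e.1 →
      Tendsto (fun n => g n ω - g n (shift e.1 ω)) atTop (𝓝 (G ω e))) : GradientClass P G := by
  have := hP.isProbabilityMeasure_P0
  have htot : ∀ᵐ ω ∂(P0 P), ∀ l, OpenPath ω l →
      Tendsto (fun n => g n ω - g n (shift (endpt l) ω)) atTop (𝓝 (total G ω l)) := by
    filter_upwards [ae_P0_shift_of_openPath hP hae] with ω hω l hl
    have := tendsto_total (G := G) (Gn := fun n ω e => g n ω - g n (shift e.1 ω)) hl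
      fun l hl e he => hω l hl e he
    simpa only [total_gradient] using this
  have hloop : ∀ᵐ ω ∂(P0 P), LoopFree G ω := by
    filter_upwards [htot] with ω hω l hl he
    have h1 := hω l hl
    simp only [he, shift_zero, sub_self] at h1
    exact (tendsto_nhds_unique h1 tendsto_const_nhds)
  have hclosed : ∀ᵐ ω ∂(P0 P), ∀ x ∈ infCluster ω, ∀ w : (openGraph ω).Walk x x,
      pathSum G ω w = 0 := by
    refine ae_P0_iff.2 ?_
    filter_upwards [ae_forall_mem_infCluster hP hloop] with ω hω _ x hx w
    obtain ⟨l, h1, h2, -, h4⟩ := exists_openPath_of_walk G ω w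
    rw [h4]
    exact hω x hx l h1 (by simpa using h2)
  refine ⟨hGm, hGb, hclosed, fun e => ?_⟩
  -- shortest paths to the arrival point
  have hpath : ∀ᵐ ω ∂(P0 P), ∃ l, OpenPath ω l ∧ endpt l = arrivalPoint ω e ∧
      l.length = arrivalDist e ω := by
    refine ae_P0_iff.2 ?_
    filter_upwards [ae_reachable hP, ae_exists_nsmul_mem hP e] with ω h1 h2 h0
    have hv : arrivalPoint ω e ∈ infCluster ω := by
      have hin : arrival ω e ∈ {k : ℕ | 1 ≤ k ∧ shift (k • e.1) ω ∈ Omega0 d m} := by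
        refine Nat.sInf_mem ?_
        obtain ⟨k, hk⟩ := h2 e.1
        refine ⟨k + 1, by omega, ?_⟩
        rwa [shift_mem_Omega0, succ_nsmul']
      exact (shift_mem_Omega0 _ _).1 hin.2
    obtain ⟨l, h3, h4, h5⟩ := exists_openPath_length_eq_chemDist (h1 0 h0 _ hv)
    exact ⟨l, by simpa using h3, by simpa using h4, h5⟩
  set V : Config d m → ℝ := fun ω => corrector G ω (arrivalPoint ω e) with hV
  set W : ℕ → Config d m → ℝ := fun n ω => g n ω - g n (shift (arrivalPoint ω e) ω) with hW
  have hWint : ∀ n, Integrable (W n) (P0 P) ∧ ∫ ω, W n ω ∂(P0 P) = 0 := fun n =>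
    integral_arrival_coboundary hP (hg n) (hgb n) e
  have hlim : ∀ᵐ ω ∂(P0 P), Tendsto (fun n => W n ω) atTop (𝓝 (V ω)) := by
    filter_upwards [htot, hloop, hpath] with ω h1 h2 ⟨l, h3, h4, _⟩
    have := h1 l h3
    rw [h4, ← h2.corrector_eq h3 h4] at this
    exact this
  have hVm : AEStronglyMeasurable V (P0 P) :=
    aestronglyMeasurable_of_tendsto_ae atTop (fun n => (hWint n).1.aestronglyMeasurable) hlim
  set Gn : ℕ → Config d m → Dir d → ℝ := fun n ω e => g n ω - g n (shift e.1 ω) with hGn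
  have hGnm : ∀ n e, Measurable fun ω => Gn n ω e := fun n e =>
    (hg n).sub ((hg n).comp (measurable_shift e.1))
  have hDm : ∀ n, Measurable (edgeDefect (Gn n) G) := fun n =>
    (Finset.measurable_sum _ fun e _ => ((measurable_openInd e).ennreal_ofReal.mul
      ((hGnm n e).sub (hGm e)).enorm)).indicator measurableSet_Omega0
  set S := ∑' k : ℕ, (k : ℝ≥0∞) * (2 * k + 1 : ℝ≥0∞) ^ d *
        (P0 P {ω | arrivalDist e ω = k}) ^ (1 / 2 : ℝ) with hS
  have hSt : S ≠ ∞ := tsum_arrivalDist_ne_top hP e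
  set N : ℕ → ℝ≥0∞ := fun n => eLpNorm (fun q : Config d m × Dir d =>
      (g n q.1 - g n (shift q.2.1 q.1)) - G q.1 q.2) 2 (dartMeasure P) with hN
  have hbound : ∀ n, ∫⁻ ω, ‖W n ω - V ω‖ₑ ∂(P0 P) ≤
      S * ((Fintype.card (Dir d) : ℝ≥0∞) ^ (1 / 2 : ℝ) * N n) := by
    intro n
    refine le_trans ?_ ((lintegral_sum_box_arrivalDist_le hP e (hDm n)
      (fun ω h => indicator_of_notMem h _)).trans
      (mul_le_mul_right (lintegral_edgeDefect_le P (hGnm n) hGm) _))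
    refine lintegral_mono_ae ?_
    filter_upwards [hloop, hpath, ae_P0_mem P] with ω h2 ⟨l, h3, h4, h5⟩ h0
    have h6 := enorm_total_sub_le_sum_box (G := Gn n) (G' := G) h0 h3
    rw [total_gradient, h4, h5, ← h2.corrector_eq h3 h4] at h6
    exact h6
  have hto0 : Tendsto (fun n => S * ((Fintype.card (Dir d) : ℝ≥0∞) ^ (1 / 2 : ℝ) * N n)) atTop
      (𝓝 0) := by
    have h1 := ENNReal.Tendsto.const_mul (a := (Fintype.card (Dir d) : ℝ≥0∞) ^ (1 / 2 : ℝ)) hL2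
      (Or.inr (ENNReal.rpow_ne_top_of_nonneg (by norm_num) (ENNReal.natCast_ne_top _)))
    rw [mul_zero] at h1
    have h2 := ENNReal.Tendsto.const_mul h1 (Or.inr hSt)
    rwa [mul_zero] at h2
  have hdiff0 : Tendsto (fun n => ∫⁻ ω, ‖W n ω - V ω‖ₑ ∂(P0 P)) atTop (𝓝 0) :=
    tendsto_of_tendsto_of_tendsto_of_le_of_le tendsto_const_nhds hto0 (fun _ => zero_le) hbound
  have hVi : Integrable V (P0 P) := by
    obtain ⟨n, hn⟩ := (hdiff0.eventually (gt_mem_nhds ENNReal.zero_lt_top)).exists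
    have h1 : Integrable (fun ω => W n ω - V ω) (P0 P) :=
      ⟨(hWint n).1.aestronglyMeasurable.sub hVm, hn⟩
    refine ((hWint n).1.sub h1).congr (ae_of_all _ fun ω => ?_)
    simp
  refine ⟨hVi, ?_⟩
  have hconv := tendsto_integral_of_L1 V hVm
    (Eventually.of_forall fun n => (hWint n).1) hdiff0
  simp only [(hWint _).2] at hconv
  exact tendsto_nhds_unique hconv tendsto_const_nhds

end MeanZero

end Perc

namespace Perc

open Filter Topology
open scoped RealInnerProductSpace

variable {d : ℕ} {m : Model}

/-! ### Bounded gradients against the admissible edge functions in `L²` -/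

/-- The partition sum `∑_e π_ω(0,e) exp(f(ω,e) + a(ω,e))`. -/
noncomputable def partitionSum (f a : Config d m × Dir d → ℝ) (ω : Config d m) : ℝ :=
  ∑ e, stepProb ω e * Real.exp (f (ω, e) + a (ω, e))

theorem stepProb_of_not_adj {ω : Config d m} {e : Dir d} (h : ¬ (openGraph ω).Adj 0 e.1) :
    stepProb ω e = 0 := by
  rw [stepProb, openInd_of_not_adj h, zero_div]

theorem partitionSum_congr {P : Measure (Config d m)} (f : Config d m × Dir d → ℝ)
    {a b : Config d m × Dir d → ℝ} (h : a =ᵐ[dartMeasure P] b) :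
    partitionSum f a =ᵐ[P0 P] partitionSum f b := by
  filter_upwards [ae_dartMeasure_iff.1 h] with ω hω
  refine Finset.sum_congr rfl fun e _ => ?_
  by_cases he : (openGraph ω).Adj 0 e.1
  · rw [hω e he]
  · rw [stepProb_of_not_adj he, zero_mul, zero_mul]

theorem partitionSum_pos {ω : Config d m} (h0 : ω ∈ Omega0 d m) (f a : Config d m × Dir d → ℝ) :
    0 < partitionSum f a ω := by
  obtain ⟨e, he⟩ := exists_adj_of_mem_Omega0 h0
  have hcard := one_le_card_dir h0
  refine Finset.sum_pos' (fun e _ => mul_nonneg (stepProb_nonneg ω e) (Real.exp_pos _).le)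
    ⟨e, Finset.mem_univ e, mul_pos (lt_of_lt_of_le ?_ (inv_card_le_stepProb h0 he))
      (Real.exp_pos _)⟩
  exact inv_pos.2 (by linarith)

/-- The edge functions whose partition sum is at most `exp c`. -/
def subSolutions (P : Measure (Config d m)) (f : Config d m × Dir d → ℝ) (c : ℝ) :
    Set (Lp ℝ 2 (dartMeasure P)) :=
  {a | ∀ᵐ ω ∂(P0 P), partitionSum f a ω ≤ Real.exp c}

/-- The gradients of bounded functions, as a subspace of `L²`. -/
noncomputable def boundedGradients (P : Measure (Config d m)) :
    Submodule ℝ (Lp ℝ 2 (dartMeasure P)) where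
  carrier := {h | ∃ g : Config d m → ℝ, Measurable g ∧ (∃ C : ℝ, ∀ ω, |g ω| ≤ C) ∧
    h =ᵐ[dartMeasure P] fun q => g q.1 - g (shift q.2.1 q.1)}
  zero_mem' := ⟨0, measurable_const, ⟨0, fun ω => by simp⟩, by
    filter_upwards [Lp.coeFn_zero ℝ 2 (dartMeasure P)] with q hq
    simpa using hq⟩
  add_mem' := by
    rintro a b ⟨g, hg, ⟨C, hC⟩, ha⟩ ⟨g', hg', ⟨C', hC'⟩, hb⟩
    refine ⟨fun ω => g ω + g' ω, hg.add hg', ⟨C + C', fun ω =>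
      (abs_add_le _ _).trans (add_le_add (hC ω) (hC' ω))⟩, ?_⟩
    filter_upwards [Lp.coeFn_add a b, ha, hb] with q h1 h2 h3
    rw [h1, Pi.add_apply, h2, h3]
    ring
  smul_mem' := by
    rintro r a ⟨g, hg, ⟨C, hC⟩, ha⟩
    refine ⟨fun ω => r * g ω, hg.const_mul r, ⟨|r| * C, fun ω => ?_⟩, ?_⟩
    · rw [abs_mul]
      exact mul_le_mul_of_nonneg_left (hC ω) (abs_nonneg r)
    · filter_upwards [Lp.coeFn_smul r a, ha] with q h1 h2
      rw [h1, Pi.smul_apply, h2, smul_eq_mul]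
      ring

theorem mem_boundedGradients {P : Measure (Config d m)} {h : Lp ℝ 2 (dartMeasure P)} :
    h ∈ boundedGradients P ↔ ∃ g : Config d m → ℝ, Measurable g ∧ (∃ C : ℝ, ∀ ω, |g ω| ≤ C) ∧
      h =ᵐ[dartMeasure P] fun q => g q.1 - g (shift q.2.1 q.1) := Iff.rfl

section Admissible

variable {P : Measure (Config d m)} {f : Config d m × Dir d → ℝ} {c C : ℝ}

/-- Convexity is inherited from the exponential function. -/
theorem convex_subSolutions : Convex ℝ (subSolutions P f c) := by
  intro a ha b hb s t hs ht hst
  have h1 : ((s • a + t • b : Lp ℝ 2 (dartMeasure P)) : Config d m × Dir d → ℝ)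
      =ᵐ[dartMeasure P] fun q => s * a q + t * b q := by
    filter_upwards [Lp.coeFn_add (s • a) (t • b), Lp.coeFn_smul s a, Lp.coeFn_smul t b]
      with q h1 h2 h3
    rw [h1, Pi.add_apply, h2, h3]
    rfl
  filter_upwards [ha, hb, partitionSum_congr f h1] with ω ha hb h1
  rw [h1]
  have h2 : partitionSum f (fun q => s * a q + t * b q) ω ≤
      s * partitionSum f a ω + t * partitionSum f b ω := by
    unfold partitionSum
    rw [Finset.mul_sum, Finset.mul_sum, ← Finset.sum_add_distrib]
    refine Finset.sum_le_sum fun e _ => ?_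
    have h3 := convexOn_exp.2 (mem_univ (f (ω, e) + a (ω, e))) (mem_univ (f (ω, e) + b (ω, e)))
      hs ht hst
    simp only [smul_eq_mul] at h3
    have h4 : f (ω, e) + (s * a (ω, e) + t * b (ω, e)) =
        s * (f (ω, e) + a (ω, e)) + t * (f (ω, e) + b (ω, e)) := by
      linear_combination -f (ω, e) * hst
    rw [h4]
    have := mul_le_mul_of_nonneg_left h3 (stepProb_nonneg ω e)
    linarith
  calc _ ≤ _ := h2
    _ ≤ s * Real.exp c + t * Real.exp c :=
      add_le_add (mul_le_mul_of_nonneg_left ha hs) (mul_le_mul_of_nonneg_left hb ht)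
    _ = Real.exp c := by rw [← add_mul, hst, one_mul]

/-- A subsequence converges almost surely. -/
theorem isClosed_subSolutions : IsClosed (subSolutions P f c) := by
  refine IsSeqClosed.isClosed fun a b ha hb => ?_
  obtain ⟨n, -, hn⟩ := (tendstoInMeasure_of_tendsto_Lp hb).exists_seq_tendsto_ae
  filter_upwards [ae_dartMeasure_iff.1 hn, ae_all_iff.2 ha] with ω h1 h2
  have h3 : Tendsto (fun i => partitionSum f (a (n i)) ω) atTop (𝓝 (partitionSum f b ω)) := by
    refine tendsto_finsetSum _ fun e _ => ?_
    by_cases he : (openGraph ω).Adj 0 e.1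
    · exact ((Real.continuous_exp.tendsto _).comp ((h1 e he).const_add _)).const_mul _
    · simp only [stepProb_of_not_adj he, zero_mul]
      exact tendsto_const_nhds
  exact le_of_tendsto' h3 fun i => h2 (n i)

/-- A sufficiently low constant is a subsolution, so the set is nonempty. -/
theorem const_mem_subSolutions [IsFiniteMeasure (dartMeasure P)] (hC : ∀ q, |f q| ≤ C) :
    Lp.const 2 (dartMeasure P) (c - C) ∈ subSolutions P f c := by
  filter_upwards [partitionSum_congr f (Lp.coeFn_const 2 (dartMeasure P) (c - C)), ae_P0_mem P]
    with ω h1 h0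
  rw [h1]
  unfold partitionSum
  calc _ ≤ ∑ e, stepProb ω e * Real.exp c := by
        refine Finset.sum_le_sum fun e _ => mul_le_mul_of_nonneg_left (Real.exp_le_exp.2 ?_)
          (stepProb_nonneg ω e)
        have := (abs_le.1 (hC (ω, e))).2
        simp only [Function.const_apply]
        linarith
    _ = Real.exp c := by rw [← Finset.sum_mul, sum_stepProb h0, one_mul]

/-- Subsolutions are bounded above, because every open edge carries the weight `1 / (2 d)` at least
in the partition sum. -/
theorem ae_le_of_mem_subSolutions (hC : ∀ q, |f q| ≤ C) {a : Lp ℝ 2 (dartMeasure P)}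
    (ha : a ∈ subSolutions P f c) :
    ∀ᵐ q ∂(dartMeasure P), a q ≤ c + Real.log (Fintype.card (Dir d)) + C := by
  rw [ae_dartMeasure_iff]
  filter_upwards [ha, ae_P0_mem P] with ω h1 h0 e he
  have hcard := one_le_card_dir h0
  have h2 : (Fintype.card (Dir d) : ℝ)⁻¹ * Real.exp (f (ω, e) + a (ω, e)) ≤ Real.exp c := by
    refine le_trans (mul_le_mul_of_nonneg_right (inv_card_le_stepProb h0 he)
      (Real.exp_pos _).le) (le_trans ?_ h1)
    exact Finset.single_le_sum
      (f := fun e => stepProb ω e * Real.exp (f (ω, e) + a (ω, e)))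
      (fun e _ => mul_nonneg (stepProb_nonneg ω e) (Real.exp_pos _).le) (Finset.mem_univ e)
  have h3 : Real.exp (f (ω, e) + a (ω, e)) ≤
      Real.exp (c + Real.log (Fintype.card (Dir d))) := by
    rw [Real.exp_add c, Real.exp_log (by linarith)]
    rwa [inv_mul_le_iff₀ (by linarith), mul_comm] at h2
  have h4 := Real.exp_le_exp.1 h3
  have h5 := (abs_le.1 (hC (ω, e))).1
  linarith

/-- Gradients change sign when the edge is reversed; so do their limits. -/
theorem ae_revDart_eq_neg (hP : Admissible P) {h : Lp ℝ 2 (dartMeasure P)}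
    (hh : h ∈ (boundedGradients P).topologicalClosure) :
    ∀ᵐ q ∂(dartMeasure P), h (revDart q) = -h q := by
  have hmp := measurePreserving_revDart hP
  have hclosed : IsClosed {h : Lp ℝ 2 (dartMeasure P) |
      Lp.compMeasurePreserving revDart hmp h = -h} :=
    isClosed_eq (Lp.isometry_compMeasurePreserving hmp).continuous continuous_neg
  have hsub : (boundedGradients P : Set (Lp ℝ 2 (dartMeasure P))) ⊆
      {h | Lp.compMeasurePreserving revDart hmp h = -h} := by
    rintro h ⟨g, -, -, hg⟩
    refine Lp.ext ?_
    filter_upwards [Lp.coeFn_compMeasurePreserving h hmp, Lp.coeFn_neg h, hg,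
      hmp.quasiMeasurePreserving.ae hg] with q h1 h2 h3 h4
    rw [h1, h2, Pi.neg_apply, h3, Function.comp_apply, h4]
    simp only [revDart]
    rw [shift_shift]
    simp
  have h1 : Lp.compMeasurePreserving revDart hmp h = -h := closure_minimal hsub hclosed hh
  filter_upwards [Lp.coeFn_compMeasurePreserving h hmp, Lp.coeFn_neg h] with q h2 h3
  have h4 : h (revDart q) = (Lp.compMeasurePreserving revDart hmp h) q := h2.symm
  rw [h4, h1, h3, Pi.neg_apply]

/-- A subsolution `a` is bounded above only. A gradient `h` close to `a` is also bounded below,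
since `h` changes sign under reversal of edges and `a` is bounded above on the reversed edge. -/
theorem norm_le_of_near_subSolutions [IsFiniteMeasure (dartMeasure P)] (hP : Admissible P)
    (hC : ∀ q, |f q| ≤ C)
    {a h : Lp ℝ 2 (dartMeasure P)} (ha : a ∈ subSolutions P f c)
    (hh : h ∈ (boundedGradients P).topologicalClosure) (hah : ‖a - h‖ < 1) :
    ‖h‖ ≤ ‖Lp.const 2 (dartMeasure P) |c + Real.log (Fintype.card (Dir d)) + C|‖ + 2 := by
  have hmp := measurePreserving_revDart hP
  set K := c + Real.log (Fintype.card (Dir d)) + C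
  set u : Lp ℝ 2 (dartMeasure P) := |a - h| with hu
  set v : Lp ℝ 2 (dartMeasure P) := Lp.compMeasurePreserving revDart hmp u with hv
  have hun : ‖u‖ < 1 := by rwa [hu, norm_abs_eq_norm]
  have hvn : ‖v‖ < 1 := by rwa [hv, Lp.norm_compMeasurePreserving]
  have hu_eq : ∀ᵐ q ∂(dartMeasure P), u q = |a q - h q| := by
    filter_upwards [Lp.coeFn_abs (a - h), Lp.coeFn_sub a h] with q h1 h2
    rw [hu, h1, h2, Pi.sub_apply]
  have hle := ae_le_of_mem_subSolutions hC ha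
  have key : ‖h‖ ≤ ‖Lp.const 2 (dartMeasure P) |K| + u + v‖ := by
    refine Lp.norm_le_norm_of_ae_le ?_
    filter_upwards [hu_eq, hle, hmp.quasiMeasurePreserving.ae hu_eq,
      hmp.quasiMeasurePreserving.ae hle, ae_revDart_eq_neg hP hh,
      Lp.coeFn_compMeasurePreserving u hmp, Lp.coeFn_add (Lp.const 2 (dartMeasure P) |K| + u) v,
      Lp.coeFn_add (Lp.const 2 (dartMeasure P) |K|) u, Lp.coeFn_const 2 (dartMeasure P) |K|]
      with q h1 h2 h3 h4 h5 h6 h7 h8 h9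
    rw [h7, Pi.add_apply, h8, Pi.add_apply, h9, Function.const_apply, hv, h6, Function.comp_apply,
      h1, h3, h5, Real.norm_eq_abs, Real.norm_eq_abs]
    have e1 := neg_abs_le (a q - h q)
    have e2 := neg_abs_le (a (revDart q) - -h q)
    have e3 := le_abs_self K
    have e4 := abs_nonneg (a q - h q)
    have e5 := abs_nonneg (a (revDart q) - -h q)
    have e6 := abs_nonneg K
    rw [abs_of_nonneg (by linarith : 0 ≤ |K| + |a q - h q| + |a (revDart q) - -h q|), abs_le]
    constructor <;> linarith
  calc ‖h‖ ≤ _ := key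
    _ ≤ ‖Lp.const 2 (dartMeasure P) |K|‖ + ‖u‖ + ‖v‖ :=
      (norm_add_le _ _).trans (add_le_add_left (norm_add_le _ _) _)
    _ ≤ _ := by linarith

/-- A limit of bounded gradients with partition sum at most `exp c` gives an admissible
gradient. -/
theorem infLam_le_of_mem [IsProbabilityMeasure P] (hP : Admissible P) (hC : ∀ q, |f q| ≤ C)
    {p : Lp ℝ 2 (dartMeasure P)} (hp : p ∈ subSolutions P f c)
    (hpN : p ∈ (boundedGradients P).topologicalClosure) : infLam P f ≤ (c : EReal) := by
  have hmp := measurePreserving_revDart hP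
  set K := c + Real.log (Fintype.card (Dir d)) + C with hK
  have hpm : Measurable p := (Lp.stronglyMeasurable p).measurable
  set G : Config d m → Dir d → ℝ := fun ω e => openInd ω e * p (ω, e) with hG
  have hGm : ∀ e, Measurable fun ω => G ω e := fun e =>
    (measurable_openInd e).mul (hpm.comp (measurableEmbedding_pair e).measurable)
  have hGp : (fun q : Config d m × Dir d => G q.1 q.2) =ᵐ[dartMeasure P] p := by
    refine ae_dartMeasure_iff.2 (ae_of_all _ fun ω e he => ?_)
    simp only [hG]
    rw [openInd_of_adj he, one_mul]
  have hle := ae_le_of_mem_subSolutions hC hp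
  have hpb : ∀ᵐ q ∂(dartMeasure P), |p q| ≤ K := by
    filter_upwards [hle, hmp.quasiMeasurePreserving.ae hle, ae_revDart_eq_neg hP hpN]
      with q h1 h2 h3
    rw [h3] at h2
    exact abs_le.2 ⟨by linarith, h1⟩
  have hGb : ∀ᵐ ω ∂(P0 P), ∀ e, |G ω e| ≤ |K| := by
    filter_upwards [ae_dartMeasure_iff.1 hpb] with ω hω e
    simp only [hG]
    by_cases he : (openGraph ω).Adj 0 e.1
    · rw [openInd_of_adj he, one_mul]
      exact (hω e he).trans (le_abs_self K)
    · rw [openInd_of_not_adj he, zero_mul, abs_zero]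
      exact abs_nonneg K
  obtain ⟨h, hh, hlim⟩ := mem_closure_iff_seq_limit.1
    (show p ∈ closure (boundedGradients P : Set (Lp ℝ 2 (dartMeasure P))) from hpN)
  obtain ⟨n, hn, hae⟩ := (tendstoInMeasure_of_tendsto_Lp hlim).exists_seq_tendsto_ae
  choose g hgm hgb hgh using fun i => mem_boundedGradients.1 (hh (n i))
  have hL2 : Tendsto (fun i => eLpNorm (fun q : Config d m × Dir d =>
      (g i q.1 - g i (shift q.2.1 q.1)) - G q.1 q.2) 2 (dartMeasure P)) atTop (𝓝 0) := by
    have h1 := (Lp.tendsto_Lp_iff_tendsto_eLpNorm' _ _).1 (hlim.comp hn.tendsto_atTop)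
    refine h1.congr fun i => eLpNorm_congr_ae ?_
    filter_upwards [hgh i, hGp] with q e1 e2
    simp only [Pi.sub_apply, Function.comp_apply]
    rw [e2, e1]
  have hlimG : ∀ᵐ ω ∂(P0 P), ∀ e : Dir d, (openGraph ω).Adj 0 e.1 →
      Tendsto (fun i => g i ω - g i (shift e.1 ω)) atTop (𝓝 (G ω e)) := by
    refine (ae_dartMeasure_iff (p := fun q => Tendsto (fun i => g i q.1 - g i (shift q.2.1 q.1))
      atTop (𝓝 (G q.1 q.2)))).1 ?_
    filter_upwards [hae, ae_all_iff.2 hgh, hGp] with q h1 h2 h3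
    rw [h3]
    exact h1.congr h2
  have hclass : GradientClass P G := gradientClass_of_tendsto hP hGm
    (fun e => ⟨|K|, hGb.mono fun ω hω => hω e⟩) hgm hgb hL2 hlimG
  refine (iInf₂_le G hclass).trans (essSup_le_of_ae_le _ ?_)
  filter_upwards [hp, partitionSum_congr f hGp, ae_P0_mem P] with ω h1 h2 h0
  have h3 : ∑ e, openInd ω e * stepProb ω e * Real.exp (f (ω, e) + G ω e) =
      partitionSum f p ω := by
    rw [← h2]
    refine Finset.sum_congr rfl fun e _ => ?_
    rw [openInd_mul_stepProb]
  rw [h3]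
  exact_mod_cast (Real.log_le_iff_le_exp (partitionSum_pos h0 f p)).2 h1

/-- Below the infimum of `Λ`, some square integrable edge function is orthogonal to all gradients
and strictly negative on all functions with small partition sum. -/
theorem exists_separating_edge_function [IsProbabilityMeasure P] (hP : Admissible P)
    (hC : ∀ q, |f q| ≤ C) (hc : (c : EReal) < infLam P f) :
    ∃ ψ : Lp ℝ 2 (dartMeasure P), ∃ δ : ℝ, 0 < δ ∧
      (∀ h ∈ boundedGradients P, ⟪ψ, h⟫ = 0) ∧ ∀ a ∈ subSolutions P f c, ⟪ψ, a⟫ ≤ -δ := by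
  have := isFiniteMeasure_dartMeasure hP
  obtain ⟨ψ, δ, hδ, h1, h2⟩ := exists_separating_vector (A := subSolutions P f c)
    (N := (boundedGradients P).topologicalClosure) ⟨_, const_mem_subSolutions hC⟩
    isClosed_subSolutions convex_subSolutions (boundedGradients P).isClosed_topologicalClosure
    (fun p hp hpN => not_le_of_gt hc (infLam_le_of_mem hP hC hp hpN))
    fun a ha h hh hah => norm_le_of_near_subSolutions hP hC ha hh hah
  exact ⟨ψ, δ, hδ, fun h hh => h1 h ((boundedGradients P).le_topologicalClosure hh), h2⟩

end Admissible

end Perc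

namespace Perc

open Filter Topology
open scoped RealInnerProductSpace

variable {d : ℕ} {m : Model}

/-! ### From the separating edge function to a stationary flow -/

/-- The total mass leaving the origin when the open edge `e` carries the mass `u (ω,e)`. -/
noncomputable def outMass (u : Config d m × Dir d → ℝ) (ω : Config d m) : ℝ :=
  ∑ e, openInd ω e * u (ω, e)

/-- The transition kernel proportional to `u` on the open edges. -/
noncomputable def outKernel (u : Config d m × Dir d → ℝ) (ω : Config d m) (e : Dir d) : ℝ :=
  openInd ω e * u (ω, e) / outMass u ω

section Kernel

variable {u : Config d m × Dir d → ℝ} {ε : ℝ}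

theorem measurable_outMass (hu : Measurable u) : Measurable (outMass u) :=
  Finset.measurable_sum _ fun e _ =>
    (measurable_openInd e).mul (hu.comp (measurableEmbedding_pair e).measurable)

theorem openInd_mul_le_outMass (hu : ∀ q, 0 ≤ u q) (ω : Config d m) (e : Dir d) :
    openInd ω e * u (ω, e) ≤ outMass u ω :=
  Finset.single_le_sum (f := fun e => openInd ω e * u (ω, e))
    (fun e _ => mul_nonneg (openInd_nonneg ω e) (hu _)) (Finset.mem_univ e)

theorem outMass_nonneg (hu : ∀ q, 0 ≤ u q) (ω : Config d m) : 0 ≤ outMass u ω :=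
  Finset.sum_nonneg fun e _ => mul_nonneg (openInd_nonneg ω e) (hu _)

theorem le_outMass (hε : 0 ≤ ε) (hu : ∀ q, ε ≤ u q) {ω : Config d m} (h0 : ω ∈ Omega0 d m) :
    ε ≤ outMass u ω := by
  obtain ⟨e, he⟩ := exists_adj_of_mem_Omega0 h0
  have h1 := openInd_mul_le_outMass (fun q => hε.trans (hu q)) ω e
  rw [openInd_of_adj he, one_mul] at h1
  exact (hu _).trans h1

theorem outMass_mul_outKernel (hu : ∀ q, 0 ≤ u q) (ω : Config d m) (e : Dir d) :
    outMass u ω * outKernel u ω e = openInd ω e * u (ω, e) := by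
  by_cases h : outMass u ω = 0
  · have h1 := openInd_mul_le_outMass hu ω e
    rw [h] at h1
    rw [h, zero_mul]
    exact le_antisymm (mul_nonneg (openInd_nonneg ω e) (hu _)) h1
  · exact mul_div_cancel₀ _ h

/-- The lower bound `ε` makes every open edge have positive probability. -/
theorem isKernel_outKernel (P : Measure (Config d m)) (hum : Measurable u) (hε : 0 < ε)
    (hu : ∀ q, ε ≤ u q) : IsKernel P (outKernel u) := by
  have hu0 : ∀ q, 0 ≤ u q := fun q => hε.le.trans (hu q)
  exact
  { measurable := fun e => ((measurable_openInd e).mul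
      (hum.comp (measurableEmbedding_pair e).measurable)).div (measurable_outMass hum)
    mem_Icc := fun ω e => ⟨div_nonneg (mul_nonneg (openInd_nonneg ω e) (hu0 _))
      (outMass_nonneg hu0 ω), div_le_one_of_le₀ (openInd_mul_le_outMass hu0 ω e)
      (outMass_nonneg hu0 ω)⟩
    sum_eq_one := by
      filter_upwards [ae_P0_mem P] with ω h0
      unfold outKernel
      rw [← Finset.sum_div]
      exact div_self (hε.trans_le (le_outMass hε.le hu h0)).ne'
    zero_iff := fun ω h0 e => by
      rw [stepProb_eq_zero_iff h0]
      have h1 := (hε.trans_le (le_outMass hε.le hu h0)).ne'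
      have h2 := (hε.trans_le (hu (ω, e))).ne'
      by_cases he : (openGraph ω).Adj 0 e.1
      · simp [outKernel, openInd_of_adj he, he, h1, h2]
      · simp [outKernel, openInd_of_not_adj he, he] }

/-- The relative entropy density of the kernel is controlled by the outgoing mass. -/
theorem log_outKernel_div_bounds (hε : 0 < ε) (hu : ∀ q, ε ≤ u q) {ω : Config d m}
    (h0 : ω ∈ Omega0 d m) {e : Dir d} (he : (openGraph ω).Adj 0 e.1) :
    Real.log (outKernel u ω e / stepProb ω e) ≤ Real.log (Fintype.card (Dir d)) ∧
      -(outMass u ω / ε) ≤ Real.log (outKernel u ω e / stepProb ω e) := by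
  have hu0 : ∀ q, 0 ≤ u q := fun q => hε.le.trans (hu q)
  have hm := hε.trans_le (le_outMass hε.le hu h0)
  have hcard := one_le_card_dir h0
  have hup : 0 < u (ω, e) := hε.trans_le (hu _)
  have hk : outKernel u ω e = u (ω, e) / outMass u ω := by
    rw [outKernel, openInd_of_adj he, one_mul]
  have hkpos : 0 < outKernel u ω e := by
    rw [hk]
    positivity
  have hk1 : outKernel u ω e ≤ 1 := by
    have := openInd_mul_le_outMass hu0 ω e
    exact div_le_one_of_le₀ this hm.le
  have hs := inv_card_le_stepProb h0 he
  have hspos : 0 < stepProb ω e := lt_of_lt_of_le (inv_pos.2 (by linarith)) hs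
  constructor
  · refine Real.log_le_log (by positivity) ?_
    rw [div_le_iff₀ hspos]
    calc outKernel u ω e ≤ 1 := hk1
      _ = Fintype.card (Dir d) * (Fintype.card (Dir d) : ℝ)⁻¹ :=
        (mul_inv_cancel₀ (by linarith)).symm
      _ ≤ _ := mul_le_mul_of_nonneg_left hs (by linarith)
  · have h1 := Real.log_le_sub_one_of_pos (div_pos hspos hkpos)
    have h2 : stepProb ω e / outKernel u ω e ≤ outMass u ω / ε := by
      rw [hk, div_div_eq_mul_div]
      refine div_le_div₀ hm.le ?_ hε (hu _)
      exact mul_le_of_le_one_left hm.le (stepProb_le_one ω e)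
    have h3 : Real.log (outKernel u ω e / stepProb ω e) =
        -Real.log (stepProb ω e / outKernel u ω e) := by
      rw [← Real.log_inv, inv_div]
    rw [h3]
    linarith

end Kernel

section Admissible

variable {P : Measure (Config d m)} {f : Config d m × Dir d → ℝ} {c C : ℝ}

/-- A function that is bounded above on the set of subsolutions is nonnegative, because the latter
is stable under lowering. -/
theorem ae_nonneg_of_inner_subSolutions_le [IsFiniteMeasure (dartMeasure P)]
    (hC : ∀ q, |f q| ≤ C) {ψ : Lp ℝ 2 (dartMeasure P)} {r : ℝ}
    (hψ : ∀ a ∈ subSolutions P f c, ⟪ψ, a⟫ ≤ r) : 0 ≤ᵐ[dartMeasure P] ψ := by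
  refine ae_nonneg_of_forall_setIntegral_nonneg ((Lp.memLp ψ).integrable one_le_two) ?_
  intro s hs hsm
  set i : Lp ℝ 2 (dartMeasure P) := indicatorConstLp 2 hs hsm.ne (1 : ℝ) with hi
  have hin : ⟪i, ψ⟫ = ∫ x in s, ψ x ∂(dartMeasure P) := L2.inner_indicatorConstLp_one hs hsm.ne ψ
  rw [← hin]
  by_contra! hneg
  set a : Lp ℝ 2 (dartMeasure P) := Lp.const 2 (dartMeasure P) (c - C) with ha
  have hmem : ∀ t : ℝ, 0 ≤ t → a - t • i ∈ subSolutions P f c := by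
    intro t ht
    have h1 : ∀ᵐ q ∂(dartMeasure P), (a - t • i : Lp ℝ 2 (dartMeasure P)) q ≤ a q := by
      filter_upwards [Lp.coeFn_sub a (t • i), Lp.coeFn_smul t i,
        indicatorConstLp_coeFn (p := 2) (hs := hs) (hμs := hsm.ne) (c := (1 : ℝ))]
        with q h1 h2 h3
      rw [h1, Pi.sub_apply, h2, Pi.smul_apply, hi, h3, smul_eq_mul]
      have : 0 ≤ t * s.indicator (fun _ => (1 : ℝ)) q :=
        mul_nonneg ht (indicator_nonneg (fun _ _ => zero_le_one) q)
      linarith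
    filter_upwards [const_mem_subSolutions (P := P) (c := c) hC, ae_dartMeasure_iff.1 h1]
      with ω h2 h3
    refine le_trans (Finset.sum_le_sum fun e _ => ?_) h2
    by_cases he : (openGraph ω).Adj 0 e.1
    · exact mul_le_mul_of_nonneg_left (Real.exp_le_exp.2 (by linarith [h3 e he]))
        (stepProb_nonneg ω e)
    · rw [stepProb_of_not_adj he, zero_mul, zero_mul]
  set t : ℝ := (|r - ⟪ψ, a⟫| + 1) / -⟪i, ψ⟫ with ht
  have ht0 : 0 ≤ t := div_nonneg (by positivity) (by linarith)
  have h1 := hψ _ (hmem t ht0)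
  rw [inner_sub_right, inner_smul_right, real_inner_comm i ψ] at h1
  have h2 : t * -⟪i, ψ⟫ = |r - ⟪ψ, a⟫| + 1 := div_mul_cancel₀ _ (by linarith)
  have h3 := le_abs_self (r - ⟪ψ, a⟫)
  linarith

theorem inner_eq_integral_dart (a b : Lp ℝ 2 (dartMeasure P)) :
    ⟪a, b⟫ = ∫ q, a q * b q ∂(dartMeasure P) := by
  rw [L2.inner_def]
  refine integral_congr_ae (ae_of_all _ fun q => ?_)
  simp [mul_comm]

/-- The gradient of a bounded function has mean zero over the open edges. -/
theorem integral_gradient_dart (hP : Admissible P) {g : Config d m → ℝ} (hg : Measurable g) :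
    ∫ q, (g q.1 - g (shift q.2.1 q.1)) ∂(dartMeasure P) = 0 := by
  have hmp := measurePreserving_revDart hP
  set F : Config d m × Dir d → ℝ := fun q => g q.1 - g (shift q.2.1 q.1) with hF
  have hFm : Measurable F := measurable_pair (F := fun ω e => g ω - g (shift e.1 ω))
    fun e => hg.sub (hg.comp (measurable_shift e.1))
  have h1 : ∫ q, F (revDart q) ∂(dartMeasure P) = ∫ q, F q ∂(dartMeasure P) := by
    have := integral_map (μ := dartMeasure P) hmp.measurable.aemeasurable (f := F)
      hFm.aestronglyMeasurable
    rw [hmp.map_eq] at this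
    exact this.symm
  have h2 : ∀ q, F (revDart q) = -F q := by
    intro q
    simp only [hF, revDart]
    rw [shift_shift]
    simp
  rw [integral_congr_ae (ae_of_all _ h2), integral_neg] at h1
  linarith

theorem memLp_bounded_gradient [IsFiniteMeasure (dartMeasure P)]
    {g : Config d m → ℝ} (hg : Measurable g) (hgb : ∃ C : ℝ, ∀ ω, |g ω| ≤ C) :
    MemLp (fun q : Config d m × Dir d => g q.1 - g (shift q.2.1 q.1)) 2 (dartMeasure P) := by
  obtain ⟨C, hC⟩ := hgb
  refine MemLp.of_bound (measurable_pair (F := fun ω e => g ω - g (shift e.1 ω))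
    fun e => hg.sub (hg.comp (measurable_shift e.1))).aestronglyMeasurable (C + C)
    (ae_of_all _ fun q => (abs_sub _ _).trans (add_le_add (hC _) (hC _)))

theorem memLp_outMass [IsFiniteMeasure (dartMeasure P)] {u : Config d m × Dir d → ℝ}
    (hum : Measurable u) (hu2 : MemLp u 2 (dartMeasure P)) :
    MemLp (outMass u) 2 (P0 P) := by
  refine memLp_finsetSum _ fun e _ => ?_
  have hm : Measurable fun ω : Config d m => openInd ω e * u (ω, e) :=
    (measurable_openInd e).mul (hum.comp (measurableEmbedding_pair e).measurable)
  rw [memLp_two_iff_integrable_sq hm.aestronglyMeasurable]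
  refine (integrable_dartMeasure_iff.1 hu2.integrable_sq e).congr (ae_of_all _ fun ω => ?_)
  by_cases he : (openGraph ω).Adj 0 e.1
  · simp [openInd_of_adj he]
  · simp [openInd_of_not_adj he]

theorem memLp_fst_dart {F : Config d m → ℝ} (hF : Measurable F) (hF2 : MemLp F 2 (P0 P)) :
    MemLp (fun q : Config d m × Dir d => F q.1) 2 (dartMeasure P) := by
  have hm : Measurable fun q : Config d m × Dir d => F q.1 := hF.comp measurable_fst
  rw [memLp_two_iff_integrable_sq hm.aestronglyMeasurable, integrable_dartMeasure_iff]
  intro e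
  refine hF2.integrable_sq.bdd_mul (c := 1) (measurable_openInd e).aestronglyMeasurable
    (ae_of_all _ fun ω => ?_)
  rw [Real.norm_of_nonneg (openInd_nonneg ω e)]
  exact openInd_le_one ω e

/-- Every value below the infimum of `Λ` is reached by the mean gain of a stationary random walk
whose invariant density is positive. -/
theorem exists_stationary_kernel [IsProbabilityMeasure P] (hP : Admissible P)
    (hf : ∀ e, Measurable fun ω => f (ω, e)) (hC : ∀ q, |f q| ≤ C)
    (hc : (c : EReal) < infLam P f) :
    ∃ φ : Config d m → ℝ, ∃ k : Config d m → Dir d → ℝ, IsDensity P φ ∧ IsKernel P k ∧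
      (∀ᵐ ω ∂(P0 P), 0 < φ ω) ∧
      (∀ g : Config d m → ℝ, Measurable g → (∃ C : ℝ, ∀ ω, |g ω| ≤ C) →
        ∫ ω, ∑ e, φ ω * k ω e * (g ω - g (shift e.1 ω)) ∂(P0 P) = 0) ∧
      c ≤ ∫ ω, φ ω * stepGain f k ω ∂(P0 P) := by
  have hfin := isFiniteMeasure_dartMeasure hP
  have := hP.isProbabilityMeasure_P0
  have hC0 : 0 ≤ C := by
    obtain ⟨ω, h0⟩ := (ae_P0_mem P).exists
    obtain ⟨e, -⟩ := exists_adj_of_mem_Omega0 h0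
    exact (abs_nonneg _).trans (hC (ω, e))
  have hfm : Measurable f := measurable_pair (F := fun ω e => f (ω, e)) hf
  obtain ⟨ψ, δ, hδ, horth, hsep⟩ := exists_separating_edge_function hP hC hc
  have hψ0 := ae_nonneg_of_inner_subSolutions_le hC hsep
  have hψm : Measurable ψ := (Lp.stronglyMeasurable ψ).measurable
  have hlogcard : 0 ≤ Real.log (Fintype.card (Dir d)) := Real.log_natCast_nonneg _
  set K : ℝ := |c| + Real.log (Fintype.card (Dir d)) + C with hK
  have hK0 : 0 ≤ K := by positivity
  set M : ℝ := (dartMeasure P).real univ with hM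
  have hM0 : 0 ≤ M := measureReal_nonneg
  -- the perturbation costs at most `ε K M ≤ δ`
  set ε : ℝ := δ / (K * M + 1) with hε
  have hε0 : 0 < ε := by positivity
  have hεKM : ε * K * M ≤ δ := by
    rw [hε, div_mul_eq_mul_div, div_mul_eq_mul_div, div_le_iff₀ (by positivity)]
    nlinarith
  set u : Config d m × Dir d → ℝ := fun q => max (ψ q) 0 + ε with hu
  have hum : Measurable u := (hψm.max measurable_const).add_const ε
  have huε : ∀ q, ε ≤ u q := fun q => le_add_of_nonneg_left (le_max_right _ _)
  have hu0 : ∀ q, 0 ≤ u q := fun q => hε0.le.trans (huε q)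
  have hueq : ∀ᵐ q ∂(dartMeasure P), u q = ψ q + ε := by
    filter_upwards [hψ0] with q hq
    have hq' : 0 ≤ ψ q := hq
    simp only [hu]
    rw [max_eq_left hq']
  have hu2 : MemLp u 2 (dartMeasure P) := by
    refine ((Lp.memLp ψ).add (memLp_const ε)).ae_eq ?_
    filter_upwards [hueq] with q hq
    rw [hq]
    rfl
  have hk := isKernel_outKernel P hum hε0 huε
  have hmass2 := memLp_outMass hum hu2
  have hmassm := measurable_outMass hum
  have hmassi : Integrable (outMass u) (P0 P) := hmass2.integrable one_le_two
  set Z : ℝ := ∫ ω, outMass u ω ∂(P0 P) with hZ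
  have hZ0 : 0 < Z := by
    have h1 : ∫ _ω, ε ∂(P0 P) ≤ Z := by
      refine integral_mono_ae (integrable_const ε) hmassi ?_
      filter_upwards [ae_P0_mem P] with ω h0
      exact le_outMass hε0.le huε h0
    rw [integral_const, probReal_univ, one_smul] at h1
    exact hε0.trans_le h1
  have hφ : IsDensity P fun ω => Z⁻¹ * outMass u ω :=
    { measurable := hmassm.const_mul _
      nonneg := fun ω => mul_nonneg (inv_nonneg.2 hZ0.le) (outMass_nonneg hu0 ω)
      integrable := hmassi.const_mul _
      integral_eq_one := by
        rw [integral_const_mul]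
        exact inv_mul_cancel₀ hZ0.ne' }
  refine ⟨_, outKernel u, hφ, hk, ?_, ?_, ?_⟩
  · filter_upwards [ae_P0_mem P] with ω h0
    exact mul_pos (inv_pos.2 hZ0) (hε0.trans_le (le_outMass hε0.le huε h0))
  · intro g hg hgb
    have hgm := memLp_bounded_gradient (P := P) hg hgb
    set F : Config d m × Dir d → ℝ := fun q => g q.1 - g (shift q.2.1 q.1) with hF
    have h1 : ∫ q, u q * F q ∂(dartMeasure P) = 0 := by
      have e1 : Integrable (fun q => ψ q * F q) (dartMeasure P) :=
        (Lp.memLp ψ).integrable_mul hgm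
      have e2 : Integrable (fun q => ε * F q) (dartMeasure P) :=
        (hgm.integrable one_le_two).const_mul ε
      have e3 : ∫ q, ψ q * F q ∂(dartMeasure P) = 0 := by
        rw [← horth (hgm.toLp F) ⟨g, hg, hgb, hgm.coeFn_toLp⟩, inner_eq_integral_dart]
        refine integral_congr_ae ?_
        filter_upwards [hgm.coeFn_toLp] with q hq
        rw [hq]
      calc ∫ q, u q * F q ∂(dartMeasure P) =
            ∫ q, (ψ q * F q + ε * F q) ∂(dartMeasure P) := by
            refine integral_congr_ae ?_
            filter_upwards [hueq] with q hq
            rw [hq]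
            ring
        _ = 0 := by
          rw [integral_add e1 e2, e3, integral_const_mul, integral_gradient_dart hP hg]
          ring
    have hi : Integrable (fun q => u q * F q) (dartMeasure P) := hu2.integrable_mul hgm
    rw [integral_dartMeasure hi] at h1
    have h2 : ∀ ω, ∑ e, Z⁻¹ * outMass u ω * outKernel u ω e * (g ω - g (shift e.1 ω)) =
        Z⁻¹ * ∑ e, openInd ω e * (u (ω, e) * F (ω, e)) := by
      intro ω
      rw [Finset.mul_sum]
      refine Finset.sum_congr rfl fun e _ => ?_
      rw [mul_assoc Z⁻¹, outMass_mul_outKernel hu0]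
      ring
    simp only [h2]
    rw [integral_const_mul, h1, mul_zero]
  · -- test the separation with the logarithmic transform of the kernel
    set L : Config d m × Dir d → ℝ := fun q => Real.log (outKernel u q.1 q.2 / stepProb q.1 q.2)
      with hL
    set G : Config d m × Dir d → ℝ := fun q => c + L q - f q with hG
    have hLm : Measurable L := measurable_pair
      (F := fun ω e => Real.log (outKernel u ω e / stepProb ω e))
      fun e => ((hk.measurable e).div (measurable_stepProb e)).log
    have hGm : Measurable G := (hLm.const_add c).sub hfm
    have hbounds : ∀ᵐ q ∂(dartMeasure P), L q ≤ Real.log (Fintype.card (Dir d)) ∧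
        -(outMass u q.1 / ε) ≤ L q := by
      rw [ae_dartMeasure_iff]
      filter_upwards [ae_P0_mem P] with ω h0 e he
      exact log_outKernel_div_bounds hε0 huε h0 he
    have hG2 : MemLp G 2 (dartMeasure P) := by
      have h1 : MemLp (fun q : Config d m × Dir d => K + ε⁻¹ * outMass u q.1) 2 (dartMeasure P) :=
        (memLp_const K).add ((memLp_fst_dart hmassm hmass2).const_mul ε⁻¹)
      refine h1.mono hGm.aestronglyMeasurable ?_
      filter_upwards [hbounds] with q ⟨h2, h3⟩
      have h4 := abs_le.1 (hC q)
      have h5 := neg_abs_le c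
      have h6 := le_abs_self c
      have h7 : 0 ≤ ε⁻¹ * outMass u q.1 :=
        mul_nonneg (inv_nonneg.2 hε0.le) (outMass_nonneg hu0 q.1)
      rw [div_eq_inv_mul] at h3
      rw [Real.norm_eq_abs, Real.norm_of_nonneg (by linarith)]
      exact abs_le.2 ⟨by simp only [hG]; linarith [h4.2], by simp only [hG]; linarith [h4.1]⟩
    have hmem : hG2.toLp G ∈ subSolutions P f c := by
      filter_upwards [partitionSum_congr f hG2.coeFn_toLp, hk.sum_eq_one, ae_P0_mem P]
        with ω h1 h2 h0
      rw [h1]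
      have h3 : ∀ e, stepProb ω e * Real.exp (f (ω, e) + G (ω, e)) =
          Real.exp c * outKernel u ω e := by
        intro e
        by_cases he : (openGraph ω).Adj 0 e.1
        · have hs : stepProb ω e ≠ 0 := fun h => (stepProb_eq_zero_iff h0 e).1 h he
          have hs0 : 0 < stepProb ω e := lt_of_le_of_ne (stepProb_nonneg ω e) hs.symm
          have hk0 : 0 < outKernel u ω e := lt_of_le_of_ne (hk.mem_Icc ω e).1
            fun h => hs ((hk.zero_iff ω h0 e).1 h.symm)
          have e1 : f (ω, e) + G (ω, e) = c + L (ω, e) := by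
            simp only [hG]
            ring
          rw [e1, Real.exp_add]
          simp only [hL]
          rw [Real.exp_log (by positivity)]
          field_simp
        · rw [stepProb_of_not_adj he, (hk.zero_iff ω h0 e).2 (stepProb_of_not_adj he)]
          ring
      unfold partitionSum
      simp only [h3]
      rw [← Finset.mul_sum, h2, mul_one]
    have hψG : ∫ q, ψ q * G q ∂(dartMeasure P) ≤ -δ := by
      have h1 := hsep _ hmem
      rw [inner_eq_integral_dart] at h1
      refine le_trans (le_of_eq (integral_congr_ae ?_)) h1
      filter_upwards [hG2.coeFn_toLp] with q hq
      rw [hq]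
    have hGint : Integrable G (dartMeasure P) := hG2.integrable one_le_two
    have hεG : ∫ q, ε * G q ∂(dartMeasure P) ≤ δ := by
      have h1 : ∫ q, G q ∂(dartMeasure P) ≤ K * M := by
        calc ∫ q, G q ∂(dartMeasure P) ≤ ∫ _q, K ∂(dartMeasure P) := by
              refine integral_mono_ae hGint (integrable_const K) ?_
              filter_upwards [hbounds] with q ⟨h2, _⟩
              have h4 := abs_le.1 (hC q)
              have h6 := le_abs_self c
              simp only [hG]
              linarith [h4.1]
          _ = K * M := by rw [integral_const, smul_eq_mul, mul_comm]
      rw [integral_const_mul]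
      calc ε * ∫ q, G q ∂(dartMeasure P) ≤ ε * (K * M) := mul_le_mul_of_nonneg_left h1 hε0.le
        _ = ε * K * M := by ring
        _ ≤ δ := hεKM
    have huG : ∫ q, u q * G q ∂(dartMeasure P) ≤ 0 := by
      have e1 : Integrable (fun q => ψ q * G q) (dartMeasure P) := (Lp.memLp ψ).integrable_mul hG2
      have e2 : Integrable (fun q => ε * G q) (dartMeasure P) := hGint.const_mul ε
      calc ∫ q, u q * G q ∂(dartMeasure P) =
            ∫ q, (ψ q * G q + ε * G q) ∂(dartMeasure P) := by
            refine integral_congr_ae ?_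
            filter_upwards [hueq] with q hq
            rw [hq]
            ring
        _ ≤ 0 := by
          rw [integral_add e1 e2]
          linarith
    have hi : Integrable (fun q => u q * G q) (dartMeasure P) := hu2.integrable_mul hG2
    rw [integral_dartMeasure hi] at huG
    have hpt : ∀ ω, ∑ e, openInd ω e * (u (ω, e) * G (ω, e)) =
        c * outMass u ω - outMass u ω * stepGain f (outKernel u) ω := by
      intro ω
      rw [stepGain, Finset.mul_sum, outMass, Finset.mul_sum, ← outMass,
        ← Finset.sum_sub_distrib]
      refine Finset.sum_congr rfl fun e _ => ?_
      rw [← mul_assoc (outMass u ω), outMass_mul_outKernel hu0]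
      simp only [hG, hL]
      ring
    simp only [hpt] at huG
    have hgi : Integrable (fun ω => outMass u ω * stepGain f (outKernel u) ω) (P0 P) := by
      refine hmassi.mul_bdd (measurable_stepGain hf hk.measurable).aestronglyMeasurable
        (c := Fintype.card (Dir d) * (C + (1 + Real.log (Fintype.card (Dir d))))) ?_
      filter_upwards [ae_P0_mem P] with ω h0
      exact abs_stepGain_le hC hk.mem_Icc hk.zero_iff h0
    have hci : Integrable (fun ω => c * outMass u ω) (P0 P) := hmassi.const_mul c
    rw [integral_sub hci hgi, integral_const_mul] at huG
    simp only [mul_assoc]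
    rw [integral_const_mul, ← div_eq_inv_mul, le_div_iff₀ hZ0]
    linarith

end Admissible

end Perc

namespace Perc

open Filter Topology

variable {d : ℕ} {m : Model}

/-! ### Stationary kernels as pair measures -/

section KernelToPair

variable {P : Measure (Config d m)} {φ : Config d m → ℝ} {k : Config d m → Dir d → ℝ}

/-- The probability measure with density `φ` with respect to `ℙ_0`. -/
noncomputable def densityMeasure (P : Measure (Config d m)) (φ : Config d m → ℝ) :
    Measure (Config d m) := (P0 P).withDensity fun ω => ENNReal.ofReal (φ ω)

/-- The joint law of the environment, with density `φ`, and of a step of the kernel `k`. -/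
noncomputable def stepMeasure (P : Measure (Config d m)) (φ : Config d m → ℝ)
    (k : Config d m → Dir d → ℝ) : Measure (Config d m × Dir d) :=
  pairMeasure fun e => (densityMeasure P φ).withDensity fun ω => ENNReal.ofReal (k ω e)

theorem densityMeasure_absolutelyContinuous : densityMeasure P φ ≪ P0 P :=
  withDensity_absolutelyContinuous _ _

theorem isProbabilityMeasure_densityMeasure (hφ : IsDensity P φ) :
    IsProbabilityMeasure (densityMeasure P φ) := by
  refine ⟨?_⟩
  rw [densityMeasure, withDensity_apply _ MeasurableSet.univ, Measure.restrict_univ,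
    ← ofReal_integral_eq_lintegral_ofReal hφ.integrable (ae_of_all _ hφ.nonneg),
    hφ.integral_eq_one, ENNReal.ofReal_one]

theorem marg1_stepMeasure (hk : IsKernel P k) :
    marg1 (stepMeasure P φ k) = densityMeasure P φ := by
  rw [marg1_eq_sum_slice]
  simp only [stepMeasure, slice_pairMeasure]
  have hkm : ∀ e, Measurable fun ω => ENNReal.ofReal (k ω e) := fun e =>
    (hk.measurable e).ennreal_ofReal
  ext s hs
  rw [Measure.finsetSum_apply]
  simp only [withDensity_apply _ hs]
  rw [← lintegral_finsetSum _ fun e _ => hkm e]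
  have h1 : ∀ᵐ ω ∂(densityMeasure P φ), ∑ e, ENNReal.ofReal (k ω e) = 1 := by
    filter_upwards [densityMeasure_absolutelyContinuous.ae_le hk.sum_eq_one] with ω hω
    rw [← ENNReal.ofReal_sum_of_nonneg fun e _ => (hk.mem_Icc ω e).1, hω, ENNReal.ofReal_one]
  rw [lintegral_congr_ae (ae_restrict_of_ae h1), setLIntegral_one]

theorem slice_stepMeasure_real (hφ : IsDensity P φ) (hk : IsKernel P k) (e : Dir d)
    {s : Set (Config d m)} (hs : MeasurableSet s) :
    (slice (stepMeasure P φ k) e).real s =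
      ∫ ω, φ ω * k ω e * s.indicator (fun _ => 1) ω ∂(P0 P) := by
  rw [stepMeasure, slice_pairMeasure, ← integral_indicator_one hs,
    integral_withDensity_eq_integral_toReal_smul (hk.measurable e).ennreal_ofReal
      (ae_of_all _ fun _ => ENNReal.ofReal_lt_top), densityMeasure,
    integral_withDensity_eq_integral_toReal_smul hφ.measurable.ennreal_ofReal
      (ae_of_all _ fun _ => ENNReal.ofReal_lt_top)]
  refine integral_congr_ae (ae_of_all _ fun ω => ?_)
  simp only [smul_eq_mul]
  rw [ENNReal.toReal_ofReal (hφ.nonneg ω), ENNReal.toReal_ofReal (hk.mem_Icc ω e).1, mul_assoc]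
  rfl

variable [IsProbabilityMeasure P]

/-- Positivity of the density turns almost sure statements for the first marginal into almost sure
statements for `ℙ_0`. -/
theorem condStep_stepMeasure (hP : Admissible P) (hφ : IsDensity P φ) (hk : IsKernel P k)
    (hpos : ∀ᵐ ω ∂(P0 P), 0 < φ ω) :
    ∀ᵐ ω ∂(P0 P), ∀ e, condStep (stepMeasure P φ k) ω e = ENNReal.ofReal (k ω e) := by
  have := hP.isProbabilityMeasure_P0
  have := isProbabilityMeasure_densityMeasure hφ
  have hac : P0 P ≪ densityMeasure P φ := by
    refine withDensity_absolutelyContinuous' hφ.measurable.ennreal_ofReal.aemeasurable ?_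
    filter_upwards [hpos] with ω hω
    exact (ENNReal.ofReal_pos.2 hω).ne'
  refine ae_all_iff.2 fun e => hac.ae_le ?_
  have h1 := Measure.rnDeriv_withDensity (densityMeasure P φ) (hk.measurable e).ennreal_ofReal
  unfold condStep
  rw [marg1_stepMeasure hk, stepMeasure, slice_pairMeasure]
  exact h1

/-- Stationarity, tested with indicator functions, is equality of the two marginals. -/
theorem mStar_stepMeasure (hP : Admissible P) (hφ : IsDensity P φ) (hk : IsKernel P k)
    (hpos : ∀ᵐ ω ∂(P0 P), 0 < φ ω)
    (hst : ∀ g : Config d m → ℝ, Measurable g → (∃ C : ℝ, ∀ ω, |g ω| ≤ C) →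
      ∫ ω, ∑ e, φ ω * k ω e * (g ω - g (shift e.1 ω)) ∂(P0 P) = 0) :
    MStar P (stepMeasure P φ k) := by
  have := isProbabilityMeasure_densityMeasure hφ
  have hm1 := marg1_stepMeasure (φ := φ) hk
  have hprob : IsProbabilityMeasure (stepMeasure P φ k) := by
    refine ⟨?_⟩
    have h1 : marg1 (stepMeasure P φ k) univ = 1 := by
      rw [hm1]
      exact measure_univ
    rwa [marg1, Measure.map_apply measurable_fst MeasurableSet.univ, preimage_univ] at h1
  have hac : marg1 (stepMeasure P φ k) ≪ P0 P := hm1 ▸ densityMeasure_absolutelyContinuous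
  have hsm : Measurable fun q : Config d m × Dir d => shift q.2.1 q.1 :=
    measurable_from_prod_countable_left fun e => measurable_shift e.1
  refine ⟨hprob, ?_, ?_, hac, ?_⟩
  · have h1 : marg1 (stepMeasure P φ k) (Omega0 d m)ᶜ = 0 := hac (ae_P0_mem P)
    rw [marg1, Measure.map_apply measurable_fst measurableSet_Omega0.compl] at h1
    rwa [prod_univ]
  · have hslice := isFiniteMeasure_slice (stepMeasure P φ k)
    have := isProbabilityMeasure_marg1 (stepMeasure P φ k)
    have : IsProbabilityMeasure (marg2 (stepMeasure P φ k)) :=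
      Measure.isProbabilityMeasure_map hsm.aemeasurable
    have hint : ∀ e, ∀ s : Set (Config d m), MeasurableSet s →
        Integrable (fun ω => φ ω * k ω e * s.indicator (fun _ => (1 : ℝ)) ω) (P0 P) := by
      intro e s hs
      have h1 : Measurable fun ω => k ω e * s.indicator (fun _ => (1 : ℝ)) ω :=
        (hk.measurable e).mul (measurable_const.indicator hs)
      refine (hφ.integrable_mul_bdd h1 (C := 1) fun ω _ => ?_).congr
        (ae_of_all _ fun ω => (mul_assoc _ _ _).symm)
      have h2 := hk.mem_Icc ω e
      by_cases hω : ω ∈ s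
      · rw [indicator_of_mem hω, mul_one, abs_of_nonneg h2.1]
        exact h2.2
      · rw [indicator_of_notMem hω, mul_zero, abs_zero]
        exact zero_le_one
    ext s hs
    have hpre : ∀ e : Dir d, MeasurableSet (shift e.1 ⁻¹' s : Set (Config d m)) := fun e =>
      measurable_shift e.1 hs
    have e1 : marg1 (stepMeasure P φ k) s =
        ENNReal.ofReal (∑ e, (slice (stepMeasure P φ k) e).real s) := by
      rw [marg1_eq_sum_slice, Measure.finsetSum_apply,
        ENNReal.ofReal_sum_of_nonneg fun _ _ => measureReal_nonneg]
      exact Finset.sum_congr rfl fun e _ => (ofReal_measureReal).symm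
    have e2 : marg2 (stepMeasure P φ k) s =
        ENNReal.ofReal (∑ e, (slice (stepMeasure P φ k) e).real (shift e.1 ⁻¹' s)) := by
      rw [marg2, Measure.map_apply hsm hs, stepMeasure, pairMeasure_apply, ← stepMeasure,
        ENNReal.ofReal_sum_of_nonneg fun _ _ => measureReal_nonneg]
      refine Finset.sum_congr rfl fun e _ => ?_
      rw [ofReal_measureReal, stepMeasure, slice_pairMeasure]
      rfl
    rw [e1, e2]
    congr 1
    rw [← sub_eq_zero, ← Finset.sum_sub_distrib,
      ← hst (s.indicator fun _ => 1) (measurable_const.indicator hs) ⟨1, fun ω => by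
        by_cases hω : ω ∈ s <;> simp [hω]⟩]
    have h3 : ∀ e : Dir d, ∀ ω : Config d m, φ ω * k ω e *
        (s.indicator (fun _ => (1 : ℝ)) ω - s.indicator (fun _ => (1 : ℝ)) (shift e.1 ω)) =
        φ ω * k ω e * s.indicator (fun _ => (1 : ℝ)) ω -
        φ ω * k ω e * (shift e.1 ⁻¹' s).indicator (fun _ => (1 : ℝ)) ω := by
      intro e ω
      rw [mul_sub]
      rfl
    simp only [h3]
    have h4 : ∀ e : Dir d, Integrable (fun ω => φ ω * k ω e * s.indicator (fun _ => (1 : ℝ)) ω -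
        φ ω * k ω e * (shift e.1 ⁻¹' s).indicator (fun _ => (1 : ℝ)) ω) (P0 P) := fun e =>
      (hint e s hs).sub (hint e _ (hpre e))
    rw [integral_finsetSum _ fun e _ => h4 e]
    refine Finset.sum_congr rfl fun e _ => ?_
    rw [integral_sub (hint e s hs) (hint e _ (hpre e)), slice_stepMeasure_real hφ hk e hs,
      slice_stepMeasure_real hφ hk e (hpre e)]
  · filter_upwards [condStep_stepMeasure hP hφ hk hpos, ae_P0_mem P] with ω h1 h0 e
    rw [h1, ENNReal.ofReal_pos, (hk.mem_Icc ω e).1.lt_iff_ne', ne_eq, hk.zero_iff ω h0,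
      stepProb_eq_zero_iff h0, not_not]

/-- The mean gain of a stationary kernel is dominated by the lower variational formula. -/
theorem integral_stepGain_le_HBar {f : Config d m × Dir d → ℝ} (hP : Admissible P)
    (hf : ∀ e, Measurable fun ω => f (ω, e)) {C : ℝ} (hC : ∀ q, |f q| ≤ C)
    (hφ : IsDensity P φ) (hk : IsKernel P k) (hpos : ∀ᵐ ω ∂(P0 P), 0 < φ ω)
    (hst : ∀ g : Config d m → ℝ, Measurable g → (∃ C : ℝ, ∀ ω, |g ω| ≤ C) →
      ∫ ω, ∑ e, φ ω * k ω e * (g ω - g (shift e.1 ω)) ∂(P0 P) = 0) :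
    ((∫ ω, φ ω * stepGain f k ω ∂(P0 P) : ℝ) : EReal) ≤ HBar P f := by
  have hprob := hP.isProbabilityMeasure_P0
  have hμ := mStar_stepMeasure hP hφ hk hpos hst
  refine le_iSup₂_of_le _ hμ ?_
  rw [entropyI, if_pos hμ, ← EReal.coe_sub, EReal.coe_le_coe_iff,
    hμ.integral_sub_entropy hP hf hC]
  refine le_of_eq (integral_congr_ae ?_)
  have hdens : ∀ᵐ ω ∂(P0 P), margDensity P (stepMeasure P φ k) ω = φ ω := by
    unfold margDensity
    rw [marg1_stepMeasure hk]
    filter_upwards [Measure.rnDeriv_withDensity (P0 P) hφ.measurable.ennreal_ofReal] with ω hω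
    rw [densityMeasure, hω, ENNReal.toReal_ofReal (hφ.nonneg ω)]
  filter_upwards [hdens, condStep_stepMeasure hP hφ hk hpos, hμ.pos_iff, hk.sum_eq_one]
    with ω h1 h2 h3 h4
  have hgood : ω ∈ goodStep (stepMeasure P φ k) := by
    refine ⟨?_, h3⟩
    simp only [h2]
    rw [← ENNReal.ofReal_sum_of_nonneg fun e _ => (hk.mem_Icc ω e).1, h4, ENNReal.ofReal_one]
  have h5 : ∀ e, stepKernel (stepMeasure P φ k) ω e = k ω e := fun e => by
    rw [stepKernel, if_pos hgood, h2, ENNReal.toReal_ofReal (hk.mem_Icc ω e).1]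
  simp only [stepGain, h1, h5]

/-- Every `c` below the infimum is attained by a stationary kernel, hence by a pair measure. -/
theorem infLam_le_HBar {f : Config d m × Dir d → ℝ} (hP : Admissible P)
    (hf : ∀ e, Measurable fun ω => f (ω, e)) {C : ℝ} (hC : ∀ q, |f q| ≤ C) :
    infLam P f ≤ HBar P f := by
  refine EReal.ge_of_forall_gt_iff_ge.1 fun c hc => ?_
  obtain ⟨φ, k, hφ, hk, hpos, hst, hle⟩ := exists_stationary_kernel hP hf hC hc
  exact (EReal.coe_le_coe_iff.2 hle).trans
    (integral_stepGain_le_HBar hP hf hC hφ hk hpos hst)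

end KernelToPair

/-! ### Reduction to bounded measurable functions -/

section Reduction

variable {P : Measure (Config d m)} {f f' : Config d m × Dir d → ℝ}

theorem countable_index (d : ℕ) (m : Model) : Countable (Index d m) := by
  cases m with
  | bond => exact inferInstanceAs (Countable (lattice d).edgeSet)
  | site => exact inferInstanceAs (Countable (Lat d))

/-- Only the values of `f` on `Ω_0` matter; likewise for the other two expressions. -/
theorem infLam_congr (h : ∀ ω ∈ Omega0 d m, ∀ e, f (ω, e) = f' (ω, e)) :
    infLam P f = infLam P f' := by
  refine iInf_congr fun G => iInf_congr fun _ => essSup_congr_ae ?_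
  filter_upwards [ae_P0_mem P] with ω h0
  simp only [h ω h0]

theorem HBarSaddle_congr (h : ∀ ω ∈ Omega0 d m, ∀ e, f (ω, e) = f' (ω, e)) :
    HBarSaddle P f = HBarSaddle P f' := by
  refine iSup_congr fun φ => iSup_congr fun _ => iSup_congr fun k => iSup_congr fun _ =>
    iInf_congr fun g => iInf_congr fun _ => ?_
  congr 1
  refine integral_congr_ae ?_
  filter_upwards [ae_P0_mem P] with ω h0
  simp only [h ω h0]

theorem HBar_congr (h : ∀ ω ∈ Omega0 d m, ∀ e, f (ω, e) = f' (ω, e)) :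
    HBar P f = HBar P f' := by
  refine iSup_congr fun μ => iSup_congr fun hμ => ?_
  congr 2
  refine integral_congr_ae ?_
  have h1 : ∀ᵐ q ∂μ, q ∉ (Omega0 d m)ᶜ ×ˢ (univ : Set (Dir d)) :=
    measure_eq_zero_iff_ae_notMem.1 hμ.supported
  filter_upwards [h1] with q hq
  refine h q.1 (by_contra fun hn => hq ⟨hn, mem_univ _⟩) q.2

end Reduction

end Perc

theorem theorem5p1 {d : ℕ} (hd : 2 ≤ d) {m : Perc.Model}
    (P : Measure (Perc.Config d m)) [IsProbabilityMeasure P] (hP : Perc.Admissible P)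
    (f : Perc.Config d m × Perc.Dir d → ℝ)
    (hf_cont : ContinuousOn f (Perc.Omega0 d m ×ˢ univ))
    (hf_bdd : ∃ C : ℝ, ∀ q ∈ Perc.Omega0 d m ×ˢ (univ : Set (Perc.Dir d)), |f q| ≤ C) :
    Perc.HBar P f = Perc.infLam P f ∧ Perc.HBarSaddle P f = Perc.infLam P f := by
  obtain ⟨C, hC⟩ := hf_bdd
  -- extension by zero outside of `Ω_0`, where `f` is arbitrary
  set F : Perc.Config d m × Perc.Dir d → ℝ :=
    fun q => (Perc.Omega0 d m).indicator (fun ω => f (ω, q.2)) q.1 with hF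
  have hFf : ∀ ω ∈ Perc.Omega0 d m, ∀ e, f (ω, e) = F (ω, e) := fun ω h0 e =>
    (indicator_of_mem h0 fun ω => f (ω, e)).symm
  have hFm : ∀ e, Measurable fun ω => F (ω, e) := by
    intro e
    have h1 : ContinuousOn (fun ω => f (ω, e)) (Perc.Omega0 d m) :=
      hf_cont.comp (Continuous.prodMk_left e).continuousOn fun ω h0 => ⟨h0, mem_univ e⟩
    have := Perc.countable_index d m
    classical
    have h2 := h1.measurable_piecewise (continuousOn_const (c := (0 : ℝ)))
      Perc.measurableSet_Omega0
    change Measurable ((Perc.Omega0 d m).indicator fun ω => f (ω, e))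
    rw [← piecewise_eq_indicator]
    exact h2
  have hFC : ∀ q, |F q| ≤ |C| := by
    intro q
    by_cases h0 : q.1 ∈ Perc.Omega0 d m
    · simp only [hF, indicator_of_mem h0]
      exact (hC _ ⟨h0, mem_univ _⟩).trans (le_abs_self C)
    · simp only [hF, indicator_of_notMem h0, abs_zero]
      exact abs_nonneg C
  rw [Perc.HBar_congr hFf, Perc.infLam_congr hFf, Perc.HBarSaddle_congr hFf]
  have h1 := Perc.HBar_le_HBarSaddle hP hFm hFC
  have h2 := Perc.HBarSaddle_le_infLam (by omega) hP hFm hFC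
  have h3 := Perc.infLam_le_HBar hP hFm hFC
  exact ⟨le_antisymm (h1.trans h2) h3, le_antisymm h2 (h3.trans h1)⟩
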